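/- **Setting.** All functions are real valued. Notation: $\|g\|_K=\sup_{x\in K}|g(x)|$. *Data space.* A (compact) data space $\Xi=(\mathbb X,d,\mu^*,\{\lambda_k\}_{k\ge 0},\{\phi_k\}_{k\ge 0})$ consists of a compact metric space $(\mathbb X,d)$, a Borel probability measure $\mu^*$, a non-decreasing real sequence with $\lambda_0=0$, $\lambda_k\to\infty$, and continuous functions $\phi_k$, orthonormal in $L^2(\mu^*)$, such that for some $q\ge1$, $\kappa,\kappa_1,\kappa_2>0$: (i) with $\mathbb B(x,r)=\{y:d(x,y)\le r\}$, $\mu^*(\mathbb B(x,r))=\mu^*(\{y:d(x,y)<r\})\le\kappa r^q$ for all $x$, $r>0$; (ii) $\sum_k e^{-\lambda_k^2t}\phi_k(x)\phi_k(y)$ converges absolutely and is bounded in absolute value by $\kappa_1t^{-q/2}e^{-\kappa_2d(x,y)^2/t}$ for all $x,y$, $0<t\le1$. Put $\Pi_n=\mathrm{span}\{\phi_k:\lambda_k<n\}$ and, for continuous $f$, $E_n(f)=\min_{P\in\Pi_n}\|f-P\|_{\mathbb X}$. For $\gamma>0$, $W_\gamma$ is the set of continuous $f$ with $E_n(f)\to0$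 and $\sup_{n>0}n^\gamma E_n(f)<\infty$; $C^\infty=\bigcap_{\gamma>0}W_\gamma$; $C^\infty(B)$ is the set of $f\in C^\infty$ vanishing outside $B$; $f\in W_\gamma(\Xi;A)$ means that for each $x_0\in A$ there is $\rho>0$ with $\phi f\in W_\gamma$ for all $\phi\in C^\infty(\mathbb B(x_0,\rho))$. Fix an even $C^\infty$ function $h:\mathbb R\to[0,1]$ with $h=1$ on $[0,1/2]$ and $h=0$ on $[1,\infty)$, and let $\sigma_n(\Xi;f)(x)=\int\sum_kh(\lambda_k/n)\phi_k(x)\phi_k(y)f(y)\,d\mu^*(y)$. $\mathbb X$ has a *partition of unity* if for each $r>0$ there are $\psi_k\in C^\infty$ ($k\ge0$) with $0\le\psi_k\le1$, $\psi_k$ supported on some ball $\mathbb B(x_k,r)$, such that for each $x$ there is a finite index set $F$, of cardinality bounded independently of $x$, with $\sum_{k\in F}\psi_k=1$ on $\mathbb B(x,r)$. $\Xi$ satisfies the *strong product assumption* if for some $A^*\ge1$, $P,R\in\Pi_n$ implies $PR\in\Pi_{A^*n}$ for all integers $n\ge1$. *Joint data space.* Given data spaces $\Xi_1,\Xi_2$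 (with data indexed by $1,2$), a joint data space $(\Xi_1,\Xi_2,d_{1,2},\mathbf A,\mathbf L)$ with exponents $(Q,q_1,q_2)$, all $>0$, consists of $d_{1,2}:\mathbb X_1\times\mathbb X_2\to[0,\infty)$ with $d_{1,2}(x_1,x_2)\le d_1(x_1,x_1')+d_{1,2}(x_1',x_2)$ and $d_{1,2}(x_1,x_2)\le d_{1,2}(x_1,x_2')+d_2(x_2',x_2)$, a real matrix $\mathbf A=(A_{j,k})_{j,k\ge 0}$ and a matrix $\mathbf L=(\ell_{j,k})_{j,k\ge 0}$ with $\ell_{j,k}\ge0$ and $\{(j,k):\ell_{j,k}<u\}$ finite for all $u$, such that for some positive constants $C_0,c,c_1,c_2$ and all $x_1\in\mathbb X_1$, $x_2\in\mathbb X_2$: (i) $\mu_1^*\{z:d_{1,2}(z,x_2)\le\rho\}\le C_0\rho^{q_1}$ and $\mu_2^*\{z:d_{1,2}(x_1,z)\le\rho\}\le C_0\rho^{q_2}$ for all $\rho>0$; (ii) $\sum_{\ell_{j,k}<n}|A_{j,k}\phi_{1,j}(x_1)\phi_{2,k}(x_2)|\le C_0n^Q$ for all integers $n\ge1$; (iii)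 for $0<t\le1$ the limit $K_t(x_1,x_2)=\lim_{n\to\infty}\sum_{\ell_{j,k}<n}e^{-\ell_{j,k}^2t}A_{j,k}\phi_{1,j}(x_1)\phi_{2,k}(x_2)$ exists and $|K_t(x_1,x_2)|\le c_1t^{-c}e^{-c_2d_{1,2}(x_1,x_2)^2/t}$. For $n>0$ put $\sigma_n(\Xi_1,\Xi_2;f)(x_1)=\int f(x_2)\sum_{j,k}h(\ell_{j,k}/n)A_{j,k}\phi_{1,j}(x_1)\phi_{2,k}(x_2)\,d\mu_2^*(x_2)$. The *polynomial preservation condition* with parameter $c^*>0$ is: for all integers $n\ge1$, $P\in\Pi_n(\Xi_2)$ and real $m\ge c^*n$, $\sigma_m(\Xi_1,\Xi_2;P)=\sigma_{c^*n}(\Xi_1,\Xi_2;P)$. The lifted function is $\mathcal E(f)=\lim_{n\to\infty}\sigma_n(\Xi_1,\Xi_2;f)$ where the limit (over real $n$) exists. For $r,s>0$ and compact $A\subseteq\mathbb X_2$, an *image set* $B=\mathcal I(r,s;A)$ is a set $\{x_1:d_1(x_1,B^-)\le s\}$, where $B^-\subseteq\mathbb X_1$ is a compact set with $\inf_{x_2\in\mathbb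 X_2\setminus A}d_{1,2}(x_1,x_2)\ge s+r$ for all $x_1\in B^-$ ($\inf\emptyset=\infty$; $B=\emptyset$ if $B^-=\emptyset$). **Theorem.** Let $(\Xi_1,\Xi_2,d_{1,2},\mathbf A,\mathbf L)$ be a joint data space with exponents $(Q,q_1,q_2)$ that satisfies the polynomial preservation condition with parameter $c^*$, suppose that $\mathbb X_2$ has a partition of unity, and let $S>\max(Q,q_1,q_2)+1$ be an integer. There is a constant $C>0$, depending only on these data, on $h$ and on $S$, such that the following holds for all $r,s>0$, all compact $A\subseteq\mathbb X_2$, all image sets $B=\mathcal I(r,s;A)$ and all $f\in C(\mathbb X_2)$ with $$\sum_{m=0}^\infty2^{m(Q-q_2)}\|\sigma_{2^{m+1}}(\Xi_2;f)-\sigma_{2^m}(\Xi_2;f)\|_A<\infty.$$ (a) $\mathcal E(f)$ exists on $B$, as a uniform limit on $B$, and for every integer $n\ge0$ with $c^*r2^n\ge1$, $$\|\mathcal E(f)-\sigma_{c^*2^n}(\Xi_1,\Xi_2;f)\|_B\le C\Big(2^{n(Q-q_2)}\|f-\sigma_{2^n}(\Xi_2;f)\|_A+\|f\|_{\mathbb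 X_2}2^{n(Q-S)}r^{q_2-S}+\sum_{m=n}^\infty2^{m(Q-q_2)}\|\sigma_{2^{m+1}}(\Xi_2;f)-\sigma_{2^m}(\Xi_2;f)\|_A\Big).$$ Moreover, if $\alpha>0$ and $\lambda_{1,j}\le\alpha\ell_{j,k}$ for all $j,k$, then $\sigma_n(\Xi_1,\Xi_2;f)\in\Pi_{\alpha n}(\Xi_1)$ for all $n>0$. (b) If in addition $f\in W_\gamma(\Xi_2;A)$ for some $\gamma>0$ with $Q-q_2<\gamma<S-q_2$, then $\mathcal E(f)$ is continuous on $B$. If moreover $\Xi_1$ satisfies the strong product assumption and there is $\alpha>0$ with $\lambda_{1,j}\le\alpha\ell_{j,k}$ for all $j,k$, then for every $\phi\in C^\infty(B)$ the function $\phi\,\mathcal E(f)$ (set to $0$ outside $B$) belongs to $W_{\gamma-Q+q_2}(\Xi_1)$. -/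

import Mathlib

open Set Filter Topology MeasureTheory
open scoped ContDiff

noncomputable section

namespace LocalTransfer

/-- A compact data space on the compact metric space `X` (with its Borel sets): a probability
measure `μ`, a non-decreasing sequence `lam` with `lam 0 = 0` tending to infinity, and a sequence
`phi` of continuous real functions, orthonormal in `L²(μ)`, that satisfy the ball measure condition
and the Gaussian upper bound with a common exponent `q`. Closed balls are compact because `X` is. -/
structure DataSpace (X : Type*) [MetricSpace X] [CompactSpace X] [MeasurableSpace X]
    [BorelSpace X] where
  μ : Measure X
  isProb : IsProbabilityMeasure μ
  lam : ℕ → ℝ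
  phi : ℕ → C(X, ℝ)
  lam_mono : Monotone lam
  lam_zero : lam 0 = 0
  lam_tendsto : Tendsto lam atTop atTop
  orthonormal : ∀ j k, ∫ x, phi j x * phi k x ∂μ = if j = k then 1 else 0
  exists_exponent : ∃ q : ℝ, 1 ≤ q ∧
    (∃ κ : ℝ, 0 < κ ∧ ∀ (x : X) (r : ℝ), 0 < r →
      μ (Metric.closedBall x r) = μ (Metric.ball x r) ∧
      μ.real (Metric.closedBall x r) ≤ κ * r ^ q) ∧
    (∃ κ₁ κ₂ : ℝ, 0 < κ₁ ∧ 0 < κ₂ ∧ ∀ (x y : X) (t : ℝ), 0 < t → t ≤ 1 →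
      Summable (fun k => Real.exp (-(lam k ^ 2 * t)) * phi k x * phi k y) ∧
      |∑' k, Real.exp (-(lam k ^ 2 * t)) * phi k x * phi k y|
        ≤ κ₁ * t ^ (-(q / 2)) * Real.exp (-(κ₂ * (dist x y ^ 2 / t))))

/-- The filter `h`, extended to an even function on `ℝ`. -/
structure IsCutoff (h : ℝ → ℝ) : Prop where
  smooth : ContDiff ℝ ∞ h
  even : ∀ t, h (-t) = h t
  mem_Icc : ∀ t, h t ∈ Icc (0 : ℝ) 1
  eq_one : ∀ t, 0 ≤ t → t ≤ 1 / 2 → h t = 1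
  eq_zero : ∀ t, 1 ≤ t → h t = 0

/-- The supremum norm of `g` on `K` (used for continuous `g` and compact `K`; it is `0` if `K` is
empty). -/
def supNormOn {X : Type*} (K : Set X) (g : X → ℝ) : ℝ := ⨆ x : K, |g x|

namespace DataSpace

variable {X : Type*} [MetricSpace X] [CompactSpace X] [MeasurableSpace X] [BorelSpace X]

/-- Diffusion polynomials of order `< n`, for real `n`. -/
def diffusionPoly (Ξ : DataSpace X) (n : ℝ) : Submodule ℝ C(X, ℝ) :=
  Submodule.span ℝ (Ξ.phi '' {k | Ξ.lam k < n})

/-- Degree of approximation of `f` from diffusion polynomials of order `< n`, in the sup norm. -/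
def degApprox (Ξ : DataSpace X) (n : ℝ) (f : C(X, ℝ)) : ℝ :=
  Metric.infDist f (Ξ.diffusionPoly n : Set C(X, ℝ))

/-- The smoothness class `W_γ` (for `p = ∞`): `f ∈ X^∞` and `sup_{n > 0} n ^ γ E_n(f) < ∞`. -/
def MemW (Ξ : DataSpace X) (γ : ℝ) (f : C(X, ℝ)) : Prop :=
  Tendsto (fun n : ℝ => Ξ.degApprox n f) atTop (𝓝 0) ∧
    BddAbove ((fun n : ℝ => n ^ γ * Ξ.degApprox n f) '' Ioi 0)

/-- The class `C^∞ = ⋂_{γ > 0} W_γ`. -/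
def IsSmooth (Ξ : DataSpace X) (f : C(X, ℝ)) : Prop := ∀ γ : ℝ, 0 < γ → Ξ.MemW γ f

/-- The class `C^∞(B)`: functions in `C^∞` supported on `B`. -/
def IsSmoothOn (Ξ : DataSpace X) (B : Set X) (f : C(X, ℝ)) : Prop :=
  Ξ.IsSmooth f ∧ ∀ x, x ∉ B → f x = 0

/-- The local class `W_γ(x₀)`. -/
def MemWAt (Ξ : DataSpace X) (γ : ℝ) (x₀ : X) (f : C(X, ℝ)) : Prop :=
  ∃ r : ℝ, 0 < r ∧
    ∀ φ : C(X, ℝ), Ξ.IsSmoothOn (Metric.closedBall x₀ r) φ → Ξ.MemW γ (φ * f)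

/-- The local class `W_γ(A) = ⋂_{x₀ ∈ A} W_γ(x₀)`. -/
def MemWOn (Ξ : DataSpace X) (γ : ℝ) (A : Set X) (f : C(X, ℝ)) : Prop :=
  ∀ x₀ ∈ A, Ξ.MemWAt γ x₀ f

/-- The kernel `Φ_n(x, y)`; for `n > 0` the sum is finite because `h` vanishes on `[1, ∞)`. -/
def kernel (Ξ : DataSpace X) (h : ℝ → ℝ) (n : ℝ) (x y : X) : ℝ :=
  ∑' k : ℕ, h (Ξ.lam k / n) * Ξ.phi k x * Ξ.phi k y

/-- The operator `σ_n(Ξ; f)`. -/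
def sigma (Ξ : DataSpace X) (h : ℝ → ℝ) (n : ℝ) (f : C(X, ℝ)) (x : X) : ℝ :=
  ∫ y, Ξ.kernel h n x y * f y ∂Ξ.μ

/-- Partition of unity. -/
def HasPartitionOfUnity (Ξ : DataSpace X) : Prop :=
  ∀ r : ℝ, 0 < r → ∃ (ψ : ℕ → C(X, ℝ)) (c : ℕ → X) (N : ℕ),
    (∀ k, Ξ.IsSmoothOn (Metric.closedBall (c k) r) (ψ k)) ∧
    (∀ k x, 0 ≤ ψ k x ∧ ψ k x ≤ 1) ∧
    ∀ x : X, ∃ F : Finset ℕ, F.card ≤ N ∧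
      ∀ y ∈ Metric.closedBall x r, ∑ k ∈ F, ψ k y = 1

/-- Strong product assumption. -/
def StrongProduct (Ξ : DataSpace X) : Prop :=
  ∃ Astar : ℝ, 1 ≤ Astar ∧ ∀ n : ℕ, 0 < n →
    ∀ P ∈ Ξ.diffusionPoly n, ∀ R ∈ Ξ.diffusionPoly n, P * R ∈ Ξ.diffusionPoly (Astar * n)

end DataSpace

/-- A joint compact data space with exponents `(Q, q₁, q₂)`: a joint distance `d`, connection
coefficients `A` and joint eigenvalues `ell` for the data spaces `Ξ₁` and `Ξ₂`. -/
structure JointDataSpace {X₁ X₂ : Type*}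
    [MetricSpace X₁] [CompactSpace X₁] [MeasurableSpace X₁] [BorelSpace X₁]
    [MetricSpace X₂] [CompactSpace X₂] [MeasurableSpace X₂] [BorelSpace X₂]
    (Ξ₁ : DataSpace X₁) (Ξ₂ : DataSpace X₂) (Q q₁ q₂ : ℝ) where
  d : X₁ → X₂ → ℝ
  A : ℕ → ℕ → ℝ
  ell : ℕ → ℕ → ℝ
  d_nonneg : ∀ x₁ x₂, 0 ≤ d x₁ x₂
  d_triangle_left : ∀ x₁ x₁' x₂, d x₁ x₂ ≤ dist x₁ x₁' + d x₁' x₂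
  d_triangle_right : ∀ x₁ x₂ x₂', d x₁ x₂ ≤ d x₁ x₂' + dist x₂' x₂
  ell_nonneg : ∀ j k, 0 ≤ ell j k
  finite_ell_lt : ∀ u : ℝ, {p : ℕ × ℕ | ell p.1 p.2 < u}.Finite
  Q_pos : 0 < Q
  q₁_pos : 0 < q₁
  q₂_pos : 0 < q₂
  regularity : ∃ c : ℝ, 0 < c ∧ ∀ (x₁ : X₁) (x₂ : X₂) (r : ℝ), 0 < r →
    Ξ₁.μ.real {z | d z x₂ ≤ r} ≤ c * r ^ q₁ ∧ Ξ₂.μ.real {z | d x₁ z ≤ r} ≤ c * r ^ q₂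
  variation : ∃ c : ℝ, 0 < c ∧ ∀ (n : ℕ), 0 < n → ∀ (x₁ : X₁) (x₂ : X₂),
    ∑ p ∈ (finite_ell_lt n).toFinset, |A p.1 p.2 * Ξ₁.phi p.1 x₁ * Ξ₂.phi p.2 x₂|
      ≤ c * (n : ℝ) ^ Q
  gaussian : ∃ c₁ c c₂ : ℝ, 0 < c₁ ∧ 0 < c ∧ 0 < c₂ ∧
    ∀ (x₁ : X₁) (x₂ : X₂) (t : ℝ), 0 < t → t ≤ 1 → ∃ K : ℝ,
      Tendsto (fun n : ℕ => ∑ p ∈ (finite_ell_lt n).toFinset,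
        Real.exp (-(ell p.1 p.2 ^ 2 * t)) * A p.1 p.2 * Ξ₁.phi p.1 x₁ * Ξ₂.phi p.2 x₂)
        atTop (𝓝 K) ∧
      |K| ≤ c₁ * t ^ (-c) * Real.exp (-(c₂ * (d x₁ x₂ ^ 2 / t)))

namespace JointDataSpace

variable {X₁ X₂ : Type*}
  [MetricSpace X₁] [CompactSpace X₁] [MeasurableSpace X₁] [BorelSpace X₁]
  [MetricSpace X₂] [CompactSpace X₂] [MeasurableSpace X₂] [BorelSpace X₂]
  {Ξ₁ : DataSpace X₁} {Ξ₂ : DataSpace X₂} {Q q₁ q₂ : ℝ}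

/-- The joint kernel `Φ_n(x₁, x₂)`; for `n > 0` the sum is finite. -/
def kernel (J : JointDataSpace Ξ₁ Ξ₂ Q q₁ q₂) (h : ℝ → ℝ) (n : ℝ) (x₁ : X₁) (x₂ : X₂) : ℝ :=
  ∑' p : ℕ × ℕ, h (J.ell p.1 p.2 / n) * J.A p.1 p.2 * Ξ₁.phi p.1 x₁ * Ξ₂.phi p.2 x₂

/-- The joint operator `σ_n(Ξ₁, Ξ₂; f)`. -/
def sigma (J : JointDataSpace Ξ₁ Ξ₂ Q q₁ q₂) (h : ℝ → ℝ) (n : ℝ) (f : C(X₂, ℝ)) (x₁ : X₁) : ℝ :=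
  ∫ x₂, f x₂ * J.kernel h n x₁ x₂ ∂Ξ₂.μ

/-- Polynomial preservation condition with parameter `cstar`. -/
def PolynomialPreservation (J : JointDataSpace Ξ₁ Ξ₂ Q q₁ q₂) (h : ℝ → ℝ) (cstar : ℝ) : Prop :=
  0 < cstar ∧ ∀ n : ℕ, 0 < n → ∀ P ∈ Ξ₂.diffusionPoly n, ∀ m : ℝ, cstar * n ≤ m →
    J.sigma h m P = J.sigma h (cstar * n) P

/-- The lifted function, the limit of `σ_n(Ξ₁, Ξ₂; f)` as `n → ∞`; it is meaningful at the points
where that limit exists. -/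
def lift (J : JointDataSpace Ξ₁ Ξ₂ Q q₁ q₂) (h : ℝ → ℝ) (f : C(X₂, ℝ)) (x₁ : X₁) : ℝ :=
  limUnder atTop (fun n : ℝ => J.sigma h n f x₁)

/-- The joint distance from a point to a subset of `X₂`, infinite for the empty set. -/
def distToSet (J : JointDataSpace Ξ₁ Ξ₂ Q q₁ q₂) (x₁ : X₁) (Y : Set X₂) : ENNReal :=
  ⨅ y ∈ Y, ENNReal.ofReal (J.d x₁ y)

/-- `B` is an image set `ℐ(r, s; A)`: the closed `s`-neighbourhood of some compact set all of whose
points have joint distance at least `s + r` from the complement of `A`. -/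
def IsImageSet (J : JointDataSpace Ξ₁ Ξ₂ Q q₁ q₂) (r s : ℝ) (A : Set X₂) (B : Set X₁) : Prop :=
  ∃ Bm : Set X₁, IsCompact Bm ∧ Bm ⊆ {x | ENNReal.ofReal (s + r) ≤ J.distToSet x Aᶜ} ∧
    B = Metric.cthickening s Bm

end JointDataSpace

end LocalTransfer

end

noncomputable section

open Set Filter Topology MeasureTheory
open scoped ContDiff

namespace LocalTransfer

/-! ### Coefficient sums of polynomials -/

/-! The lifted function is the sum of a telescoping series. Let `P m` be `σ_{2^m}(Ξ₂; f)` and let `G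
m` be the joint operator of order `c* 2^m` applied to `P m`. Polynomial preservation turns `G (m+1)
- G m` into the joint operator of order `c* 2^(m+1)` applied to `P (m+1) - P m`. The joint kernel of
order `n` has size `n^Q` and is concentrated at joint distance `1/n`. On an image set the operator
therefore costs `n^(Q-q₂)` times the size of its argument on `A`, plus `n^(Q-S) r^(q₂-S)` times its
global size. Summing these costs gives (a): see `JointDataSpace.exists_sigmaPoly_bound` and
`JointDataSpace.exists_lift`.

For (b), localization of `σ_n(Ξ₂)` and the partition of unity turn local smoothness into the rate
`n^(-γ)` on `A` (`MemWOn.exists_rate`). By (a), the lifted function is then approximated on `B` at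
rate `β = γ - Q + q₂` by diffusion polynomials. Multiplying these by polynomials close to `φ` gives
membership in `W_β` (`StrongProduct.exists_memW`).

The analytic core is the passage from Gaussian heat bounds to localized filtered kernels. A
polynomial in `exp (-u²τ)` without constant term is a combination of heat kernels at times `jτ`.
Chebyshev polynomials provide such combinations that converge to `cos (s u) * sinc u ^ M`, with
degree at most `(s+M)L` and coefficient sum at most `3^((s+M)L)`. The Gaussian factor `exp
(-2(s+M)L)` beats this growth, so band-limited averages vanish when the band `s+M` does not exceed
the distance (`tsum_cos_mul_sinc_eq_zero`). Writing `h` as a superposition of such functions with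
rapidly decaying weight gives arbitrary polynomial decay (`IsCutoff.exists_localization`). The
factor `sinc ^ M` makes the sums converge absolutely. -/

/-- The sum of the absolute values of the coefficients of a real polynomial. -/
def coeffSum (P : Polynomial ℝ) : ℝ := P.sum fun _ a => |a|

lemma coeffSum_eq_sum_range {P : Polynomial ℝ} {n : ℕ} (hn : P.natDegree < n) :
    coeffSum P = ∑ i ∈ Finset.range n, |P.coeff i| :=
  Polynomial.sum_over_range' P (by simp) n hn

lemma coeffSum_nonneg (P : Polynomial ℝ) : 0 ≤ coeffSum P :=
  Finset.sum_nonneg fun _ _ => abs_nonneg _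

lemma coeffSum_add_le (P R : Polynomial ℝ) : coeffSum (P + R) ≤ coeffSum P + coeffSum R := by
  set n := max (P + R).natDegree (max P.natDegree R.natDegree) + 1
  rw [coeffSum_eq_sum_range (n := n) (by omega), coeffSum_eq_sum_range (P := P) (n := n) (by omega),
    coeffSum_eq_sum_range (P := R) (n := n) (by omega), ← Finset.sum_add_distrib]
  exact Finset.sum_le_sum fun i _ => by simpa using abs_add_le _ _

lemma coeffSum_neg (P : Polynomial ℝ) : coeffSum (-P) = coeffSum P := by
  rw [coeffSum_eq_sum_range (Nat.lt_succ_self _), coeffSum_eq_sum_range (Nat.lt_succ_self _)]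
  simp

lemma coeffSum_sub_le (P R : Polynomial ℝ) : coeffSum (P - R) ≤ coeffSum P + coeffSum R := by
  rw [sub_eq_add_neg, ← coeffSum_neg R]; exact coeffSum_add_le _ _

lemma coeffSum_zero : coeffSum 0 = 0 := by simp [coeffSum]

lemma coeffSum_monomial (n : ℕ) (a : ℝ) : coeffSum (Polynomial.monomial n a) = |a| := by
  simp [coeffSum, Polynomial.sum_monomial_index]

lemma coeffSum_C (a : ℝ) : coeffSum (Polynomial.C a) = |a| := coeffSum_monomial 0 a

lemma coeffSum_sum_le {ι : Type*} (s : Finset ι) (f : ι → Polynomial ℝ) :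
    coeffSum (∑ i ∈ s, f i) ≤ ∑ i ∈ s, coeffSum (f i) :=
  Finset.le_sum_of_subadditive _ coeffSum_zero.le coeffSum_add_le s f

lemma coeffSum_mul_le (P R : Polynomial ℝ) : coeffSum (P * R) ≤ coeffSum P * coeffSum R := by
  rw [Polynomial.mul_eq_sum_sum]
  refine (coeffSum_sum_le _ _).trans ?_
  rw [coeffSum, Polynomial.sum, Finset.sum_mul]
  refine Finset.sum_le_sum fun i _ => ?_
  rw [Polynomial.sum]
  refine (coeffSum_sum_le _ _).trans ?_
  rw [coeffSum, Polynomial.sum, Finset.mul_sum]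
  exact Finset.sum_le_sum fun j _ => by rw [coeffSum_monomial, abs_mul]

lemma coeffSum_pow_le (P : Polynomial ℝ) (n : ℕ) : coeffSum (P ^ n) ≤ coeffSum P ^ n := by
  induction n with
  | zero => simpa using (coeffSum_C 1).le
  | succ n ih =>
    rw [pow_succ, pow_succ]
    exact (coeffSum_mul_le _ _).trans (mul_le_mul_of_nonneg_right ih (coeffSum_nonneg _))

lemma coeffSum_X : coeffSum Polynomial.X = 1 := by
  rw [← Polynomial.monomial_one_one_eq_X, coeffSum_monomial, abs_one]

lemma coeffSum_two_X_mul_le (P : Polynomial ℝ) :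
    coeffSum (2 * Polynomial.X * P) ≤ 2 * coeffSum P := by
  have : (2 * Polynomial.X : Polynomial ℝ) = Polynomial.monomial 1 2 := by
    rw [← Polynomial.C_mul_X_eq_monomial, Polynomial.C_ofNat]
  rw [this]
  simpa [coeffSum_monomial] using coeffSum_mul_le (Polynomial.monomial 1 2) P

/-- The three-term recurrence gives `2 * 3^(n+1) + 3^n = 7 * 3^n ≤ 3^(n+2)`. The base 3 is not
sharp; all that matters later is that it is below `e²`. -/
lemma coeffSum_chebyshev_le {P : ℕ → Polynomial ℝ} (h0 : coeffSum (P 0) ≤ 1)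
    (h1 : coeffSum (P 1) ≤ 3) (h : ∀ n, P (n + 2) = 2 * Polynomial.X * P (n + 1) - P n) (n : ℕ) :
    coeffSum (P n) ≤ 3 ^ n := by
  induction n using Nat.twoStepInduction with
  | zero => simpa using h0
  | one => simpa using h1
  | more n ih0 ih1 =>
    rw [h]
    have := coeffSum_sub_le (2 * Polynomial.X * P (n + 1)) (P n)
    have := coeffSum_two_X_mul_le (P (n + 1))
    have : (0 : ℝ) < 3 ^ n := by positivity
    rw [pow_succ] at *
    rw [pow_succ]
    linarith

lemma coeffSum_T_le (n : ℕ) : coeffSum (Polynomial.Chebyshev.T ℝ n) ≤ 3 ^ n := by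
  refine coeffSum_chebyshev_le (P := fun n : ℕ => Polynomial.Chebyshev.T ℝ n) ?_ ?_ ?_ n
  · simpa using (coeffSum_C 1).le
  · simp [coeffSum_X]
  · intro n; push_cast; exact Polynomial.Chebyshev.T_add_two ℝ n

lemma coeffSum_U_le (n : ℕ) : coeffSum (Polynomial.Chebyshev.U ℝ n) ≤ 3 ^ n := by
  refine coeffSum_chebyshev_le (P := fun n : ℕ => Polynomial.Chebyshev.U ℝ n) ?_ ?_ ?_ n
  · simpa using (coeffSum_C 1).le
  · have := coeffSum_two_X_mul_le 1
    have h1 : coeffSum 1 = 1 := by simpa using coeffSum_C 1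
    simp only [mul_one] at this
    simp only [Nat.cast_one, Polynomial.Chebyshev.U_one]
    linarith
  · intro n; push_cast; exact Polynomial.Chebyshev.U_add_two ℝ n

lemma natDegree_chebyshev_le {P : ℕ → Polynomial ℝ} (h0 : (P 0).natDegree ≤ 0)
    (h1 : (P 1).natDegree ≤ 1) (h : ∀ n, P (n + 2) = 2 * Polynomial.X * P (n + 1) - P n) (n : ℕ) :
    (P n).natDegree ≤ n := by
  induction n using Nat.twoStepInduction with
  | zero => simpa using h0
  | one => simpa using h1
  | more n ih0 ih1 =>
    rw [h]
    refine (Polynomial.natDegree_sub_le _ _).trans (max_le ?_ (by omega))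
    refine Polynomial.natDegree_mul_le.trans ?_
    have : (2 * Polynomial.X : Polynomial ℝ).natDegree ≤ 1 := by
      refine Polynomial.natDegree_mul_le.trans ?_
      simp
    omega

lemma natDegree_T_le (n : ℕ) : (Polynomial.Chebyshev.T ℝ n).natDegree ≤ n := by
  refine natDegree_chebyshev_le (P := fun n : ℕ => Polynomial.Chebyshev.T ℝ n) ?_ ?_ ?_ n
  · simp
  · simp
  · intro n; push_cast; exact Polynomial.Chebyshev.T_add_two ℝ n

lemma natDegree_U_le (n : ℕ) : (Polynomial.Chebyshev.U ℝ n).natDegree ≤ n := by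
  refine natDegree_chebyshev_le (P := fun n : ℕ => Polynomial.Chebyshev.U ℝ n) ?_ ?_ ?_ n
  · simp
  · simp only [Nat.cast_one, Polynomial.Chebyshev.U_one]
    refine Polynomial.natDegree_mul_le.trans ?_
    simp
  · intro n; push_cast; exact Polynomial.Chebyshev.U_add_two ℝ n

/-! ### Gaussian approximation of band-limited functions -/

/-- A polynomial without constant term whose value at `exp (-u² / (2 L²))` approximates
`cos (s u) * sinc u ^ M` as `L → ∞`. -/
def bandPoly (s : ℝ) (M L : ℕ) : Polynomial ℝ :=
  Polynomial.Chebyshev.T ℝ (⌊s * L⌋₊ : ℕ) *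
    (Polynomial.C (L : ℝ)⁻¹ * (Polynomial.X * Polynomial.Chebyshev.U ℝ (L - 1 : ℕ))) ^ M

lemma natDegree_bandPoly_le {s : ℝ} (hs : 0 ≤ s) (M L : ℕ) (hL : 0 < L) :
    ((bandPoly s M L).natDegree : ℝ) ≤ (s + M) * L := by
  have h1 : (bandPoly s M L).natDegree ≤ ⌊s * L⌋₊ + M * L := by
    refine Polynomial.natDegree_mul_le.trans (add_le_add (natDegree_T_le _) ?_)
    refine Polynomial.natDegree_pow_le.trans (Nat.mul_le_mul_left _ ?_)
    refine (Polynomial.natDegree_C_mul_le _ _).trans (Polynomial.natDegree_mul_le.trans ?_)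
    have := natDegree_U_le (L - 1)
    rw [Polynomial.natDegree_X]
    omega
  have h2 : (⌊s * L⌋₊ : ℝ) ≤ s * L := Nat.floor_le (by positivity)
  calc ((bandPoly s M L).natDegree : ℝ) ≤ ((⌊s * L⌋₊ + M * L : ℕ) : ℝ) := by exact_mod_cast h1
    _ ≤ _ := by push_cast; linarith

/-- The exponent is the degree bound of `natDegree_bandPoly_le`, so a single number `(s+M)L` governs
both the coefficient growth and the largest heat time used. -/
lemma coeffSum_bandPoly_le {s : ℝ} (hs : 0 ≤ s) (M L : ℕ) (hL : 0 < L) :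
    coeffSum (bandPoly s M L) ≤ (3 : ℝ) ^ ((s + M) * L) := by
  have hL' : (1 : ℝ) ≤ L := by exact_mod_cast hL
  have h1 : coeffSum (Polynomial.C (L : ℝ)⁻¹ *
      (Polynomial.X * Polynomial.Chebyshev.U ℝ (L - 1 : ℕ))) ≤ 3 ^ L := by
    refine (coeffSum_mul_le _ _).trans ?_
    have h2 : coeffSum (Polynomial.X * Polynomial.Chebyshev.U ℝ (L - 1 : ℕ)) ≤ 3 ^ L := by
      refine (coeffSum_mul_le _ _).trans ?_
      rw [coeffSum_X, one_mul]
      exact (coeffSum_U_le _).trans (pow_le_pow_right₀ (by norm_num) (by omega))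
    rw [coeffSum_C, abs_of_nonneg (by positivity)]
    calc (L : ℝ)⁻¹ * _ ≤ 1 * 3 ^ L := by
          gcongr
          · exact coeffSum_nonneg _
          · exact inv_le_one_of_one_le₀ hL'
      _ = _ := one_mul _
  have h2 : (⌊s * L⌋₊ : ℝ) ≤ s * L := Nat.floor_le (by positivity)
  calc coeffSum (bandPoly s M L) ≤ 3 ^ ⌊s * L⌋₊ * (3 ^ L) ^ M := by
        refine (coeffSum_mul_le _ _).trans ?_
        gcongr
        · exact coeffSum_nonneg _
        · exact coeffSum_T_le _
        · exact (coeffSum_pow_le _ _).trans (pow_le_pow_left₀ (coeffSum_nonneg _) h1 _)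
    _ = (3 : ℝ) ^ ((⌊s * L⌋₊ : ℝ) + L * M) := by
        rw [Real.rpow_add (by norm_num), Real.rpow_natCast, ← pow_mul, ← Nat.cast_mul,
          Real.rpow_natCast]
    _ ≤ _ := Real.rpow_le_rpow_of_exponent_le (by norm_num) (by linarith)

/-- A constant term would correspond to heat time 0, where no Gaussian bound is available. The
factor `X` removes it as soon as `M > 0`. -/
lemma coeff_zero_bandPoly (s : ℝ) {M : ℕ} (hM : 0 < M) (L : ℕ) :
    (bandPoly s M L).coeff 0 = 0 := by
  rw [Polynomial.coeff_zero_eq_eval_zero]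
  simp [bandPoly, hM.ne']

lemma abs_sin_nat_mul_le (n : ℕ) (θ : ℝ) : |Real.sin (n * θ)| ≤ n * |Real.sin θ| := by
  induction n with
  | zero => simp
  | succ n ih =>
    push_cast
    rw [add_mul, one_mul, Real.sin_add]
    refine (abs_add_le _ _).trans ?_
    rw [abs_mul, abs_mul]
    nlinarith [Real.abs_cos_le_one θ, Real.abs_cos_le_one (n * θ), abs_nonneg (Real.sin θ),
      abs_nonneg (Real.sin (n * θ)), abs_nonneg (Real.cos θ), abs_nonneg (Real.cos (n * θ))]

lemma eval_U_mul_sin {L : ℕ} (hL : 0 < L) (θ : ℝ) :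
    (Polynomial.Chebyshev.U ℝ (L - 1 : ℕ)).eval (Real.cos θ) * Real.sin θ = Real.sin (L * θ) := by
  rw [Polynomial.Chebyshev.U_real_cos]
  congr 2
  push_cast [Nat.cast_sub hL]
  ring

/-- The two hypotheses add up to `(1 + v) * |w| ≤ 2`. -/
lemma two_div_pow_bound {v w : ℝ} (hv : 0 ≤ v) (h1 : |w| ≤ 1) (h2 : v * |w| ≤ 1) (M : ℕ) :
    |w| ^ M ≤ 2 ^ M / (1 + v) ^ M := by
  rw [← div_pow]
  refine pow_le_pow_left₀ (abs_nonneg _) ?_ _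
  rw [le_div_iff₀ (by linarith)]
  linarith

/-- A bound uniform in `L`, serving as the dominating function when `L → ∞`. Put `y = cos φ`; the
Chebyshev values become `cos (⌊sL⌋ φ)` and `sin (L φ) / sin φ`. -/
lemma abs_eval_bandPoly_le (s : ℝ) (M : ℕ) {L : ℕ} (hL : 0 < L) {u : ℝ} (hu : 0 ≤ u) :
    |(bandPoly s M L).eval (Real.exp (-(u ^ 2 / (2 * (L : ℝ) ^ 2))))| ≤ 2 ^ M / (1 + u) ^ M := by
  set y := Real.exp (-(u ^ 2 / (2 * (L : ℝ) ^ 2))) with hy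
  have hL' : (0 : ℝ) < L := by exact_mod_cast hL
  have hy0 : 0 < y := Real.exp_pos _
  have hy1 : y ≤ 1 := Real.exp_le_one_iff.2 (by have : 0 ≤ u ^ 2 / (2 * (L : ℝ) ^ 2) := by positivity
                                                linarith)
  have hysq : y ^ 2 = Real.exp (-(u / L) ^ 2) := by
    rw [hy, ← Real.exp_nat_mul]; congr 1; field_simp; push_cast; ring
  have hcos : Real.cos (Real.arccos y) = y := Real.cos_arccos (by linarith) hy1
  set φ := Real.arccos y
  have hsin0 : 0 ≤ Real.sin φ := Real.sin_nonneg_of_mem_Icc ⟨Real.arccos_nonneg _, Real.arccos_le_pi _⟩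
  have hU := eval_U_mul_sin hL φ
  rw [hcos] at hU
  set U := (Polynomial.Chebyshev.U ℝ (L - 1 : ℕ)).eval y with hUdef
  -- If `sin φ = 0` then `y = 1`, and the value of `U_{L-1}` at 1 is exactly `L`.
  have hUL : |U| ≤ L := by
    rcases hsin0.eq_or_lt with h0 | h0
    · have hsc := Real.sin_sq_add_cos_sq φ
      rw [← h0, hcos] at hsc
      have : y = 1 := by nlinarith
      rw [hUdef, this, Polynomial.Chebyshev.U_eval_one]
      push_cast [Nat.cast_sub hL]
      simp
    · have := abs_sin_nat_mul_le L φ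
      rw [← hU, abs_mul] at this
      rw [abs_of_pos h0] at this
      exact le_of_mul_le_mul_right this h0
  have hU1 : |U| * Real.sin φ ≤ 1 := by
    rw [← abs_of_nonneg hsin0, ← abs_mul, hU]; exact Real.abs_sin_le_one _
  -- After squaring, with `x = (u/L)²`, this is `x e^{-x} ≤ 1 - e^{-x}`, that is, `1 + x ≤ e^x`.
  have huy : u * y ≤ L * Real.sin φ := by
    refine (sq_le_sq₀ (by positivity) (by positivity)).1 ?_
    have hs : Real.sin φ ^ 2 = 1 - y ^ 2 := by rw [Real.sin_sq, hcos]
    rw [mul_pow, mul_pow, hs, hysq]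
    have hx := Real.add_one_le_exp ((u / L) ^ 2)
    have he : Real.exp (-(u / L) ^ 2) * Real.exp ((u / L) ^ 2) = 1 := by
      rw [← Real.exp_add]; simp
    have hue : u ^ 2 = L ^ 2 * (u / L) ^ 2 := by field_simp
    rw [hue, mul_assoc]
    refine mul_le_mul_of_nonneg_left ?_ (by positivity)
    nlinarith [Real.exp_pos (-(u / L) ^ 2)]
  rw [bandPoly, Polynomial.eval_mul, abs_mul, Polynomial.eval_pow, abs_pow]
  have hT : |(Polynomial.Chebyshev.T ℝ (⌊s * L⌋₊ : ℕ)).eval y| ≤ 1 :=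
    Polynomial.Chebyshev.abs_eval_T_real_le_one _ (abs_le.2 ⟨by linarith, hy1⟩)
  have hW : |Polynomial.eval y (Polynomial.C (L : ℝ)⁻¹ *
      (Polynomial.X * Polynomial.Chebyshev.U ℝ (L - 1 : ℕ)))| = (L : ℝ)⁻¹ * (y * |U|) := by
    simp only [Polynomial.eval_mul, Polynomial.eval_C, Polynomial.eval_X]
    rw [← hUdef, abs_mul, abs_mul, abs_of_pos hy0, abs_of_pos (inv_pos.2 hL')]
  have key := two_div_pow_bound hu (w := Polynomial.eval y (Polynomial.C (L : ℝ)⁻¹ *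
      (Polynomial.X * Polynomial.Chebyshev.U ℝ (L - 1 : ℕ)))) ?_ ?_ M
  · calc _ ≤ 1 * _ := mul_le_mul_of_nonneg_right hT (by positivity)
      _ ≤ _ := by rw [one_mul]; exact key
  · rw [hW, inv_mul_le_iff₀ hL', mul_one]
    calc y * |U| ≤ 1 * L := by gcongr
      _ = L := one_mul _
  · rw [hW, ← mul_assoc, mul_comm u, mul_assoc, inv_mul_le_iff₀ hL', mul_one]
    calc u * (y * |U|) = (u * y) * |U| := by ring
      _ ≤ (L * Real.sin φ) * |U| := by gcongr
      _ = L * (|U| * Real.sin φ) := by ring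
      _ ≤ L * 1 := by gcongr
      _ = L := mul_one _

/-- First-order expansion along a sequence. -/
lemma tendsto_nat_mul_of_hasDerivAt {g : ℝ → ℝ} {g' w : ℝ} (hg : HasDerivAt g g' 0) (h0 : g 0 = 0)
    {z : ℕ → ℝ} (hz : Tendsto (fun L : ℕ => (L : ℝ) * z L) atTop (𝓝 w)) :
    Tendsto (fun L : ℕ => (L : ℝ) * g (z L)) atTop (𝓝 (w * g')) := by
  have hc : Tendsto (fun L : ℕ => ‖(L : ℝ)‖) atTop atTop := by
    simpa using tendsto_natCast_atTop_atTop (R := ℝ)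
  have hz0 : Tendsto z atTop (𝓝 0) := by
    have := (tendsto_inv_atTop_nhds_zero_nat (𝕜 := ℝ)).mul hz
    rw [zero_mul] at this
    refine this.congr' ?_
    filter_upwards [eventually_gt_atTop 0] with L hL
    have : (L : ℝ) ≠ 0 := by exact_mod_cast hL.ne'
    field_simp
  have := hg.hasFDerivAt.hasFDerivWithinAt (s := univ) |>.lim (c := fun L : ℕ => (L : ℝ)) (d := z)
    (l := atTop) hz0 (Eventually.of_forall fun _ => mem_univ _) hz
  simpa [h0] using this

/-- With `y L = cos φ` and `z L = sin φ`, one has `φ ~ u/L`. Hence `T` contributes `cos (⌊sL⌋ φ) →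
cos (s u)` and `U` contributes `sin (L φ) / (L sin φ) → sinc u`. -/
lemma tendsto_eval_bandPoly {s : ℝ} (hs : 0 ≤ s) (M : ℕ) {u : ℝ} (hu : 0 ≤ u) :
    Tendsto (fun L : ℕ => (bandPoly s M L).eval (Real.exp (-(u ^ 2 / (2 * (L : ℝ) ^ 2)))))
      atTop (𝓝 (Real.cos (s * u) * Real.sinc u ^ M)) := by
  set y : ℕ → ℝ := fun L => Real.exp (-(u ^ 2 / (2 * (L : ℝ) ^ 2))) with hy
  set z : ℕ → ℝ := fun L => √(1 - Real.exp (-(u ^ 2 / (L : ℝ) ^ 2))) with hz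
  have hy0 : ∀ L, 0 < y L := fun L => Real.exp_pos _
  have hysq : ∀ L, y L ^ 2 = Real.exp (-(u ^ 2 / (L : ℝ) ^ 2)) := by
    intro L
    rw [hy, ← Real.exp_nat_mul]; congr 1
    rcases eq_or_ne (L : ℝ) 0 with h | h
    · simp [h]
    · field_simp; push_cast; ring
  have he1 : ∀ L : ℕ, Real.exp (-(u ^ 2 / (L : ℝ) ^ 2)) ≤ 1 := fun L =>
    Real.exp_le_one_iff.2 (by have : 0 ≤ u ^ 2 / (L : ℝ) ^ 2 := by positivity
                              linarith)
  have hzsq : ∀ L, z L ^ 2 = 1 - y L ^ 2 := fun L => by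
    rw [hz, hysq]; exact Real.sq_sqrt (by linarith [he1 L])
  have hz0 : ∀ L, 0 ≤ z L := fun L => Real.sqrt_nonneg _
  have hz1 : ∀ L, z L ≤ 1 := fun L => by nlinarith [hzsq L, hz0 L, hy0 L]
  have hsin : ∀ L, Real.sin (Real.arcsin (z L)) = z L := fun L =>
    Real.sin_arcsin (by linarith [hz0 L]) (hz1 L)
  have hcos : ∀ L, Real.cos (Real.arcsin (z L)) = y L := fun L => by
    rw [Real.cos_arcsin, hzsq, sub_sub_cancel, Real.sqrt_sq (hy0 L).le]
  have hLz : Tendsto (fun L : ℕ => (L : ℝ) * z L) atTop (𝓝 u) := by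
    -- The expansion `n (1 - exp (-u²/n)) → u²` is used along `n = L²`, followed by a square root.
    have hg : HasDerivAt (fun x : ℝ => 1 - Real.exp (-x)) 1 0 := by
      have := ((hasDerivAt_id (0 : ℝ)).neg.exp).const_sub 1
      simpa using this
    have h1 : Tendsto (fun L : ℕ => (L : ℝ) * (u ^ 2 / L)) atTop (𝓝 (u ^ 2)) := by
      refine tendsto_const_nhds.congr' ?_
      filter_upwards [eventually_gt_atTop 0] with L hL
      have : (L : ℝ) ≠ 0 := by exact_mod_cast hL.ne'
      field_simp
    have h2 := (tendsto_nat_mul_of_hasDerivAt hg (by simp) h1).comp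
      (tendsto_pow_atTop (α := ℕ) two_ne_zero)
    have h3 := (Real.continuous_sqrt.tendsto _).comp h2
    rw [mul_one, Real.sqrt_sq hu] at h3
    refine h3.congr fun L => ?_
    simp only [Function.comp, Nat.cast_pow, hz]
    rw [Real.sqrt_mul (by positivity), Real.sqrt_sq (by positivity)]
  have hLφ : Tendsto (fun L : ℕ => (L : ℝ) * Real.arcsin (z L)) atTop (𝓝 u) := by
    have hg := Real.hasDerivAt_arcsin (x := 0) (by norm_num) (by norm_num)
    simpa using tendsto_nat_mul_of_hasDerivAt hg (by simp) hLz
  have hy1 : Tendsto y atTop (𝓝 1) := by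
    have h1 : Tendsto (fun L : ℕ => -(u ^ 2 / (2 * (L : ℝ) ^ 2))) atTop (𝓝 (-0)) := by
      refine Tendsto.neg (tendsto_const_nhds.div_atTop ?_)
      exact Tendsto.const_mul_atTop two_pos
        ((tendsto_pow_atTop two_ne_zero).comp tendsto_natCast_atTop_atTop)
    simpa [hy, Function.comp_def] using (Real.continuous_exp.tendsto _).comp h1
  have hT : Tendsto (fun L : ℕ => (Polynomial.Chebyshev.T ℝ (⌊s * L⌋₊ : ℕ)).eval (y L)) atTop
      (𝓝 (Real.cos (s * u))) := by
    have h1 : Tendsto (fun L : ℕ => (⌊s * L⌋₊ : ℝ) / L) atTop (𝓝 s) :=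
      (tendsto_nat_floor_mul_div_atTop hs).comp tendsto_natCast_atTop_atTop
    refine ((Real.continuous_cos.tendsto _).comp (h1.mul hLφ)).congr' ?_
    filter_upwards [eventually_gt_atTop 0] with L hL
    have : (L : ℝ) ≠ 0 := by exact_mod_cast hL.ne'
    rw [← hcos, Polynomial.Chebyshev.T_real_cos]
    simp only [Function.comp]
    congr 1
    push_cast
    field_simp
  have hU : Tendsto (fun L : ℕ => (L : ℝ)⁻¹ * (Polynomial.Chebyshev.U ℝ (L - 1 : ℕ)).eval (y L))
      atTop (𝓝 (Real.sinc u)) := by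
    rcases hu.eq_or_lt with h0 | h0
    · rw [← h0, Real.sinc_zero]
      refine tendsto_const_nhds.congr' ?_
      filter_upwards [eventually_gt_atTop 0] with L hL
      have h1 : (L : ℝ) ≠ 0 := by exact_mod_cast hL.ne'
      have h2 : y L = 1 := by simp [hy, ← h0]
      rw [h2, Polynomial.Chebyshev.U_eval_one]
      push_cast [Nat.cast_sub (show 1 ≤ L from hL)]
      field_simp
      simp
    · rw [Real.sinc_of_ne_zero h0.ne']
      refine (((Real.continuous_sin.tendsto _).comp hLφ).div hLz h0.ne').congr' ?_
      filter_upwards [eventually_gt_atTop 0] with L hL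
      have h1 : (L : ℝ) ≠ 0 := by exact_mod_cast hL.ne'
      have h2 : z L ≠ 0 := by
        refine (Real.sqrt_pos.2 (sub_pos.2 (Real.exp_lt_one_iff.2 ?_))).ne'
        have : 0 < u ^ 2 / (L : ℝ) ^ 2 := by positivity
        linarith
      have h3 := eval_U_mul_sin hL (Real.arcsin (z L))
      rw [hsin, hcos] at h3
      simp only [Function.comp, Pi.div_apply]
      rw [← h3]
      field_simp
  have := hT.mul ((hy1.mul hU).pow M)
  rw [one_mul] at this
  refine this.congr fun L => ?_
  simp only [bandPoly, Polynomial.eval_mul, Polynomial.eval_pow, Polynomial.eval_C,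
    Polynomial.eval_X, hy]
  ring

/-! ### Finite propagation speed -/

/-- Consequently one weighted summability condition of order `M` makes the heat sums converge
absolutely at every positive time. -/
lemma exists_pow_mul_exp_le (M : ℕ) {t : ℝ} (ht : 0 < t) :
    ∃ B : ℝ, 0 < B ∧ ∀ u : ℝ, 0 ≤ u → Real.exp (-(u ^ 2 * t)) ≤ B / (1 + u) ^ M := by
  refine ⟨2 ^ M * (M.factorial * Real.exp t) / t ^ M, by positivity, fun u hu => ?_⟩
  have h1 : (1 + u) ^ M ≤ 2 ^ M * (1 + u ^ 2) ^ M := by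
    rw [← mul_pow]
    exact pow_le_pow_left₀ (by positivity) (by nlinarith [sq_nonneg (u - 1 / 2)]) _
  have h2 : (t * (1 + u ^ 2)) ^ M / M.factorial ≤ Real.exp (t * (1 + u ^ 2)) :=
    Real.pow_div_factorial_le_exp _ (by positivity) M
  rw [div_le_iff₀ (by positivity), mul_pow] at h2
  rw [le_div_iff₀ (by positivity), le_div_iff₀ (by positivity)]
  have h3 : Real.exp (-(u ^ 2 * t)) * Real.exp (t * (1 + u ^ 2)) = Real.exp t := by
    rw [← Real.exp_add]; congr 1; ring
  calc Real.exp (-(u ^ 2 * t)) * (1 + u) ^ M * t ^ M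
      ≤ Real.exp (-(u ^ 2 * t)) * (2 ^ M * (1 + u ^ 2) ^ M) * t ^ M := by gcongr
    _ = 2 ^ M * (Real.exp (-(u ^ 2 * t)) * (t ^ M * (1 + u ^ 2) ^ M)) := by ring
    _ ≤ 2 ^ M * (Real.exp (-(u ^ 2 * t)) * (Real.exp (t * (1 + u ^ 2)) * M.factorial)) := by gcongr
    _ = 2 ^ M * (M.factorial * (Real.exp (-(u ^ 2 * t)) * Real.exp (t * (1 + u ^ 2)))) := by ring
    _ = _ := by rw [h3]

section Propagation

variable {ι : Type*} {a u : ι → ℝ}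

lemma summable_mul_of_abs_le {M : ℕ} (hsum : Summable fun p => |a p| / (1 + u p) ^ M)
    {w : ι → ℝ} {B : ℝ} (hw : ∀ p, |w p| ≤ B / (1 + u p) ^ M) :
    Summable fun p => a p * w p := by
  refine Summable.of_norm_bounded (hsum.mul_left B) fun p => ?_
  rw [Real.norm_eq_abs, abs_mul]
  calc |a p| * |w p| ≤ |a p| * (B / (1 + u p) ^ M) := by gcongr; exact hw p
    _ = _ := by ring

lemma summable_mul_exp (hu : ∀ p, 0 ≤ u p) {M : ℕ}
    (hsum : Summable fun p => |a p| / (1 + u p) ^ M) {t : ℝ} (ht : 0 < t) :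
    Summable fun p => a p * Real.exp (-(u p ^ 2 * t)) := by
  obtain ⟨B, -, hB⟩ := exists_pow_mul_exp_le M ht
  exact summable_mul_of_abs_le hsum fun p => by
    rw [abs_of_pos (Real.exp_pos _)]; exact hB _ (hu p)

/-- The monomial of degree `j` evaluated at `exp (-u²τ)` is the heat multiplier at time `jτ`, so
heat bounds at the times `τ, 2τ, …` transfer to polynomials. -/
lemma abs_tsum_eval_exp_le (hu : ∀ p, 0 ≤ u p) {M : ℕ}
    (hsum : Summable fun p => |a p| / (1 + u p) ^ M) {τ δ : ℝ} (hτ : 0 < τ)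
    {P : Polynomial ℝ} (hP : P.coeff 0 = 0)
    (hδ : ∀ j : ℕ, 0 < j → j ≤ P.natDegree → |∑' p, a p * Real.exp (-(u p ^ 2 * (j * τ)))| ≤ δ) :
    |∑' p, a p * P.eval (Real.exp (-(u p ^ 2 * τ)))| ≤ coeffSum P * δ := by
  have h1 : ∀ p, a p * P.eval (Real.exp (-(u p ^ 2 * τ))) =
      ∑ j ∈ Finset.range (P.natDegree + 1),
        P.coeff j * (a p * Real.exp (-(u p ^ 2 * (j * τ)))) := by
    intro p
    rw [Polynomial.eval_eq_sum_range, Finset.mul_sum]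
    refine Finset.sum_congr rfl fun j _ => ?_
    rw [← Real.exp_nat_mul]
    rw [show (j : ℝ) * -(u p ^ 2 * τ) = -(u p ^ 2 * (j * τ)) by ring]
    ring
  simp_rw [h1]
  rw [Summable.tsum_finsetSum, coeffSum_eq_sum_range (Nat.lt_succ_self _), Finset.sum_mul]
  · refine (Finset.abs_sum_le_sum_abs _ _).trans (Finset.sum_le_sum fun j hj => ?_)
    rw [tsum_mul_left, abs_mul]
    rcases Nat.eq_zero_or_pos j with rfl | h
    · simp [hP]
    · exact mul_le_mul_of_nonneg_left
        (hδ j h (by simpa [Nat.lt_succ_iff] using hj)) (abs_nonneg _)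
  · intro j _
    rcases Nat.eq_zero_or_pos j with rfl | h
    · simp [hP, summable_zero]
    · exact (summable_mul_exp hu hsum (by positivity)).mul_left _

/-- Since `log 3 < 2`, the product `3^(σL) exp (-2σL)` decays exponentially and absorbs the power of
`L` coming from `t^(-c)`. -/
lemma tendsto_decay {A c σ : ℝ} (hσ : 0 < σ) :
    Tendsto (fun L : ℕ => (3 : ℝ) ^ (σ * L) *
      (A * (1 / (2 * (L : ℝ) ^ 2)) ^ (-c) * Real.exp (-(2 * σ * L)))) atTop (𝓝 0) := by
  have hlog : Real.log 3 < 2 := by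
    rw [Real.log_lt_iff_lt_exp (by norm_num)]
    have := Real.add_one_le_exp (1 : ℝ)
    have h2 : Real.exp 2 = Real.exp 1 * Real.exp 1 := by rw [← Real.exp_add]; norm_num
    rw [h2]; nlinarith
  have h := (tendsto_rpow_mul_exp_neg_mul_atTop_nhds_zero (2 * c) (σ * (2 - Real.log 3))
    (mul_pos hσ (by linarith))).comp (tendsto_natCast_atTop_atTop (R := ℝ))
  have h2 := h.const_mul (A * 2 ^ c)
  rw [mul_zero] at h2
  refine h2.congr' ?_
  filter_upwards [eventually_gt_atTop 0] with L hL
  have hL' : (0 : ℝ) < L := by exact_mod_cast hL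
  have e1 : (1 / (2 * (L : ℝ) ^ 2)) ^ (-c) = 2 ^ c * (L : ℝ) ^ (2 * c) := by
    rw [one_div, Real.inv_rpow (by positivity), Real.rpow_neg (by positivity), inv_inv,
      Real.mul_rpow (by norm_num) (by positivity), ← Real.rpow_natCast, ← Real.rpow_mul hL'.le]
    norm_num
  have e2 : Real.exp (-(σ * (2 - Real.log 3)) * L) =
      (3 : ℝ) ^ (σ * L) * Real.exp (-(2 * σ * L)) := by
    rw [Real.rpow_def_of_pos (by norm_num), ← Real.exp_add]; congr 1; ring
  simp only [Function.comp]
  rw [e1, e2]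
  ring

/-- A Gaussian upper bound for a generalized heat kernel forces the vanishing of the band-limited
averages with band smaller than the distance. -/
theorem tsum_cos_mul_sinc_eq_zero (hu : ∀ p, 0 ≤ u p) {s : ℝ} (hs : 0 ≤ s) {M : ℕ} (hM : 0 < M)
    (hsum : Summable fun p => |a p| / (1 + u p) ^ M) {A c κ T : ℝ} (hc : 0 ≤ c) (hT : 0 < T)
    (hb : ∀ t, 0 < t → t ≤ T → |∑' p, a p * Real.exp (-(u p ^ 2 * t))| ≤
      A * t ^ (-c) * Real.exp (-(κ / t)))
    (hκ : (s + M) ^ 2 ≤ κ) :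
    ∑' p, a p * (Real.cos (s * u p) * Real.sinc (u p) ^ M) = 0 := by
  have hM' : (0 : ℝ) < M := by exact_mod_cast hM
  set σ := s + M with hσ
  have hσ0 : 0 < σ := by positivity
  have hA : 0 ≤ A := by
    have := (abs_nonneg _).trans (hb T hT le_rfl)
    rw [mul_assoc] at this
    exact nonneg_of_mul_nonneg_left this (by positivity)
  set y : ℕ → ι → ℝ := fun L p => Real.exp (-(u p ^ 2 / (2 * (L : ℝ) ^ 2)))
  have hlim : Tendsto (fun L : ℕ => ∑' p, a p * (bandPoly s M L).eval (y L p)) atTop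
      (𝓝 (∑' p, a p * (Real.cos (s * u p) * Real.sinc (u p) ^ M))) := by
    refine tendsto_tsum_of_dominated_convergence (hsum.mul_left (2 ^ M))
      (fun p => (tendsto_eval_bandPoly hs M (hu p)).const_mul _) ?_
    filter_upwards [eventually_gt_atTop 0] with L hL p
    rw [Real.norm_eq_abs, abs_mul]
    calc |a p| * _ ≤ |a p| * (2 ^ M / (1 + u p) ^ M) := by
          gcongr; exact abs_eval_bandPoly_le s M hL (hu p)
      _ = _ := by ring
  refine tendsto_nhds_unique hlim ?_
  refine squeeze_zero_norm' ?_ (tendsto_decay (A := A) (c := c) hσ0)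
  -- The times used are at most `σ/(2L)`; this places them in the range `t ≤ T` of the hypothesis.
  have hev : ∀ᶠ L : ℕ in atTop, σ / (2 * T) ≤ L :=
    tendsto_natCast_atTop_atTop.eventually_ge_atTop _
  filter_upwards [eventually_gt_atTop 0, hev] with L hL hLT
  have hL' : (0 : ℝ) < L := by exact_mod_cast hL
  set τ : ℝ := 1 / (2 * (L : ℝ) ^ 2) with hτ
  have hτ0 : 0 < τ := by positivity
  have hdeg := natDegree_bandPoly_le hs M L hL
  have hyτ : ∀ p, y L p = Real.exp (-(u p ^ 2 * τ)) := fun p => by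
    simp only [y, hτ]; congr 2; ring
  simp_rw [hyτ]
  rw [Real.norm_eq_abs]
  refine (abs_tsum_eval_exp_le (δ := A * τ ^ (-c) * Real.exp (-(2 * σ * L))) hu hsum hτ0
    (coeff_zero_bandPoly s hM L) ?_).trans ?_
  · intro j hj0 hj
    have hj1 : (1 : ℝ) ≤ j := by exact_mod_cast hj0
    have hj2 : (j : ℝ) ≤ σ * L := (by exact_mod_cast hj : (j : ℝ) ≤ _).trans hdeg
    have htl : τ ≤ j * τ := le_mul_of_one_le_left hτ0.le hj1
    have htu : j * τ ≤ σ / (2 * L) := by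
      calc j * τ ≤ σ * L * τ := by gcongr
        _ = _ := by rw [hτ]; field_simp
    have htT : j * τ ≤ T := by
      refine htu.trans ?_
      rw [div_le_iff₀ (by positivity)] at hLT ⊢
      linarith
    have ht0 : 0 < j * τ := by positivity
    refine (hb _ ht0 htT).trans ?_
    -- The degree is at most `σL` and `τ = 1/(2L²)`, so the time is at most `σ/(2L)`; with `κ ≥ σ²`
    -- the Gaussian exponent is at least `2σL`.
    have hexp : 2 * σ * L ≤ κ / (j * τ) := by
      rw [le_div_iff₀ ht0]
      calc 2 * σ * L * (j * τ) ≤ 2 * σ * L * (σ / (2 * L)) := by gcongr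
        _ = σ ^ 2 := by field_simp
        _ ≤ κ := hκ
    have hrp : (j * τ) ^ (-c) ≤ τ ^ (-c) :=
      Real.rpow_le_rpow_of_nonpos hτ0 htl (by linarith)
    gcongr
  · exact mul_le_mul_of_nonneg_right (coeffSum_bandPoly_le hs M L hL) (by positivity)

end Propagation

/-! ### Localization of spectral filters -/

/-- `sinc` is the restriction to `ℝ` of the difference quotient of the complex sine at 0, which is
entire by removal of the singularity. -/
lemma contDiff_sinc : ContDiff ℝ ∞ Real.sinc := by
  have h1 : Differentiable ℂ (dslope Complex.sin 0) := by
    rw [← differentiableOn_univ, Complex.differentiableOn_dslope univ_mem]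
    exact Complex.differentiable_sin.differentiableOn
  have h2 : ContDiff ℝ ∞ (dslope Complex.sin 0) := (h1.contDiff (n := ∞)).restrict_scalars ℝ
  have h3 : Real.sinc = fun x : ℝ => (dslope Complex.sin 0 (x : ℂ)).re := by
    funext x
    rcases eq_or_ne x 0 with rfl | hx
    · simp [dslope_same]
    · have hx' : (x : ℂ) ≠ 0 := by exact_mod_cast hx
      rw [Real.sinc_of_ne_zero hx, dslope_of_ne _ hx', slope_def_field]
      rw [Complex.sin_zero, sub_zero, sub_zero, ← Complex.ofReal_sin, ← Complex.ofReal_div,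
        Complex.ofReal_re]
  rw [h3]
  exact Complex.reCLM.contDiff.comp (h2.comp Complex.ofRealCLM.contDiff)

/-- The radius 2 lies below the first zero `π` and above the support radius 1 of `h`. Thus `h / sinc
^ M` is smooth: the sets `|x| < 2` and `|x| > 1` overlap and cover the line. -/
lemma sinc_ne_zero {x : ℝ} (hx : |x| < 2) : Real.sinc x ≠ 0 := by
  rcases eq_or_ne x 0 with rfl | h0
  · simp
  · rw [Real.sinc_of_ne_zero h0]
    refine div_ne_zero (fun h => ?_) h0
    have hpi := Real.pi_gt_three
    rw [abs_lt] at hx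
    rw [Real.sin_eq_zero_iff_of_lt_of_lt (by linarith) (by linarith)] at h
    exact h0 h

lemma abs_sinc_pow_le {u : ℝ} (hu : 0 ≤ u) (M : ℕ) :
    |Real.sinc u| ^ M ≤ 2 ^ M / (1 + u) ^ M := by
  refine two_div_pow_bound hu (Real.abs_sinc_le_one u) ?_ M
  rcases hu.eq_or_lt with h | h
  · simp [← h]
  · rw [Real.sinc_of_ne_zero h.ne', abs_div, abs_of_pos h, mul_div_cancel₀ _ h.ne']
    exact Real.abs_sin_le_one u

lemma exists_cos_transform {k : ℝ → ℝ} (hk : ContDiff ℝ ∞ k) (hc : HasCompactSupport k)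
    (heven : ∀ u, k (-u) = k u) :
    ∃ w : ℝ → ℝ, Integrable w ∧ (∀ S : ℕ, Integrable fun ξ => |ξ| ^ S * |w ξ|) ∧
      ∀ u, k u = ∫ ξ, w ξ * Real.cos (2 * Real.pi * ξ * u) := by
  have hkc : ContDiff ℝ ∞ (fun u => (k u : ℂ)) := Complex.ofRealCLM.contDiff.comp hk
  have hcc : HasCompactSupport (fun u => (k u : ℂ)) := hc.comp_left Complex.ofReal_zero
  set f : SchwartzMap ℝ ℂ := hcc.toSchwartzMap hkc with hf
  set g : SchwartzMap ℝ ℂ := FourierTransform.fourier f with hg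
  have hgint : Integrable (g : ℝ → ℂ) := g.integrable
  have hre : Integrable fun ξ => (g ξ).re := hgint.re
  have him : Integrable fun ξ => (g ξ).im := hgint.im
  have hcos : ∀ u, Integrable fun ξ => (g ξ).re * Real.cos (2 * Real.pi * ξ * u) := fun u =>
    hre.mul_bdd (c := 1) (by fun_prop) (Eventually.of_forall fun ξ => by
      rw [Real.norm_eq_abs]; exact Real.abs_cos_le_one _)
  have hsin : ∀ u, Integrable fun ξ => (g ξ).im * Real.sin (2 * Real.pi * ξ * u) := fun u =>
    him.mul_bdd (c := 1) (by fun_prop) (Eventually.of_forall fun ξ => by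
      rw [Real.norm_eq_abs]; exact Real.abs_sin_le_one _)
  have hrep : ∀ u, k u = (∫ ξ, (g ξ).re * Real.cos (2 * Real.pi * ξ * u)) -
      ∫ ξ, (g ξ).im * Real.sin (2 * Real.pi * ξ * u) := by
    intro u
    have h1 : f u = FourierTransformInv.fourierInv (g : ℝ → ℂ) u := by
      rw [← SchwartzMap.fourierInv_coe, hg, FourierTransform.fourierInv_fourier_eq]
    rw [Real.fourierInv_eq'] at h1
    have h2 : (f u).re = k u := by simp [hf]
    rw [← h2, h1, ← integral_sub (hcos u) (hsin u)]
    have h3 : Integrable fun v : ℝ =>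
        Complex.exp (((2 * Real.pi * inner ℝ v u : ℝ) : ℂ) * Complex.I) • g v := by
      simp_rw [smul_eq_mul]
      refine hgint.bdd_mul (c := 1) (by fun_prop) (Eventually.of_forall fun ξ => ?_)
      rw [Complex.norm_exp_ofReal_mul_I]
    have h4 := Complex.reCLM.integral_comp_comm h3
    simp only [Complex.reCLM_apply] at h4
    rw [← h4]
    refine integral_congr_ae (Eventually.of_forall fun ξ => ?_)
    simp only [smul_eq_mul, Complex.mul_re, Complex.exp_ofReal_mul_I_re,
      Complex.exp_ofReal_mul_I_im]
    have : (2 * Real.pi * inner ℝ ξ u : ℝ) = 2 * Real.pi * ξ * u := by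
      simp; ring
    rw [this]; ring
  refine ⟨fun ξ => (g ξ).re, hre, fun S => ?_, fun u => ?_⟩
  · refine (g.integrable_pow_mul volume S).mono (by fun_prop) (Eventually.of_forall fun ξ => ?_)
    simp only [norm_mul, norm_pow, Real.norm_eq_abs, abs_abs, abs_norm]
    gcongr
    exact Complex.abs_re_le_norm _
  -- Averaging the inversion formula at `u` and `-u` removes the sine part, because `k` is even.
  · have h1 := hrep u
    have h2 := hrep (-u)
    simp only [mul_neg, Real.cos_neg, Real.sin_neg, integral_neg] at h2
    rw [heven] at h2
    linarith

lemma IsCutoff.eq_zero_of_one_le_abs {h : ℝ → ℝ} (hh : IsCutoff h) {t : ℝ} (ht : 1 ≤ |t|) :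
    h t = 0 := by
  rcases abs_cases t with ⟨h1, _⟩ | ⟨h1, _⟩
  · exact hh.eq_zero t (h1 ▸ ht)
  · rw [← hh.even]; exact hh.eq_zero _ (h1 ▸ ht)

/-- The cosine transform is applied to `h / sinc ^ M`, and the factor `sinc ^ M` is restored
afterwards. This expresses `h` through exactly the multipliers that finite propagation annihilates.
-/
lemma IsCutoff.exists_sinc_cos_transform {h : ℝ → ℝ} (hh : IsCutoff h) (M : ℕ) :
    ∃ w : ℝ → ℝ, Integrable w ∧ (∀ S : ℕ, Integrable fun ξ => |ξ| ^ S * |w ξ|) ∧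
      ∀ u, h u = ∫ ξ, w ξ * (Real.cos (2 * Real.pi * ξ * u) * Real.sinc u ^ M) := by
  set k : ℝ → ℝ := fun u => h u / Real.sinc u ^ M with hk
  have hsmooth : ContDiff ℝ ∞ k := by
    rw [contDiff_iff_contDiffAt]
    intro x
    rcases lt_or_ge |x| 2 with hx | hx
    · exact hh.smooth.contDiffAt.div (contDiff_sinc.pow M).contDiffAt
        (pow_ne_zero _ (sinc_ne_zero hx))
    · refine (contDiffAt_const (c := (0 : ℝ))).congr_of_eventuallyEq ?_
      have : ∀ᶠ y in 𝓝 x, 1 < |y| :=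
        (continuous_abs.tendsto x).eventually_const_lt (by linarith)
      filter_upwards [this] with y hy
      simp [hk, hh.eq_zero_of_one_le_abs hy.le]
  have hsupp : HasCompactSupport k := by
    refine HasCompactSupport.of_support_subset_isCompact (isCompact_Icc (a := (-1 : ℝ)) (b := 1)) ?_
    intro x hx
    by_contra hx'
    refine hx ?_
    have : 1 ≤ |x| := by
      by_contra hlt
      exact hx' ⟨by linarith [(abs_lt.1 (not_le.1 hlt)).1], (abs_lt.1 (not_le.1 hlt)).2.le⟩
    simp [hk, hh.eq_zero_of_one_le_abs this]
  obtain ⟨w, hw, hwS, hrep⟩ := exists_cos_transform hsmooth hsupp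
    (fun u => by simp [hk, hh.even, Real.sinc_neg])
  refine ⟨w, hw, hwS, fun u => ?_⟩
  simp_rw [← mul_assoc]
  rw [integral_mul_const, ← hrep]
  simp only [hk]
  rcases lt_or_ge |u| 1 with hu | hu
  · rw [div_mul_cancel₀ _ (pow_ne_zero _ (sinc_ne_zero (by linarith)))]
  · simp [hh.eq_zero_of_one_le_abs hu]

/-- Localization: a Gaussian upper bound for the generalized heat kernel implies rapid decay of the
filtered kernel, in terms of the weighted total variation. -/
theorem IsCutoff.exists_localization {h : ℝ → ℝ} (hh : IsCutoff h) {M : ℕ} (hM : 0 < M) (S : ℕ) :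
    ∃ C : ℝ, 0 < C ∧ ∀ (ι : Type) [Countable ι] (a u : ι → ℝ) (Z A c D T : ℝ),
      (∀ p, 0 ≤ u p) → (Summable fun p => |a p| / (1 + u p) ^ M) →
      ∑' p, |a p| / (1 + u p) ^ M ≤ Z → 0 ≤ c → 0 < D → 0 < T →
      (∀ t, 0 < t → t ≤ T → |∑' p, a p * Real.exp (-(u p ^ 2 * t))| ≤
        A * t ^ (-c) * Real.exp (-(D ^ 2 / t))) →
      |∑' p, a p * h (u p)| ≤ C * Z / D ^ S := by
  obtain ⟨w, hw, hwS, hrep⟩ := hh.exists_sinc_cos_transform M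
  set I₀ := ∫ ξ, |w ξ|
  set I := ∫ ξ, |ξ| ^ S * |w ξ|
  have hI₀ : 0 ≤ I₀ := integral_nonneg fun _ => abs_nonneg _
  have hI : 0 ≤ I := integral_nonneg fun _ => by positivity
  -- The two summands serve the regimes `D ≥ 2M` and `D < 2M`; the final `+ 1` only ensures
  -- positivity. The constant is independent of `A`, `c` and `T`, which matters when these change
  -- under rescaling.
  refine ⟨2 ^ M * ((4 * Real.pi) ^ S * I + (2 * M) ^ S * I₀) + 1, by positivity, ?_⟩
  intro ι _ a u Z A c D T hu hsum hZ hc hD hT hb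
  have hZ0 : 0 ≤ Z := (tsum_nonneg fun p => div_nonneg (abs_nonneg _)
    (pow_nonneg (by linarith [hu p]) _)).trans hZ
  set V : ℝ → ℝ := fun ξ => ∑' p, a p * (Real.cos (2 * Real.pi * ξ * u p) * Real.sinc (u p) ^ M)
    with hV
  have hcs : ∀ ξ p, |a p * (Real.cos (2 * Real.pi * ξ * u p) * Real.sinc (u p) ^ M)| ≤
      2 ^ M * (|a p| / (1 + u p) ^ M) := by
    intro ξ p
    rw [abs_mul, abs_mul, abs_pow]
    calc |a p| * (|Real.cos (2 * Real.pi * ξ * u p)| * |Real.sinc (u p)| ^ M)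
        ≤ |a p| * (1 * (2 ^ M / (1 + u p) ^ M)) := by
          gcongr
          · exact Real.abs_cos_le_one _
          · exact abs_sinc_pow_le (hu p) M
      _ = _ := by ring
  have hVle : ∀ ξ, |V ξ| ≤ 2 ^ M * Z := by
    intro ξ
    have h1 : Summable fun p =>
        ‖a p * (Real.cos (2 * Real.pi * ξ * u p) * Real.sinc (u p) ^ M)‖ :=
      Summable.of_nonneg_of_le (fun _ => norm_nonneg _) (hcs ξ) (hsum.mul_left _)
    calc |V ξ| ≤ ∑' p, ‖a p * (Real.cos (2 * Real.pi * ξ * u p) * Real.sinc (u p) ^ M)‖ :=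
          norm_tsum_le_tsum_norm h1
      _ ≤ ∑' p, 2 ^ M * (|a p| / (1 + u p) ^ M) := h1.tsum_le_tsum (hcs ξ) (hsum.mul_left _)
      _ ≤ 2 ^ M * Z := by rw [tsum_mul_left]; gcongr
  have hV0 : ∀ ξ, (2 * Real.pi * |ξ| + M) ^ 2 ≤ D ^ 2 → V ξ = 0 := by
    intro ξ hξ
    have h1 := tsum_cos_mul_sinc_eq_zero hu (s := 2 * Real.pi * |ξ|) (by positivity) hM hsum hc hT
      hb hξ
    rw [← h1]
    refine tsum_congr fun p => ?_
    congr 2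
    rw [← Real.cos_abs (2 * Real.pi * ξ * u p), abs_mul, abs_mul, abs_of_nonneg (hu p),
      abs_of_pos Real.two_pi_pos]
  have hint : ∀ p, Integrable fun ξ =>
      w ξ * (a p * (Real.cos (2 * Real.pi * ξ * u p) * Real.sinc (u p) ^ M)) := fun p =>
    hw.mul_bdd (by fun_prop) (Eventually.of_forall fun ξ => hcs ξ p)
  have hswap : ∑' p, a p * h (u p) = ∫ ξ, w ξ * V ξ := by
    have h1 : ∀ p, a p * h (u p) =
        ∫ ξ, w ξ * (a p * (Real.cos (2 * Real.pi * ξ * u p) * Real.sinc (u p) ^ M)) := by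
      intro p
      rw [hrep (u p), ← integral_const_mul]
      exact integral_congr_ae (Eventually.of_forall fun ξ => by ring)
    simp_rw [h1]
    rw [integral_tsum_of_summable_integral_norm hint]
    · exact integral_congr_ae (Eventually.of_forall fun ξ => tsum_mul_left)
    · refine Summable.of_nonneg_of_le (fun p => integral_nonneg fun _ => norm_nonneg _)
        (fun p => ?_) (hsum.mul_left (I₀ * 2 ^ M))
      calc _ ≤ ∫ ξ, |w ξ| * (2 ^ M * (|a p| / (1 + u p) ^ M)) := by
            refine integral_mono (hint p).norm (hw.abs.mul_const _) fun ξ => ?_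
            rw [norm_mul]
            exact mul_le_mul_of_nonneg_left (hcs ξ p) (norm_nonneg _)
        _ = _ := by rw [integral_mul_const]; ring
  have hgoal : ∀ B : ℝ, B ≤ (2 ^ M * ((4 * Real.pi) ^ S * I + (2 * M) ^ S * I₀)) * Z / D ^ S →
      B ≤ (2 ^ M * ((4 * Real.pi) ^ S * I + (2 * M) ^ S * I₀) + 1) * Z / D ^ S := fun B hB =>
    hB.trans (by gcongr; linarith)
  rw [hswap]
  refine hgoal _ ?_
  have hab : |∫ ξ, w ξ * V ξ| ≤ ∫ ξ, |w ξ * V ξ| := abs_integral_le_integral_abs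
  -- If `D ≥ 2M`, then `V ξ ≠ 0` forces `D < 2π|ξ| + M`, hence `1 ≤ 4π|ξ|/D`, and the `S`-th power
  -- of this ratio can be inserted. If `D < 2M`, the trivial bound suffices, since `D^S ≤ (2M)^S`.
  rcases le_or_gt (2 * (M : ℝ)) D with hDM | hDM
  · have h1 : ∫ ξ, |w ξ * V ξ| ≤
        ∫ ξ, (2 ^ M * Z * (4 * Real.pi) ^ S / D ^ S) * (|ξ| ^ S * |w ξ|) := by
      refine integral_mono_of_nonneg (Eventually.of_forall fun _ => abs_nonneg _)
        ((hwS S).const_mul _) (Eventually.of_forall fun ξ => ?_)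
      simp only [abs_mul]
      by_cases hξ : (2 * Real.pi * |ξ| + M) ^ 2 ≤ D ^ 2
      · rw [hV0 ξ hξ, abs_zero, mul_zero]; positivity
      · have h2 : D < 2 * Real.pi * |ξ| + M :=
          lt_of_pow_lt_pow_left₀ 2 (by positivity) (not_le.1 hξ)
        have h3 : 1 ≤ 4 * Real.pi * |ξ| / D := by rw [le_div_iff₀ hD]; linarith
        have h4 : 1 ≤ (4 * Real.pi * |ξ| / D) ^ S := one_le_pow₀ h3
        calc |w ξ| * |V ξ| ≤ |w ξ| * (2 ^ M * Z) * 1 := by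
              rw [mul_one]; exact mul_le_mul_of_nonneg_left (hVle ξ) (abs_nonneg _)
          _ ≤ |w ξ| * (2 ^ M * Z) * (4 * Real.pi * |ξ| / D) ^ S := by gcongr
          _ = _ := by rw [div_pow, mul_pow]; ring
    rw [integral_const_mul] at h1
    refine hab.trans (h1.trans ?_)
    rw [div_mul_eq_mul_div]
    refine div_le_div_of_nonneg_right ?_ (by positivity)
    change _ * I ≤ _
    have : 0 ≤ 2 ^ M * ((2 * M) ^ S * I₀) * Z := by positivity
    nlinarith
  · have h1 : ∫ ξ, |w ξ * V ξ| ≤ ∫ ξ, (2 ^ M * Z) * |w ξ| := by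
      refine integral_mono_of_nonneg (Eventually.of_forall fun _ => abs_nonneg _)
        (hw.abs.const_mul _) (Eventually.of_forall fun ξ => ?_)
      simp only [abs_mul]
      rw [mul_comm]
      exact mul_le_mul_of_nonneg_right (hVle ξ) (abs_nonneg _)
    rw [integral_const_mul] at h1
    refine hab.trans (h1.trans ?_)
    rw [le_div_iff₀ (by positivity)]
    have h2 : D ^ S ≤ (2 * M) ^ S := pow_le_pow_left₀ hD.le hDM.le S
    calc 2 ^ M * Z * I₀ * D ^ S ≤ 2 ^ M * Z * I₀ * (2 * M) ^ S := by gcongr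
      _ ≤ _ := by
        have : 0 ≤ 2 ^ M * ((4 * Real.pi) ^ S * I) * Z := by positivity
        nlinarith

/-! ### Weighted sums and kernel bounds -/

/-- The indices are grouped into shells `i ≤ l p / n < i + 1`. The variation bound gives
`O((n(i+1))^Q)` per shell, the weight gives `(i+1)^(-M)`, and `Q - M < -1` makes the sum over `i`
finite. -/
lemma exists_weighted_sum_const {Q : ℝ} (hQ : 0 ≤ Q) {M : ℕ} (hM : Q + 1 < M) {n₀ : ℝ}
    (hn₀ : 0 < n₀) :
    ∃ C : ℝ, 0 < C ∧ ∀ (ι : Type) (a l : ι → ℝ) (C₀ : ℝ), 0 ≤ C₀ → (∀ p, 0 ≤ l p) →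
      (∀ m : ℕ, 0 < m → ∀ s : Finset ι, (∀ p ∈ s, l p < m) →
        ∑ p ∈ s, |a p| ≤ C₀ * (m : ℝ) ^ Q) →
      ∀ n : ℝ, n₀ ≤ n → (Summable fun p => |a p| / (1 + l p / n) ^ M) ∧
        ∑' p, |a p| / (1 + l p / n) ^ M ≤ C * (C₀ * n ^ Q) := by
  have hs : Summable fun i : ℕ => ((i : ℝ) + 1) ^ (Q - M) := by
    have := (summable_nat_add_iff 1).2 (Real.summable_nat_rpow.2 (show Q - M < -1 by linarith))
    simpa using this
  -- The variation bound is available at integers only; rounding `n(i+1)` up costs at most the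
  -- factor `E`, because `n ≥ n₀`.
  set E : ℝ := 1 + 1 / n₀ with hE
  have hE0 : 0 < E := by positivity
  set Z₀ := ∑' i : ℕ, ((i : ℝ) + 1) ^ (Q - M)
  have hZ₀ : 0 ≤ Z₀ := tsum_nonneg fun i => by positivity
  refine ⟨E ^ Q * Z₀ + 1, by positivity, fun ι a l C₀ hC₀ hl hvar n hn => ?_⟩
  have hn' : 0 < n := hn₀.trans_le hn
  have hnn : ∀ p, 0 ≤ |a p| / (1 + l p / n) ^ M := fun p => by have := hl p; positivity
  have key : ∀ s : Finset ι, ∑ p ∈ s, |a p| / (1 + l p / n) ^ M ≤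
      (E ^ Q * Z₀ + 1) * (C₀ * n ^ Q) := by
    intro s
    classical
    have hfib := Finset.sum_fiberwise_of_maps_to (s := s) (t := s.image fun p => ⌊l p / n⌋₊)
      (g := fun p => ⌊l p / n⌋₊) (fun p hp => Finset.mem_image_of_mem _ hp)
      (fun p => |a p| / (1 + l p / n) ^ M)
    rw [← hfib]
    have hshell : ∀ i : ℕ, ∑ p ∈ s with ⌊l p / n⌋₊ = i, |a p| / (1 + l p / n) ^ M ≤
        (E ^ Q * (C₀ * n ^ Q)) * ((i : ℝ) + 1) ^ (Q - M) := by
      intro i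
      have hi : (0 : ℝ) < (i : ℝ) + 1 := by positivity
      set m := ⌈n * (i + 1)⌉₊ with hm
      have hm0 : 0 < m := Nat.ceil_pos.2 (by positivity)
      have hmle : (m : ℝ) ≤ E * n * (i + 1) := by
        have h1 := (Nat.ceil_lt_add_one (show 0 ≤ n * ((i : ℝ) + 1) by positivity)).le
        refine h1.trans ?_
        have h2 : 1 ≤ 1 / n₀ * n * (i + 1) := by
          have h3 : 1 ≤ 1 / n₀ * n := by
            rw [one_div, ← div_eq_inv_mul, le_div_iff₀ hn₀]; linarith
          nlinarith [(Nat.cast_nonneg i : (0 : ℝ) ≤ i)]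
        rw [hE]; linarith
      have hv := hvar m hm0 (s.filter fun p => ⌊l p / n⌋₊ = i) (by
        intro p hp
        have h1 := Nat.lt_floor_add_one (l p / n)
        rw [(Finset.mem_filter.1 hp).2, div_lt_iff₀ hn'] at h1
        calc l p < (i + 1) * n := h1
          _ = n * (i + 1) := mul_comm _ _
          _ ≤ m := Nat.le_ceil _)
      calc ∑ p ∈ s with ⌊l p / n⌋₊ = i, |a p| / (1 + l p / n) ^ M
          ≤ ∑ p ∈ s with ⌊l p / n⌋₊ = i, |a p| / ((i : ℝ) + 1) ^ M := by
            refine Finset.sum_le_sum fun p hp => ?_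
            have h1 := Nat.floor_le (show 0 ≤ l p / n from div_nonneg (hl p) hn'.le)
            rw [(Finset.mem_filter.1 hp).2] at h1
            exact div_le_div_of_nonneg_left (abs_nonneg _) (by positivity)
              (pow_le_pow_left₀ hi.le (by linarith) _)
        _ = (∑ p ∈ s with ⌊l p / n⌋₊ = i, |a p|) / ((i : ℝ) + 1) ^ M := by
            rw [Finset.sum_div]
        _ ≤ (C₀ * (E * n * (i + 1)) ^ Q) / ((i : ℝ) + 1) ^ M := by
            gcongr
            refine hv.trans ?_
            gcongr
        _ = _ := by
            rw [Real.mul_rpow (by positivity) hi.le, Real.mul_rpow hE0.le hn'.le,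
              Real.rpow_sub hi, Real.rpow_natCast]
            ring
    calc _ ≤ ∑ i ∈ s.image fun p => ⌊l p / n⌋₊,
          (E ^ Q * (C₀ * n ^ Q)) * ((i : ℝ) + 1) ^ (Q - M) :=
          Finset.sum_le_sum fun i _ => hshell i
      _ = (E ^ Q * (C₀ * n ^ Q)) * ∑ i ∈ s.image fun p => ⌊l p / n⌋₊,
          ((i : ℝ) + 1) ^ (Q - M) := by rw [Finset.mul_sum]
      _ ≤ (E ^ Q * (C₀ * n ^ Q)) * Z₀ := by
          gcongr
          exact hs.sum_le_tsum _ fun i _ => by positivity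
      _ ≤ _ := by
          have : 0 ≤ C₀ * n ^ Q := by positivity
          nlinarith
  have hsum := summable_of_sum_le hnn key
  exact ⟨hsum, hsum.tsum_le_of_sum_le key⟩

/-- Bounds for filtered kernels under a variation bound and a Gaussian upper bound. -/
theorem IsCutoff.exists_kernel_const {h : ℝ → ℝ} (hh : IsCutoff h) {Q : ℝ} (hQ : 0 ≤ Q) (S : ℕ)
    {n₀ C₀ c₁ c c₂ : ℝ} (hn₀ : 0 < n₀) (hC₀ : 0 < C₀) (hc : 0 ≤ c) (hc₂ : 0 < c₂) :
    ∃ K : ℝ, 0 < K ∧ ∀ (ι : Type) [Countable ι] (a l : ι → ℝ) (d : ℝ), (∀ p, 0 ≤ l p) →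
      (∀ m : ℕ, 0 < m → ∀ s : Finset ι, (∀ p ∈ s, l p < m) →
        ∑ p ∈ s, |a p| ≤ C₀ * (m : ℝ) ^ Q) →
      (∀ t, 0 < t → t ≤ 1 → |∑' p, a p * Real.exp (-(l p ^ 2 * t))| ≤
        c₁ * t ^ (-c) * Real.exp (-(c₂ * (d ^ 2 / t)))) →
      ∀ n : ℝ, n₀ ≤ n → |∑' p, a p * h (l p / n)| ≤ K * n ^ Q ∧
        (0 < d → |∑' p, a p * h (l p / n)| ≤ K * n ^ Q / (n * d) ^ S) := by
  obtain ⟨M, hM⟩ := exists_nat_gt (Q + 1)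
  have hM0 : 0 < M := by
    have : (0 : ℝ) < M := by linarith
    exact_mod_cast this
  obtain ⟨C, hC, hweight⟩ := exists_weighted_sum_const hQ hM hn₀
  obtain ⟨C', hC', hloc⟩ := hh.exists_localization hM0 S
  refine ⟨2 ^ M * (C * C₀) + C' * (C * C₀) / √c₂ ^ S, by positivity, ?_⟩
  intro ι _ a l d hl hvar hgauss n hn
  have hn' : 0 < n := hn₀.trans_le hn
  obtain ⟨hsum, hZ⟩ := hweight ι a l C₀ hC₀.le hl hvar n hn
  have hu : ∀ p, 0 ≤ l p / n := fun p => div_nonneg (hl p) hn'.le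
  constructor
  · have hb : ∀ p, ‖a p * h (l p / n)‖ ≤ 2 ^ M * (|a p| / (1 + l p / n) ^ M) := by
      intro p
      rw [norm_mul, Real.norm_eq_abs, Real.norm_eq_abs]
      have : |h (l p / n)| ≤ 2 ^ M / (1 + l p / n) ^ M := by
        have hpos : (0 : ℝ) < (1 + l p / n) ^ M := pow_pos (by linarith [hu p]) _
        rcases lt_or_ge (l p / n) 1 with h1 | h1
        · rw [abs_of_nonneg (hh.mem_Icc _).1]
          refine (hh.mem_Icc _).2.trans ?_
          rw [one_le_div hpos]
          exact pow_le_pow_left₀ (by linarith [hu p]) (by linarith) _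
        · rw [hh.eq_zero _ h1, abs_zero]
          exact div_nonneg (by positivity) hpos.le
      calc _ ≤ |a p| * (2 ^ M / (1 + l p / n) ^ M) := by gcongr
        _ = _ := by ring
    calc |∑' p, a p * h (l p / n)| ≤ ∑' p, 2 ^ M * (|a p| / (1 + l p / n) ^ M) :=
          tsum_of_norm_bounded (hsum.mul_left _).hasSum hb
      _ ≤ 2 ^ M * (C * (C₀ * n ^ Q)) := by rw [tsum_mul_left]; gcongr
      _ = 2 ^ M * (C * C₀) * n ^ Q := by ring
      _ ≤ _ := by
          gcongr
          have : 0 ≤ C' * (C * C₀) / √c₂ ^ S := by positivity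
          linarith
  · intro hd
    have hsq : 0 < √c₂ := Real.sqrt_pos.2 hc₂
    have hD : 0 < √c₂ * (n * d) := by positivity
    -- Rescaling to `u = l/n` replaces heat time `t` by `t/n²`. The resulting prefactor `c₁ n^(2c)`
    -- is harmless, since the localization bound does not involve it.
    have h1 := hloc ι a (fun p => l p / n) (C * (C₀ * n ^ Q)) (c₁ * (n ^ 2) ^ c) c
      (√c₂ * (n * d)) (n ^ 2) hu hsum hZ hc hD (by positivity) (by
        intro t ht htn
        have h2 := hgauss (t / n ^ 2) (by positivity) (by rwa [div_le_one (by positivity)])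
        have e1 : ∀ p, l p ^ 2 * (t / n ^ 2) = (l p / n) ^ 2 * t := fun p => by
          rw [div_pow]; ring
        simp_rw [e1] at h2
        refine h2.trans (le_of_eq ?_)
        have e2 : (t / n ^ 2) ^ (-c) = (n ^ 2) ^ c * t ^ (-c) := by
          rw [Real.div_rpow ht.le (by positivity), Real.rpow_neg (by positivity : 0 ≤ n ^ 2),
            div_inv_eq_mul, mul_comm]
        have e3 : c₂ * (d ^ 2 / (t / n ^ 2)) = (√c₂ * (n * d)) ^ 2 / t := by
          rw [mul_pow, Real.sq_sqrt hc₂.le]; field_simp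
        rw [e2, e3]; ring)
    refine h1.trans ?_
    rw [mul_pow]
    calc C' * (C * (C₀ * n ^ Q)) / (√c₂ ^ S * (n * d) ^ S)
        = C' * (C * C₀) / √c₂ ^ S * n ^ Q / (n * d) ^ S := by field_simp
      _ ≤ _ := by
          gcongr
          have : 0 ≤ 2 ^ M * (C * C₀) := by positivity
          linarith

namespace DataSpace

variable {X : Type*} [MetricSpace X] [CompactSpace X] [MeasurableSpace X] [BorelSpace X]

lemma lam_nonneg (Ξ : DataSpace X) (k : ℕ) : 0 ≤ Ξ.lam k :=
  Ξ.lam_zero ▸ Ξ.lam_mono (Nat.zero_le k)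

/-- The filtered kernels of a data space are localized. -/
theorem exists_kernel_bound (Ξ : DataSpace X) {h : ℝ → ℝ} (hh : IsCutoff h) :
    ∃ q κ : ℝ, 1 ≤ q ∧ 0 < κ ∧
      (∀ (x : X) (r : ℝ), 0 < r → Ξ.μ.real (Metric.closedBall x r) ≤ κ * r ^ q) ∧
      ∀ S : ℕ, ∃ K : ℝ, 0 < K ∧ ∀ n : ℝ, 1 ≤ n → ∀ x y, |Ξ.kernel h n x y| ≤ K * n ^ q ∧
        (0 < dist x y → |Ξ.kernel h n x y| ≤ K * n ^ q / (n * dist x y) ^ S) := by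
  obtain ⟨q, hq, ⟨κ, hκ, hball⟩, ⟨κ₁, κ₂, hκ₁, hκ₂, hheat⟩⟩ := Ξ.exists_exponent
  refine ⟨q, κ, hq, hκ, fun x r hr => (hball x r hr).2, fun S => ?_⟩
  obtain ⟨K, hK, hbound⟩ := hh.exists_kernel_const (by linarith : 0 ≤ q) S (n₀ := 1)
    (C₀ := Real.exp 1 * κ₁) (c₁ := κ₁) (c := q / 2) (c₂ := κ₂) one_pos
    (by positivity) (by linarith) hκ₂
  -- The heat kernel on the diagonal at time `1/m²` has nonnegative terms, and its multiplier is at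
  -- least `1/e` on frequencies below `m`.
  have hdiag : ∀ m : ℕ, 0 < m → ∀ s : Finset ℕ, (∀ p ∈ s, Ξ.lam p < m) → ∀ x,
      ∑ p ∈ s, Ξ.phi p x ^ 2 ≤ Real.exp 1 * κ₁ * (m : ℝ) ^ q := by
    intro m hm s hs x
    have hm' : (0 : ℝ) < m := by exact_mod_cast hm
    have hm1 : (1 : ℝ) ≤ m := by exact_mod_cast hm
    set t : ℝ := 1 / (m : ℝ) ^ 2 with ht
    have ht0 : 0 < t := by positivity
    have ht1 : t ≤ 1 := by rw [ht, div_le_one (by positivity)]; exact one_le_pow₀ hm1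
    obtain ⟨hsum, hle⟩ := hheat x x t ht0 ht1
    have h1 : ∀ p ∈ s, Ξ.phi p x ^ 2 ≤
        Real.exp 1 * (Real.exp (-(Ξ.lam p ^ 2 * t)) * Ξ.phi p x * Ξ.phi p x) := by
      intro p hp
      have h2 : Ξ.lam p ^ 2 * t ≤ 1 := by
        rw [ht, mul_one_div, div_le_one (by positivity)]
        exact pow_le_pow_left₀ (Ξ.lam_nonneg p) (hs p hp).le 2
      have h3 : 1 ≤ Real.exp 1 * Real.exp (-(Ξ.lam p ^ 2 * t)) := by
        rw [← Real.exp_add]; exact Real.one_le_exp (by linarith)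
      nlinarith [sq_nonneg (Ξ.phi p x)]
    have h4 : κ₁ * t ^ (-(q / 2)) * Real.exp (-(κ₂ * (dist x x ^ 2 / t))) = κ₁ * (m : ℝ) ^ q := by
      rw [dist_self, ht, one_div, Real.inv_rpow (by positivity), Real.rpow_neg (by positivity),
        inv_inv, ← Real.rpow_natCast, ← Real.rpow_mul hm'.le]
      norm_num
      left; congr 1; ring
    calc ∑ p ∈ s, Ξ.phi p x ^ 2
        ≤ Real.exp 1 * ∑ p ∈ s, Real.exp (-(Ξ.lam p ^ 2 * t)) * Ξ.phi p x * Ξ.phi p x := by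
          rw [Finset.mul_sum]; exact Finset.sum_le_sum h1
      _ ≤ Real.exp 1 * ∑' p, Real.exp (-(Ξ.lam p ^ 2 * t)) * Ξ.phi p x * Ξ.phi p x := by
          gcongr
          refine hsum.sum_le_tsum _ fun p _ => ?_
          rw [mul_assoc]
          exact mul_nonneg (Real.exp_pos _).le (mul_self_nonneg _)
      _ ≤ Real.exp 1 * (κ₁ * (m : ℝ) ^ q) := by
          gcongr
          rw [← h4]; exact (le_abs_self _).trans hle
      _ = _ := by ring
  refine ⟨K, hK, fun n hn x y => ?_⟩
  have hker : Ξ.kernel h n x y = ∑' k, (Ξ.phi k x * Ξ.phi k y) * h (Ξ.lam k / n) :=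
    tsum_congr fun k => by ring
  rw [hker]
  refine hbound ℕ (fun k => Ξ.phi k x * Ξ.phi k y) Ξ.lam (dist x y) Ξ.lam_nonneg ?_ ?_ n hn
  · intro m hm s hs
    have hx := hdiag m hm s hs x
    have hy := hdiag m hm s hs y
    -- The off-diagonal variation follows from the diagonal one by the arithmetic-geometric mean
    -- inequality.
    calc ∑ p ∈ s, |Ξ.phi p x * Ξ.phi p y|
        ≤ ∑ p ∈ s, (Ξ.phi p x ^ 2 + Ξ.phi p y ^ 2) / 2 := by
          refine Finset.sum_le_sum fun p _ => ?_
          rw [abs_le]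
          constructor <;> nlinarith [sq_nonneg (Ξ.phi p x + Ξ.phi p y),
            sq_nonneg (Ξ.phi p x - Ξ.phi p y)]
      _ ≤ _ := by rw [← Finset.sum_div, Finset.sum_add_distrib]; linarith
  · intro t ht ht1
    have := (hheat x y t ht ht1).2
    convert this using 4 with k
    ring

end DataSpace

namespace JointDataSpace

variable {X₁ X₂ : Type*}
  [MetricSpace X₁] [CompactSpace X₁] [MeasurableSpace X₁] [BorelSpace X₁]
  [MetricSpace X₂] [CompactSpace X₂] [MeasurableSpace X₂] [BorelSpace X₂]
  {Ξ₁ : DataSpace X₁} {Ξ₂ : DataSpace X₂} {Q q₁ q₂ : ℝ}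

/-- The filtered kernels of a joint data space are localized. -/
theorem exists_kernel_bound (J : JointDataSpace Ξ₁ Ξ₂ Q q₁ q₂) {h : ℝ → ℝ} (hh : IsCutoff h)
    (S : ℕ) {n₀ : ℝ} (hn₀ : 0 < n₀) :
    ∃ K : ℝ, 0 < K ∧ ∀ n : ℝ, n₀ ≤ n → ∀ x y, |J.kernel h n x y| ≤ K * n ^ Q ∧
      (0 < J.d x y → |J.kernel h n x y| ≤ K * n ^ Q / (n * J.d x y) ^ S) := by
  obtain ⟨C₀, hC₀, hvar⟩ := J.variation
  obtain ⟨c₁, c, c₂, hc₁, hc, hc₂, hgauss⟩ := J.gaussian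
  obtain ⟨K, hK, hbound⟩ := hh.exists_kernel_const J.Q_pos.le S (c₁ := c₁) hn₀ hC₀ hc.le hc₂
  refine ⟨K, hK, fun n hn x y => ?_⟩
  set a : ℕ × ℕ → ℝ := fun p => J.A p.1 p.2 * Ξ₁.phi p.1 x * Ξ₂.phi p.2 y with ha
  set l : ℕ × ℕ → ℝ := fun p => J.ell p.1 p.2 with hl
  have hker : J.kernel h n x y = ∑' p, a p * h (l p / n) := tsum_congr fun p => by
    simp only [ha, hl]; ring
  rw [hker]
  have hl0 : ∀ p, 0 ≤ l p := fun p => J.ell_nonneg _ _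
  have hvar' : ∀ m : ℕ, 0 < m → ∀ s : Finset (ℕ × ℕ), (∀ p ∈ s, l p < m) →
      ∑ p ∈ s, |a p| ≤ C₀ * (m : ℝ) ^ Q := by
    intro m hm s hs
    refine (Finset.sum_le_sum_of_subset_of_nonneg ?_ fun p _ _ => abs_nonneg _).trans
      (hvar m hm x y)
    intro p hp
    simpa using hs p hp
  refine hbound (ℕ × ℕ) a l (J.d x y) hl0 hvar' ?_ n hn
  intro t ht ht1
  obtain ⟨H, hH, hHle⟩ := hgauss x y t ht ht1
  obtain ⟨M, hM⟩ := exists_nat_gt (Q + 1)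
  obtain ⟨C, hC, hweight⟩ := exists_weighted_sum_const J.Q_pos.le hM one_pos
  have hsum := (hweight _ a l C₀ hC₀.le hl0 hvar' 1 le_rfl).1
  simp only [div_one] at hsum
  have hsum' := summable_mul_exp hl0 hsum ht
  -- The Gaussian hypothesis bounds a limit along the sets `ℓ < n`. Absolute summability and
  -- exhaustion by these sets identify that limit with the unordered sum.
  have hfin : Tendsto (fun n : ℕ => (J.finite_ell_lt n).toFinset) atTop atTop := by
    refine tendsto_atTop_finset_of_monotone ?_ ?_
    · intro i j hij p hp
      simp only [Finite.mem_toFinset, mem_ofPred_eq] at hp ⊢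
      exact hp.trans_le (by exact_mod_cast hij)
    · intro p
      obtain ⟨i, hi⟩ := exists_nat_gt (J.ell p.1 p.2)
      exact ⟨i, by simpa using hi⟩
  have hlim := hsum'.hasSum.comp hfin
  have hEq : ∑' p, a p * Real.exp (-(l p ^ 2 * t)) = H := by
    refine tendsto_nhds_unique hlim (hH.congr fun n => ?_)
    simp only [Function.comp, ha, hl]
    exact Finset.sum_congr rfl fun p _ => by ring
  rw [hEq]
  exact hHle

end JointDataSpace

/-! ### Integral bounds -/

section IntegralBounds

universe v

lemma measurable_tail {Y : Type*} [MeasurableSpace Y] {δ : Y → ℝ} (hδ : Measurable δ) (S : ℕ)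
    (ρ : ℝ) : Measurable ({y | ρ ≤ δ y}.indicator fun y => (δ y ^ S)⁻¹) :=
  (hδ.pow_const S).inv.indicator (measurableSet_le measurable_const hδ)

lemma tail_nonneg {Y : Type*} {δ : Y → ℝ} (S : ℕ) {ρ : ℝ} (hρ : 0 < ρ) (y : Y) :
    0 ≤ {y | ρ ≤ δ y}.indicator (fun y => (δ y ^ S)⁻¹) y := by
  refine indicator_nonneg (fun y hy => ?_) y
  have : 0 < δ y := hρ.trans_le hy
  positivity

lemma integrable_tail {Y : Type*} [MeasurableSpace Y] (μ : Measure Y) [IsFiniteMeasure μ]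
    {δ : Y → ℝ} (hδ : Measurable δ) (S : ℕ) {ρ : ℝ} (hρ : 0 < ρ) :
    Integrable ({y | ρ ≤ δ y}.indicator fun y => (δ y ^ S)⁻¹) μ := by
  refine Integrable.of_bound (measurable_tail hδ S ρ).aestronglyMeasurable ((ρ ^ S)⁻¹)
    (Eventually.of_forall fun y => ?_)
  rw [Real.norm_eq_abs, abs_of_nonneg (tail_nonneg S hρ y)]
  refine indicator_apply_le' (fun hy => ?_) fun _ => by positivity
  have hy' : ρ ≤ δ y := hy
  gcongr

/-- The shell `2^i ρ ≤ δ < 2^(i+1) ρ` contributes at most a constant times `ρ^(q-S) 2^(i(q-S))`, a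
geometric series since `q < S`. The constant precedes the space, so it is uniform in the base point
from which `δ` is measured. -/
lemma exists_tail_integral_const {q : ℝ} {S : ℕ} (hqS : q < S) {c₀ : ℝ} (hc₀ : 0 < c₀) :
    ∃ C : ℝ, 0 < C ∧ ∀ (Y : Type v) [MeasurableSpace Y] (μ : Measure Y) [IsFiniteMeasure μ]
      (δ : Y → ℝ), Measurable δ → (∀ ρ, 0 < ρ → μ.real {y | δ y ≤ ρ} ≤ c₀ * ρ ^ q) →
      ∀ ρ, 0 < ρ → ∫ y, {y | ρ ≤ δ y}.indicator (fun y => (δ y ^ S)⁻¹) y ∂μ ≤ C * ρ ^ (q - S) := by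
  have hratio0 : (0 : ℝ) ≤ 2 ^ (q - S) := by positivity
  have hratio1 : (2 : ℝ) ^ (q - S) < 1 :=
    Real.rpow_lt_one_of_one_lt_of_neg (by norm_num) (by linarith)
  have hgeom := summable_geometric_of_lt_one hratio0 hratio1
  refine ⟨c₀ * 2 ^ q * ∑' i : ℕ, ((2 : ℝ) ^ (q - S)) ^ i, ?_, ?_⟩
  · rw [tsum_geometric_of_lt_one hratio0 hratio1]
    have : 0 < 1 - (2 : ℝ) ^ (q - S) := by linarith
    positivity
  intro Y _ μ _ δ hδ hball ρ hρ
  set f : Y → ℝ := {y | ρ ≤ δ y}.indicator fun y => (δ y ^ S)⁻¹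
  have hterm : ∀ i : ℕ, ((2 ^ i * ρ) ^ S)⁻¹ * (c₀ * (2 ^ (i + 1) * ρ) ^ q) =
      c₀ * 2 ^ q * ρ ^ (q - S) * ((2 : ℝ) ^ (q - S)) ^ i := by
    intro i
    have e1 : (2 ^ (i + 1) * ρ : ℝ) ^ q = ((2 : ℝ) ^ q) ^ i * 2 ^ q * ρ ^ q := by
      rw [Real.mul_rpow (by positivity) hρ.le, pow_succ, Real.mul_rpow (by positivity) (by norm_num),
        ← Real.rpow_natCast, ← Real.rpow_natCast, ← Real.rpow_mul (by norm_num),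
        ← Real.rpow_mul (by norm_num), mul_comm (i : ℝ)]
    have e2 : ((2 : ℝ) ^ (q - S)) ^ i = ((2 : ℝ) ^ q) ^ i / (2 ^ i) ^ S := by
      rw [Real.rpow_sub (by norm_num), Real.rpow_natCast, div_pow, ← pow_mul, ← pow_mul, mul_comm i]
    rw [e1, e2, Real.rpow_sub hρ, Real.rpow_natCast, mul_pow]
    field_simp
  have hsum : Summable fun i : ℕ => c₀ * 2 ^ q * ρ ^ (q - S) * ((2 : ℝ) ^ (q - S)) ^ i :=
    hgeom.mul_left _
  -- Each shell is enlarged to the full set `δ ≤ 2^(i+1) ρ`; one term of the sum already dominates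
  -- `f y`.
  have hpt : ∀ y, ENNReal.ofReal (f y) ≤ ∑' i : ℕ,
      {y | δ y ≤ 2 ^ (i + 1) * ρ}.indicator
        (fun _ => ENNReal.ofReal ((2 ^ i * ρ) ^ S)⁻¹) y := by
    intro y
    by_cases hy : ρ ≤ δ y
    · obtain ⟨i, hi1, hi2⟩ := exists_nat_pow_near (x := δ y / ρ) (by rwa [one_le_div hρ])
        (one_lt_two : (1 : ℝ) < 2)
      rw [le_div_iff₀ hρ] at hi1
      rw [div_lt_iff₀ hρ] at hi2
      refine le_trans ?_ (ENNReal.le_tsum i)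
      rw [indicator_of_mem (show y ∈ {y | δ y ≤ 2 ^ (i + 1) * ρ} from hi2.le)]
      refine ENNReal.ofReal_le_ofReal ?_
      simp only [f]
      rw [indicator_of_mem (show y ∈ {y | ρ ≤ δ y} from hy)]
      gcongr
    · simp only [f]
      rw [indicator_of_notMem (show y ∉ {y | ρ ≤ δ y} from hy)]
      simp
  have hlin : ∫⁻ y, ENNReal.ofReal (f y) ∂μ ≤
      ENNReal.ofReal (∑' i : ℕ, c₀ * 2 ^ q * ρ ^ (q - S) * ((2 : ℝ) ^ (q - S)) ^ i) := by
    refine (lintegral_mono hpt).trans ?_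
    rw [lintegral_tsum fun i => (measurable_const.indicator
      (measurableSet_le hδ measurable_const)).aemeasurable,
      ENNReal.ofReal_tsum_of_nonneg (fun i => by positivity) hsum]
    refine ENNReal.tsum_le_tsum fun i => ?_
    rw [lintegral_indicator_const (measurableSet_le hδ measurable_const), ← hterm,
      ENNReal.ofReal_mul (by positivity)]
    gcongr
    rw [← ofReal_measureReal]
    exact ENNReal.ofReal_le_ofReal (hball _ (by positivity))
  rw [integral_eq_lintegral_of_nonneg_ae (Eventually.of_forall (tail_nonneg S hρ))
    (measurable_tail hδ S ρ).aestronglyMeasurable]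
  refine (ENNReal.toReal_mono ENNReal.ofReal_ne_top hlin).trans ?_
  rw [ENNReal.toReal_ofReal (tsum_nonneg fun i => by positivity), tsum_mul_left]
  exact le_of_eq (by ring)

/-- Integral operators with localized kernels: values on `A` and off `A` contribute separately. -/
theorem exists_transfer_const {q : ℝ} {S : ℕ} (hqS : q < S) {c₀ : ℝ} (hc₀ : 0 < c₀) :
    ∃ C : ℝ, 0 < C ∧ ∀ (Y : Type v) [MeasurableSpace Y] (μ : Measure Y) [IsFiniteMeasure μ]
      (δ : Y → ℝ), Measurable δ → (∀ ρ, 0 < ρ → μ.real {y | δ y ≤ ρ} ≤ c₀ * ρ ^ q) →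
      ∀ (k g : Y → ℝ) (A : Set Y) (K n r G_A G : ℝ), 0 < n → 0 < r → 0 ≤ K → 0 ≤ G_A → 0 ≤ G →
      (∀ y, |k y| ≤ K) → (∀ y, 0 < δ y → |k y| ≤ K / (n * δ y) ^ S) → (∀ y ∈ A, |g y| ≤ G_A) →
      (∀ y, |g y| ≤ G) → (∀ y, y ∉ A → r ≤ δ y) →
      |∫ y, g y * k y ∂μ| ≤ C * K * (G_A * n ^ (-q) + G * (n ^ (-(S : ℝ)) * r ^ (q - S))) := by
  obtain ⟨C, hC, htail⟩ := exists_tail_integral_const hqS hc₀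
  refine ⟨c₀ + C, by positivity, ?_⟩
  intro Y _ μ _ δ hδ hball k g A K n r G_A G hn hr hK hG_A hG hk hkd hgA hg hrA
  have hn1 : 0 < 1 / n := by positivity
  set near : Y → ℝ := {y | δ y ≤ 1 / n}.indicator fun _ => 1
  set f₁ : Y → ℝ := {y | 1 / n ≤ δ y}.indicator fun y => (δ y ^ S)⁻¹
  set f₂ : Y → ℝ := {y | r ≤ δ y}.indicator fun y => (δ y ^ S)⁻¹
  have hms : MeasurableSet {y | δ y ≤ 1 / n} := measurableSet_le hδ measurable_const
  have hnear : Integrable near μ := (integrable_const 1).indicator hms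
  have hf₁ : Integrable f₁ μ := integrable_tail μ hδ S hn1
  have hf₂ : Integrable f₂ μ := integrable_tail μ hδ S hr
  have hf₁0 : ∀ y, 0 ≤ f₁ y := tail_nonneg S hn1
  have hf₂0 : ∀ y, 0 ≤ f₂ y := tail_nonneg S hr
  have hnear0 : ∀ y, 0 ≤ near y := fun y => indicator_nonneg (fun _ _ => zero_le_one) y
  have hkf : ∀ (ρ : ℝ) y, 0 < ρ → ρ ≤ δ y → |k y| ≤ K / n ^ S * (δ y ^ S)⁻¹ := by
    intro ρ y hρ hy
    refine (hkd y (hρ.trans_le hy)).trans (le_of_eq ?_)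
    rw [mul_pow]; field_simp
  -- On `A` the kernel is split at distance `1/n`; off `A` the distance is at least `r`, and only
  -- the tail contributes.
  have hpt : ∀ y, ‖g y * k y‖ ≤ G_A * K * near y + G_A * (K / n ^ S) * f₁ y +
      G * (K / n ^ S) * f₂ y := by
    intro y
    rw [norm_mul, Real.norm_eq_abs, Real.norm_eq_abs]
    by_cases hy : y ∈ A
    · have h1 : |k y| ≤ K * near y + K / n ^ S * f₁ y := by
        rcases le_total (δ y) (1 / n) with h | h
        · have : near y = 1 := indicator_of_mem (show y ∈ {y | δ y ≤ 1 / n} from h) _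
          rw [this, mul_one]
          have := hk y
          have : 0 ≤ K / n ^ S * f₁ y := mul_nonneg (by positivity) (hf₁0 y)
          linarith
        · have : f₁ y = (δ y ^ S)⁻¹ := indicator_of_mem (show y ∈ {y | 1 / n ≤ δ y} from h) _
          rw [this]
          have := hkf _ y hn1 h
          have : 0 ≤ K * near y := mul_nonneg hK (hnear0 y)
          linarith
      have h2 : 0 ≤ G * (K / n ^ S) * f₂ y := mul_nonneg (by positivity) (hf₂0 y)
      calc |g y| * |k y| ≤ G_A * (K * near y + K / n ^ S * f₁ y) := by
            gcongr; exact hgA y hy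
        _ ≤ _ := by linarith
    · have h : r ≤ δ y := hrA y hy
      have : f₂ y = (δ y ^ S)⁻¹ := indicator_of_mem (show y ∈ {y | r ≤ δ y} from h) _
      rw [this]
      have h1 : 0 ≤ G_A * K * near y := mul_nonneg (by positivity) (hnear0 y)
      have h2 : 0 ≤ G_A * (K / n ^ S) * f₁ y := mul_nonneg (by positivity) (hf₁0 y)
      calc |g y| * |k y| ≤ G * (K / n ^ S * (δ y ^ S)⁻¹) := by
            gcongr
            · exact hg y
            · exact hkf r y hr h
        _ ≤ _ := by linarith
  have hi1 : ∫ y, near y ∂μ ≤ c₀ * n ^ (-q) := by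
    have h1 : ∫ y, near y ∂μ = μ.real {y | δ y ≤ 1 / n} := by
      simp only [near]; rw [integral_indicator_const _ hms]; simp
    rw [h1]
    refine (hball _ hn1).trans (le_of_eq ?_)
    rw [one_div, Real.inv_rpow hn.le, Real.rpow_neg hn.le]
  have hi2 : ∫ y, f₁ y ∂μ ≤ C * (n ^ S * n ^ (-q)) := by
    refine (htail Y μ δ hδ hball _ hn1).trans (le_of_eq ?_)
    rw [one_div, Real.inv_rpow hn.le, ← Real.rpow_neg hn.le, ← Real.rpow_natCast,
      ← Real.rpow_add hn]
    congr 2; ring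
  have hi3 : ∫ y, f₂ y ∂μ ≤ C * r ^ (q - S) := htail Y μ δ hδ hball _ hr
  have hint : Integrable (fun y => G_A * K * near y + G_A * (K / n ^ S) * f₁ y +
      G * (K / n ^ S) * f₂ y) μ :=
    ((hnear.const_mul _).add (hf₁.const_mul _)).add (hf₂.const_mul _)
  rw [← Real.norm_eq_abs]
  refine (norm_integral_le_of_norm_le hint (Eventually.of_forall hpt)).trans ?_
  have hint' : Integrable (fun y => G_A * K * near y + G_A * (K / n ^ S) * f₁ y) μ :=
    (hnear.const_mul _).add (hf₁.const_mul _)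
  rw [integral_add hint' (hf₂.const_mul _),
    integral_add (hnear.const_mul _) (hf₁.const_mul _), integral_const_mul, integral_const_mul,
    integral_const_mul]
  have hnS : n ^ (-(S : ℝ)) = (n ^ S)⁻¹ := by rw [Real.rpow_neg hn.le, Real.rpow_natCast]
  rw [hnS]
  calc _ ≤ G_A * K * (c₀ * n ^ (-q)) + G_A * (K / n ^ S) * (C * (n ^ S * n ^ (-q))) +
        G * (K / n ^ S) * (C * r ^ (q - S)) := by gcongr
    _ = (c₀ + C) * K * (G_A * n ^ (-q)) + C * K * (G * ((n ^ S)⁻¹ * r ^ (q - S))) := by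
        field_simp
    _ ≤ (c₀ + C) * K * (G_A * n ^ (-q)) + (c₀ + C) * K * (G * ((n ^ S)⁻¹ * r ^ (q - S))) := by
        gcongr; linarith
    _ = _ := by ring

end IntegralBounds

/-! ### The operators as polynomials -/

namespace DataSpace

variable {X : Type*} [MetricSpace X] [CompactSpace X] [MeasurableSpace X] [BorelSpace X]

instance (Ξ : DataSpace X) : IsProbabilityMeasure Ξ.μ := Ξ.isProb

lemma integrable (Ξ : DataSpace X) (f : C(X, ℝ)) : Integrable f Ξ.μ :=
  Integrable.of_bound f.continuous.aestronglyMeasurable ‖f‖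
    (Eventually.of_forall f.norm_coe_le_norm)

lemma finite_lam_lt (Ξ : DataSpace X) (n : ℝ) : {k | Ξ.lam k < n}.Finite := by
  obtain ⟨N, hN⟩ := (Ξ.lam_tendsto.eventually_ge_atTop n).exists_forall_of_atTop
  refine (finite_lt_nat N).subset fun k hk => ?_
  by_contra hkN
  exact absurd (hN k (not_lt.1 hkN)) (not_le.2 hk)

/-- The Fourier coefficient of order `k`. -/
def coeff (Ξ : DataSpace X) (k : ℕ) : C(X, ℝ) →ₗ[ℝ] ℝ where
  toFun f := ∫ x, (Ξ.phi k * f) x ∂Ξ.μ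
  map_add' f g := by
    rw [← integral_add (Ξ.integrable _) (Ξ.integrable _)]
    simp [mul_add]
  map_smul' c f := by
    simp only [ContinuousMap.mul_apply, ContinuousMap.smul_apply, smul_eq_mul, RingHom.id_apply]
    rw [← integral_const_mul]
    congr 1; funext x; ring

lemma coeff_phi (Ξ : DataSpace X) (j k : ℕ) : Ξ.coeff j (Ξ.phi k) = if j = k then 1 else 0 :=
  Ξ.orthonormal j k

/-- The operator `σ_n` with values in continuous functions. -/
def sigmaPoly (Ξ : DataSpace X) (h : ℝ → ℝ) (n : ℝ) : C(X, ℝ) →ₗ[ℝ] C(X, ℝ) :=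
  ∑ k ∈ (Ξ.finite_lam_lt n).toFinset, h (Ξ.lam k / n) • (Ξ.coeff k).smulRight (Ξ.phi k)

lemma sigmaPoly_apply (Ξ : DataSpace X) (h : ℝ → ℝ) (n : ℝ) (f : C(X, ℝ)) :
    Ξ.sigmaPoly h n f =
      ∑ k ∈ (Ξ.finite_lam_lt n).toFinset, h (Ξ.lam k / n) • Ξ.coeff k f • Ξ.phi k := by
  simp [sigmaPoly]

lemma sigma_eq_sigmaPoly (Ξ : DataSpace X) {h : ℝ → ℝ} (hh : IsCutoff h) {n : ℝ} (hn : 0 < n)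
    (f : C(X, ℝ)) (x : X) : Ξ.sigma h n f x = Ξ.sigmaPoly h n f x := by
  have hker : ∀ y, Ξ.kernel h n x y * f y = ∑ k ∈ (Ξ.finite_lam_lt n).toFinset,
      (h (Ξ.lam k / n) * Ξ.phi k x) * (Ξ.phi k * f) y := by
    intro y
    rw [kernel, tsum_eq_sum (s := (Ξ.finite_lam_lt n).toFinset), Finset.sum_mul]
    · exact Finset.sum_congr rfl fun k _ => by simp only [ContinuousMap.mul_apply]; ring
    · intro k hk
      have : n ≤ Ξ.lam k := by simpa using hk
      rw [hh.eq_zero _ (by rwa [one_le_div hn]), zero_mul, zero_mul]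
  simp only [sigma, hker]
  rw [integral_finsetSum _ fun k _ => (Ξ.integrable _).const_mul _, sigmaPoly_apply]
  simp only [ContinuousMap.sum_apply, ContinuousMap.smul_apply, smul_eq_mul]
  refine Finset.sum_congr rfl fun k _ => ?_
  rw [integral_const_mul, coeff]
  simp only [LinearMap.coe_mk, AddHom.coe_mk]
  ring

lemma sigmaPoly_mem (Ξ : DataSpace X) (h : ℝ → ℝ) (n : ℝ) (f : C(X, ℝ)) :
    Ξ.sigmaPoly h n f ∈ Ξ.diffusionPoly n := by
  rw [sigmaPoly_apply]
  refine Submodule.sum_mem _ fun k hk => Submodule.smul_mem _ _ (Submodule.smul_mem _ _ ?_)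
  exact Submodule.subset_span ⟨k, by simpa using hk, rfl⟩

lemma coeff_sigmaPoly (Ξ : DataSpace X) {h : ℝ → ℝ} (hh : IsCutoff h) {n : ℝ} (hn : 0 < n)
    (f : C(X, ℝ)) (k : ℕ) : Ξ.coeff k (Ξ.sigmaPoly h n f) = h (Ξ.lam k / n) * Ξ.coeff k f := by
  rw [sigmaPoly_apply, map_sum]
  simp only [map_smul, coeff_phi, smul_eq_mul, mul_ite, mul_one, mul_zero]
  rw [Finset.sum_ite_eq]
  split_ifs with hk
  · rfl
  · have : n ≤ Ξ.lam k := by simpa using hk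
    rw [hh.eq_zero _ (by rwa [one_le_div hn]), zero_mul]

lemma sigmaPoly_phi (Ξ : DataSpace X) {h : ℝ → ℝ} (hh : IsCutoff h) {n : ℝ} (hn : 0 < n) {k : ℕ}
    (hk : Ξ.lam k < n / 2) : Ξ.sigmaPoly h n (Ξ.phi k) = Ξ.phi k := by
  have hmem : k ∈ (Ξ.finite_lam_lt n).toFinset := by
    simp only [Finite.mem_toFinset, mem_ofPred_eq]; linarith
  rw [sigmaPoly_apply, Finset.sum_eq_single k]
  · rw [coeff_phi, if_pos rfl, one_smul, hh.eq_one _ (div_nonneg (Ξ.lam_nonneg k) hn.le), one_smul]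
    rw [div_le_iff₀ hn]; linarith
  · intro j _ hj
    rw [coeff_phi, if_neg hj, zero_smul, smul_zero]
  · exact fun h => absurd hmem h

lemma sigmaPoly_of_mem (Ξ : DataSpace X) {h : ℝ → ℝ} (hh : IsCutoff h) {n : ℝ} (hn : 0 < n)
    {P : C(X, ℝ)} (hP : P ∈ Ξ.diffusionPoly (n / 2)) : Ξ.sigmaPoly h n P = P := by
  have : EqOn (Ξ.sigmaPoly h n) (LinearMap.id : C(X, ℝ) →ₗ[ℝ] C(X, ℝ))
      (Ξ.diffusionPoly (n / 2)) := by
    refine LinearMap.eqOn_span ?_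
    rintro _ ⟨k, hk, rfl⟩
    exact Ξ.sigmaPoly_phi hh hn hk
  exact this hP

lemma diffusionPoly_mono (Ξ : DataSpace X) {m n : ℝ} (hmn : m ≤ n) :
    Ξ.diffusionPoly m ≤ Ξ.diffusionPoly n :=
  Submodule.span_mono (image_mono fun _ hk => lt_of_lt_of_le hk hmn)

/-- The operators `σ_n` are uniformly bounded, and local up to a rapidly decaying error. -/
theorem exists_sigmaPoly_bound (Ξ : DataSpace X) {h : ℝ → ℝ} (hh : IsCutoff h) :
    (∃ C : ℝ, 0 < C ∧ ∀ n : ℝ, 1 ≤ n → ∀ f, ‖Ξ.sigmaPoly h n f‖ ≤ C * ‖f‖) ∧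
    ∀ β ρ : ℝ, 0 < ρ → ∃ C : ℝ, 0 < C ∧ ∀ n : ℝ, 1 ≤ n → ∀ (f : C(X, ℝ)) (x : X),
      (∀ y ∈ Metric.closedBall x ρ, f y = 0) →
      |Ξ.sigmaPoly h n f x| ≤ C * ‖f‖ * n ^ (-β) := by
  obtain ⟨q, κ, hq, hκ, hball, hker⟩ := Ξ.exists_kernel_bound hh
  have main : ∀ S : ℕ, q < S → ∃ C : ℝ, 0 < C ∧ ∀ n : ℝ, 1 ≤ n → ∀ (f : C(X, ℝ)) (x : X)
      (A : Set X) (r F : ℝ), 0 < r → 0 ≤ F → (∀ y ∈ A, |f y| ≤ F) →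
      (∀ y, y ∉ A → r ≤ dist x y) →
      |Ξ.sigmaPoly h n f x| ≤ C * (F + ‖f‖ * (n ^ (q - S) * r ^ (q - S))) := by
    intro S hS
    obtain ⟨K, hK, hKb⟩ := hker S
    obtain ⟨C, hC, hCb⟩ := exists_transfer_const hS hκ
    refine ⟨C * K, by positivity, fun n hn f x A r F hr hF hfA hrA => ?_⟩
    have hn0 : 0 < n := by linarith
    rw [← Ξ.sigma_eq_sigmaPoly hh hn0, sigma]
    simp_rw [mul_comm (Ξ.kernel h n x _)]
    have := hCb X Ξ.μ (fun y => dist x y) (by fun_prop)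
      (fun ρ hρ => by
        have := hball x ρ hρ
        convert this using 3
        ext y; simp [dist_comm])
      (fun y => Ξ.kernel h n x y) f A (K * n ^ q) n r F ‖f‖ hn0 hr (by positivity) hF
      (norm_nonneg _) (fun y => (hKb n hn x y).1) (fun y hy => (hKb n hn x y).2 hy) hfA
      (fun y => f.norm_coe_le_norm y) hrA
    refine this.trans (le_of_eq ?_)
    have e1 : n ^ q * n ^ (-q) = 1 := by rw [← Real.rpow_add hn0]; simp
    have e2 : n ^ q * n ^ (-(S : ℝ)) = n ^ (q - S) := by rw [← Real.rpow_add hn0]; rfl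
    calc _ = C * K * (F * (n ^ q * n ^ (-q)) +
          ‖f‖ * ((n ^ q * n ^ (-(S : ℝ))) * r ^ (q - S))) := by ring
      _ = _ := by rw [e1, e2]; ring
  constructor
  · obtain ⟨S, hS⟩ := exists_nat_gt q
    obtain ⟨C, hC, hb⟩ := main S hS
    refine ⟨C * 2, by positivity, fun n hn f => ?_⟩
    rw [ContinuousMap.norm_le _ (by positivity)]
    intro x
    -- With `A` the whole space nothing lies outside it, so the radius 1 is an arbitrary choice.
    refine (hb n hn f x univ 1 ‖f‖ one_pos (norm_nonneg _) (fun y _ => f.norm_coe_le_norm y)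
      (fun y hy => absurd (mem_univ y) hy)).trans ?_
    have h1 : n ^ (q - S) ≤ 1 := Real.rpow_le_one_of_one_le_of_nonpos hn (by linarith)
    rw [Real.one_rpow, mul_one, mul_assoc]
    have := mul_le_mul_of_nonneg_left h1 (norm_nonneg f)
    gcongr
    linarith
  · intro β ρ hρ
    -- The tail has order `n^(q-S)`, which is at most `n^(-β)` once `S > q + β`. Nothing comes from
    -- inside the ball, where `f = 0`.
    obtain ⟨S, hS⟩ := exists_nat_gt (max q (q + β))
    have hS1 : q < S := (le_max_left _ _).trans_lt hS
    have hS2 : q + β < S := (le_max_right _ _).trans_lt hS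
    obtain ⟨C, hC, hb⟩ := main S hS1
    refine ⟨C * ρ ^ (q - S), by positivity, fun n hn f x hf => ?_⟩
    refine (hb n hn f x (Metric.closedBall x ρ) ρ 0 hρ le_rfl (fun y hy => by simp [hf y hy])
      (fun y hy => ?_)).trans ?_
    · rw [Metric.mem_closedBall, dist_comm] at hy; exact (not_le.1 hy).le
    · have h1 : n ^ (q - S) ≤ n ^ (-β) := Real.rpow_le_rpow_of_exponent_le hn (by linarith)
      calc C * (0 + ‖f‖ * (n ^ (q - S) * ρ ^ (q - S)))
          = C * ρ ^ (q - S) * ‖f‖ * n ^ (q - S) := by ring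
        _ ≤ _ := by gcongr

end DataSpace

namespace JointDataSpace

variable {X₁ X₂ : Type*}
  [MetricSpace X₁] [CompactSpace X₁] [MeasurableSpace X₁] [BorelSpace X₁]
  [MetricSpace X₂] [CompactSpace X₂] [MeasurableSpace X₂] [BorelSpace X₂]
  {Ξ₁ : DataSpace X₁} {Ξ₂ : DataSpace X₂} {Q q₁ q₂ : ℝ}

/-- The joint operator `σ_n` with values in continuous functions. -/
def sigmaPoly (J : JointDataSpace Ξ₁ Ξ₂ Q q₁ q₂) (h : ℝ → ℝ) (n : ℝ) : C(X₂, ℝ) →ₗ[ℝ] C(X₁, ℝ) :=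
  ∑ p ∈ (J.finite_ell_lt n).toFinset,
    (h (J.ell p.1 p.2 / n) * J.A p.1 p.2) • (Ξ₂.coeff p.2).smulRight (Ξ₁.phi p.1)

lemma sigmaPoly_apply (J : JointDataSpace Ξ₁ Ξ₂ Q q₁ q₂) (h : ℝ → ℝ) (n : ℝ) (f : C(X₂, ℝ)) :
    J.sigmaPoly h n f = ∑ p ∈ (J.finite_ell_lt n).toFinset,
      (h (J.ell p.1 p.2 / n) * J.A p.1 p.2) • Ξ₂.coeff p.2 f • Ξ₁.phi p.1 := by
  simp [sigmaPoly]

lemma sigma_eq_sigmaPoly (J : JointDataSpace Ξ₁ Ξ₂ Q q₁ q₂) {h : ℝ → ℝ} (hh : IsCutoff h) {n : ℝ}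
    (hn : 0 < n) (f : C(X₂, ℝ)) (x : X₁) : J.sigma h n f x = J.sigmaPoly h n f x := by
  have hker : ∀ y, f y * J.kernel h n x y = ∑ p ∈ (J.finite_ell_lt n).toFinset,
      (h (J.ell p.1 p.2 / n) * J.A p.1 p.2 * Ξ₁.phi p.1 x) * (Ξ₂.phi p.2 * f) y := by
    intro y
    rw [kernel, tsum_eq_sum (s := (J.finite_ell_lt n).toFinset), Finset.mul_sum]
    · exact Finset.sum_congr rfl fun p _ => by simp only [ContinuousMap.mul_apply]; ring
    · intro p hp
      have : n ≤ J.ell p.1 p.2 := by simpa using hp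
      rw [hh.eq_zero _ (by rwa [one_le_div hn]), zero_mul, zero_mul, zero_mul]
  simp only [sigma, hker]
  rw [integral_finsetSum _ fun p _ => (Ξ₂.integrable _).const_mul _, sigmaPoly_apply]
  simp only [ContinuousMap.sum_apply, ContinuousMap.smul_apply, smul_eq_mul]
  refine Finset.sum_congr rfl fun p _ => ?_
  rw [integral_const_mul, DataSpace.coeff]
  simp only [LinearMap.coe_mk, AddHom.coe_mk]
  ring

lemma sigmaPoly_mem (J : JointDataSpace Ξ₁ Ξ₂ Q q₁ q₂) (h : ℝ → ℝ) {α : ℝ} (hα : 0 < α)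
    (hlam : ∀ j k, Ξ₁.lam j ≤ α * J.ell j k) (n : ℝ) (f : C(X₂, ℝ)) :
    J.sigmaPoly h n f ∈ Ξ₁.diffusionPoly (α * n) := by
  rw [sigmaPoly_apply]
  refine Submodule.sum_mem _ fun p hp => Submodule.smul_mem _ _ (Submodule.smul_mem _ _ ?_)
  refine Submodule.subset_span ⟨p.1, ?_, rfl⟩
  have hp' : J.ell p.1 p.2 < n := by simpa using hp
  exact (hlam p.1 p.2).trans_lt (mul_lt_mul_of_pos_left hp' hα)

/-- At a fixed order, the joint operator does not distinguish `f` from `σ_{2^m}(f)` for large `m`. -/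
lemma eventually_sigmaPoly_sigmaPoly (J : JointDataSpace Ξ₁ Ξ₂ Q q₁ q₂) {h : ℝ → ℝ}
    (hh : IsCutoff h) (n : ℝ) (f : C(X₂, ℝ)) :
    ∀ᶠ m : ℕ in atTop, J.sigmaPoly h n (Ξ₂.sigmaPoly h (2 ^ m) f) = J.sigmaPoly h n f := by
  -- Only finitely many coefficients of `f` enter at order `n`, and `σ_{2^m}` preserves all of them
  -- once `2^m` exceeds twice their frequencies. No density of polynomials is involved.
  have h1 : ∀ᶠ m : ℕ in atTop, ∀ p ∈ (J.finite_ell_lt n).toFinset,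
      Ξ₂.lam p.2 * 2 ≤ (2 : ℝ) ^ m :=
    (Finset.eventually_all _).2 fun p _ =>
      (tendsto_pow_atTop_atTop_of_one_lt (one_lt_two : (1 : ℝ) < 2)).eventually_ge_atTop _
  filter_upwards [h1] with m hm
  rw [sigmaPoly_apply, sigmaPoly_apply]
  refine Finset.sum_congr rfl fun p hp => ?_
  have h2 : (0 : ℝ) < 2 ^ m := by positivity
  rw [Ξ₂.coeff_sigmaPoly hh h2, hh.eq_one _ (div_nonneg (Ξ₂.lam_nonneg _) h2.le), one_mul]
  rw [div_le_iff₀ h2]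
  linarith [hm p hp]

lemma dist_le (J : JointDataSpace Ξ₁ Ξ₂ Q q₁ q₂) (x : X₁) (y z : X₂) :
    dist (J.d x y) (J.d x z) ≤ dist y z := by
  rw [Real.dist_eq, abs_le]
  have h1 := J.d_triangle_right x y z
  have h2 := J.d_triangle_right x z y
  rw [dist_comm] at h1
  constructor <;> linarith

lemma continuous_d (J : JointDataSpace Ξ₁ Ξ₂ Q q₁ q₂) (x : X₁) : Continuous (J.d x) :=
  (LipschitzWith.of_dist_le_mul (K := 1) fun y z => by simpa using J.dist_le x y z).continuous

/-- The first bound holds at every `x`, even far from `B`; it only limits the growth of the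
approximants in the product argument of (b). The second is the local estimate that drives (a). -/
theorem exists_sigmaPoly_bound (J : JointDataSpace Ξ₁ Ξ₂ Q q₁ q₂) {h : ℝ → ℝ} (hh : IsCutoff h)
    {S : ℕ} (hS : q₂ < S) {n₀ : ℝ} (hn₀ : 0 < n₀) :
    ∃ C : ℝ, 0 < C ∧ ∀ n : ℝ, n₀ ≤ n → ∀ (f : C(X₂, ℝ)) (x : X₁),
      |J.sigmaPoly h n f x| ≤ C * ‖f‖ * n ^ Q ∧
      ∀ (A : Set X₂) (r F : ℝ), 0 < r → 0 ≤ F → (∀ y ∈ A, |f y| ≤ F) →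
      (∀ y, y ∉ A → r ≤ J.d x y) →
      |J.sigmaPoly h n f x| ≤ C * (F * n ^ (Q - q₂) + ‖f‖ * (n ^ (Q - S) * r ^ (q₂ - S))) := by
  obtain ⟨c₀, hc₀, hreg⟩ := J.regularity
  obtain ⟨K, hK, hKb⟩ := J.exists_kernel_bound hh S hn₀
  obtain ⟨C, hC, hCb⟩ := exists_transfer_const hS hc₀
  -- The regularity hypothesis is stated for a pair of points, so a point of `X₂` has to be
  -- supplied.
  obtain ⟨y₀⟩ := nonempty_of_isProbabilityMeasure Ξ₂.μ
  refine ⟨C * K + K, by positivity, fun n hn f x => ?_⟩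
  have hn0 : 0 < n := by linarith
  rw [← J.sigma_eq_sigmaPoly hh hn0, sigma]
  constructor
  · rw [← Real.norm_eq_abs]
    refine (norm_integral_le_of_norm_le_const (C := ‖f‖ * (K * n ^ Q))
      (Eventually.of_forall fun y => ?_)).trans ?_
    · rw [norm_mul]
      exact mul_le_mul (f.norm_coe_le_norm y) (hKb n hn x y).1 (norm_nonneg _) (norm_nonneg _)
    · rw [probReal_univ, mul_one]
      have : 0 ≤ C * K * ‖f‖ * n ^ Q := by positivity
      linarith
  · intro A r F hr hF hfA hrA
    have := hCb X₂ Ξ₂.μ (J.d x) (J.continuous_d x).measurable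
      (fun ρ hρ => (hreg x y₀ ρ hρ).2)
      (fun y => J.kernel h n x y) f A (K * n ^ Q) n r F ‖f‖ hn0 hr (by positivity) hF
      (norm_nonneg _) (fun y => (hKb n hn x y).1) (fun y hy => (hKb n hn x y).2 hy) hfA
      (fun y => f.norm_coe_le_norm y) hrA
    refine this.trans ?_
    have e1 : n ^ Q * n ^ (-q₂) = n ^ (Q - q₂) := by rw [← Real.rpow_add hn0]; rfl
    have e2 : n ^ Q * n ^ (-(S : ℝ)) = n ^ (Q - S) := by rw [← Real.rpow_add hn0]; rfl
    calc _ = C * K * (F * (n ^ Q * n ^ (-q₂)) +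
          ‖f‖ * ((n ^ Q * n ^ (-(S : ℝ))) * r ^ (q₂ - S))) := by ring
      _ = C * K * (F * n ^ (Q - q₂) + ‖f‖ * (n ^ (Q - S) * r ^ (q₂ - S))) := by rw [e1, e2]
      _ ≤ _ := by gcongr; linarith

end JointDataSpace

/-! ### Existence and approximation of the lifted function -/

lemma supNormOn_nonneg {X : Type*} (K : Set X) (g : X → ℝ) : 0 ≤ supNormOn K g :=
  Real.iSup_nonneg fun _ => abs_nonneg _

/-- A bound is required because a real `iSup` over an unbounded family takes the value 0. -/
lemma abs_le_supNormOn {X : Type*} {K : Set X} {g : X → ℝ} {b : ℝ} (hb : ∀ x, |g x| ≤ b) {x : X}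
    (hx : x ∈ K) : |g x| ≤ supNormOn K g :=
  le_ciSup (f := fun x : K => |g x|) ⟨b, by rintro _ ⟨y, rfl⟩; exact hb y⟩ ⟨x, hx⟩

lemma supNormOn_le {X : Type*} {K : Set X} {g : X → ℝ} {b : ℝ} (hb0 : 0 ≤ b)
    (hb : ∀ x ∈ K, |g x| ≤ b) : supNormOn K g ≤ b :=
  Real.iSup_le (fun x => hb x x.2) hb0

lemma mul_two_pow_rpow {c : ℝ} (hc : 0 < c) (m : ℕ) (β : ℝ) :
    (c * 2 ^ m) ^ β = c ^ β * (2 : ℝ) ^ ((m : ℝ) * β) := by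
  rw [Real.mul_rpow hc.le (by positivity), ← Real.rpow_natCast, ← Real.rpow_mul (by norm_num)]

/-- The sign of `β` decides which endpoint is extremal; adding the two constants covers both cases.
-/
lemma rpow_le_of_mem_dyadic {c ν : ℝ} (hc : 0 < c) {N : ℕ} (h1 : c * 2 ^ N ≤ ν)
    (h2 : ν ≤ c * 2 ^ (N + 1)) (β : ℝ) :
    ν ^ β ≤ (c ^ β + (2 * c) ^ β) * (2 : ℝ) ^ ((N : ℝ) * β) := by
  have hν : 0 < ν := lt_of_lt_of_le (by positivity) h1
  have e1 := mul_two_pow_rpow hc N β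
  have e2 := mul_two_pow_rpow (c := 2 * c) (by positivity) N β
  have p1 : 0 ≤ c ^ β * (2 : ℝ) ^ ((N : ℝ) * β) := by positivity
  have p2 : 0 ≤ (2 * c) ^ β * (2 : ℝ) ^ ((N : ℝ) * β) := by positivity
  rw [add_mul]
  rcases le_total 0 β with hβ | hβ
  · have := Real.rpow_le_rpow hν.le h2 hβ
    rw [show c * 2 ^ (N + 1) = 2 * c * 2 ^ N by ring, e2] at this
    linarith
  · have := Real.rpow_le_rpow_of_nonpos (by positivity) h1 hβ
    rw [e1] at this
    linarith

lemma exists_dyadic {c ν : ℝ} (hc : 0 < c) (hν : c ≤ ν) :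
    ∃ N : ℕ, c * 2 ^ N ≤ ν ∧ ν ≤ c * 2 ^ (N + 1) := by
  obtain ⟨N, h1, h2⟩ := exists_nat_pow_near (x := ν / c) (by rwa [one_le_div hc])
    (one_lt_two : (1 : ℝ) < 2)
  rw [le_div_iff₀ hc] at h1
  rw [div_lt_iff₀ hc] at h2
  exact ⟨N, by linarith, by linarith⟩

lemma summable_two_rpow {β : ℝ} (hβ : β < 0) : Summable fun m : ℕ => (2 : ℝ) ^ ((m : ℝ) * β) := by
  have h1 : (2 : ℝ) ^ β < 1 := Real.rpow_lt_one_of_one_lt_of_neg (by norm_num) hβ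
  refine (summable_geometric_of_lt_one (by positivity) h1).congr fun m => ?_
  rw [← Real.rpow_natCast, ← Real.rpow_mul (by norm_num), mul_comm]

lemma tsum_two_rpow_add (n : ℕ) (β : ℝ) :
    ∑' i : ℕ, (2 : ℝ) ^ (((n + i : ℕ) : ℝ) * β) =
      (2 : ℝ) ^ ((n : ℝ) * β) * ∑' i : ℕ, (2 : ℝ) ^ ((i : ℝ) * β) := by
  rw [← tsum_mul_left]
  refine tsum_congr fun i => ?_
  rw [← Real.rpow_add (by norm_num)]
  congr 1; push_cast; ring

namespace JointDataSpace

variable {X₁ X₂ : Type*}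
  [MetricSpace X₁] [CompactSpace X₁] [MeasurableSpace X₁] [BorelSpace X₁]
  [MetricSpace X₂] [CompactSpace X₂] [MeasurableSpace X₂] [BorelSpace X₂]
  {Ξ₁ : DataSpace X₁} {Ξ₂ : DataSpace X₂} {Q q₁ q₂ : ℝ}

/-- By compactness of `Bm`, a point of its closed `s`-neighbourhood is within `s` of an actual point
of `Bm`. The triangle inequality then leaves joint distance `r`. -/
lemma IsImageSet.le_d {J : JointDataSpace Ξ₁ Ξ₂ Q q₁ q₂} {r s : ℝ} {A : Set X₂} {B : Set X₁}
    (hB : J.IsImageSet r s A B) (hs : 0 < s) {x : X₁} (hx : x ∈ B) {y : X₂} (hy : y ∉ A) :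
    r ≤ J.d x y := by
  obtain ⟨Bm, hBm, hsub, rfl⟩ := hB
  rw [hBm.cthickening_eq_biUnion_closedBall hs.le] at hx
  simp only [mem_iUnion, Metric.mem_closedBall] at hx
  obtain ⟨z, hz, hxz⟩ := hx
  have h1 : ENNReal.ofReal (s + r) ≤ ENNReal.ofReal (J.d z y) :=
    (hsub hz).trans (iInf₂_le y hy)
  have h3 := J.d_triangle_left z x y
  rw [dist_comm] at h3
  -- `ENNReal.ofReal` truncates negative numbers to 0; in that case `r < 0` and the claim is
  -- trivial.
  by_cases hsr : s + r ≤ 0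
  · have := J.d_nonneg x y; linarith
  · have h2 := (ENNReal.ofReal_le_ofReal_iff (J.d_nonneg z y)).1 h1
    linarith

lemma PolynomialPreservation.sigmaPoly_eq {J : JointDataSpace Ξ₁ Ξ₂ Q q₁ q₂} {h : ℝ → ℝ}
    {cstar : ℝ} (hpp : J.PolynomialPreservation h cstar) (hh : IsCutoff h) {m : ℕ} {P : C(X₂, ℝ)}
    (hP : P ∈ Ξ₂.diffusionPoly (2 ^ m)) {ν : ℝ} (hν : cstar * 2 ^ m ≤ ν) :
    J.sigmaPoly h ν P = J.sigmaPoly h (cstar * 2 ^ m) P := by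
  have h0 : 0 < cstar * 2 ^ m := mul_pos hpp.1 (by positivity)
  have h1 := hpp.2 (2 ^ m) (by positivity) P (by simpa using hP) ν (by simpa using hν)
  ext x
  have h2 := congrFun h1 x
  push_cast at h2
  rwa [J.sigma_eq_sigmaPoly hh (h0.trans_le hν), J.sigma_eq_sigmaPoly hh h0] at h2

/-- Existence of the lifted function as a uniform limit, with an error estimate. -/
theorem exists_lift (J : JointDataSpace Ξ₁ Ξ₂ Q q₁ q₂) {h : ℝ → ℝ} (hh : IsCutoff h) {S : ℕ}
    (hSQ : Q < S) (hSq : q₂ < S) {cstar : ℝ} (hpp : J.PolynomialPreservation h cstar) :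
    ∃ C : ℝ, 0 < C ∧ ∀ (r : ℝ) (A : Set X₂) (B : Set X₁), 0 < r →
      (∀ x ∈ B, ∀ y, y ∉ A → r ≤ J.d x y) → ∀ (f : C(X₂, ℝ)) (e : ℕ → ℝ),
      (∀ m, e m = supNormOn A fun y => Ξ₂.sigmaPoly h (2 ^ (m + 1)) f y -
        Ξ₂.sigmaPoly h (2 ^ m) f y) →
      (Summable fun m : ℕ => (2 : ℝ) ^ ((m : ℝ) * (Q - q₂)) * e m) →
      ∃ g : X₁ → ℝ, TendstoUniformlyOn (fun (ν : ℝ) x => J.sigmaPoly h ν f x) g atTop B ∧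
        ∀ n : ℕ, ∀ x ∈ B, |g x - J.sigmaPoly h (cstar * 2 ^ n) f x| ≤
          C * ((2 : ℝ) ^ ((n : ℝ) * (Q - q₂)) *
                supNormOn A (fun y => f y - Ξ₂.sigmaPoly h (2 ^ n) f y)
            + ‖f‖ * (2 : ℝ) ^ ((n : ℝ) * (Q - S)) * r ^ (q₂ - S)
            + ∑' i : ℕ, (2 : ℝ) ^ (((n + i : ℕ) : ℝ) * (Q - q₂)) * e (n + i)) := by
  have hc := hpp.1
  obtain ⟨C₁, hC₁, hJ⟩ := J.exists_sigmaPoly_bound hh hSq hc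
  obtain ⟨C₂, hC₂, hΞ⟩ := (Ξ₂.exists_sigmaPoly_bound hh).1
  set a := cstar ^ (Q - q₂) + (2 * cstar) ^ (Q - q₂) with ha
  set b := cstar ^ (Q - S) + (2 * cstar) ^ (Q - S) with hb
  have ha0 : 0 < a := by positivity
  have hb0 : 0 < b := by positivity
  set Z := ∑' i : ℕ, (2 : ℝ) ^ ((i : ℝ) * (Q - S)) with hZ
  have hZ0 : 0 ≤ Z := tsum_nonneg fun i => by positivity
  have hQS : Q - S < 0 := by linarith
  set C₃ := C₁ * (a + (1 + 2 * C₂) * b) with hC₃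
  have hC₃0 : 0 < C₃ := by positivity
  refine ⟨C₃ * (1 + Z), by positivity, ?_⟩
  intro r A B hr hB f e he hsum
  set P : ℕ → C(X₂, ℝ) := fun m => Ξ₂.sigmaPoly h (2 ^ m) f with hP
  have hPn : ∀ m, ‖P m‖ ≤ C₂ * ‖f‖ := fun m => hΞ _ (one_le_pow₀ one_le_two) f
  have hPP : ∀ m n, ‖P m - P n‖ ≤ 2 * C₂ * ‖f‖ := fun m n =>
    (norm_sub_le _ _).trans (by linarith [hPn m, hPn n])
  have hsub : ∀ (m n : ℕ) y, |P m y - P n y| ≤ 2 * C₂ * ‖f‖ := fun m n y =>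
    ((P m - P n).norm_coe_le_norm y).trans (hPP m n)
  have heA : ∀ m, ∀ y ∈ A, |P (m + 1) y - P m y| ≤ e m := fun m y hy => by
    rw [he]; exact abs_le_supNormOn (hsub (m + 1) m) hy
  have he0 : ∀ m, 0 ≤ e m := fun m => by rw [he]; exact supNormOn_nonneg _ _
  set t : ℕ → ℝ := fun N => ‖f‖ * (2 : ℝ) ^ ((N : ℝ) * (Q - S)) * r ^ (q₂ - S) with ht
  have ht0 : ∀ N, 0 ≤ t N := fun N => by positivity
  have htsum : Summable t := ((summable_two_rpow hQS).mul_left _).mul_right _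
  -- The local estimate for orders in one dyadic block, with all powers of `ν` replaced by powers of
  -- `2^N`.
  have bound : ∀ (N : ℕ) (ν : ℝ), cstar * 2 ^ N ≤ ν → ν ≤ cstar * 2 ^ (N + 1) →
      ∀ (g : C(X₂, ℝ)) (F : ℝ), ‖g‖ ≤ (1 + 2 * C₂) * ‖f‖ → 0 ≤ F → (∀ y ∈ A, |g y| ≤ F) →
      ∀ x ∈ B, |J.sigmaPoly h ν g x| ≤ C₃ * ((2 : ℝ) ^ ((N : ℝ) * (Q - q₂)) * F + t N) := by
    intro N ν h1 h2 g F hg hF hgA x hx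
    have hν : cstar ≤ ν := le_trans (le_mul_of_one_le_right hc.le (one_le_pow₀ one_le_two)) h1
    have hν0 : 0 < ν := hc.trans_le hν
    refine ((hJ ν hν g x).2 A r F hr hF hgA (hB x hx)).trans ?_
    have e1 := rpow_le_of_mem_dyadic hc h1 h2 (Q - q₂)
    have e2 := rpow_le_of_mem_dyadic hc h1 h2 (Q - S)
    have hX : 0 ≤ (2 : ℝ) ^ ((N : ℝ) * (Q - q₂)) * F := by positivity
    calc C₁ * (F * ν ^ (Q - q₂) + ‖g‖ * (ν ^ (Q - S) * r ^ (q₂ - S)))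
        ≤ C₁ * (F * (a * (2 : ℝ) ^ ((N : ℝ) * (Q - q₂))) +
          ((1 + 2 * C₂) * ‖f‖) * (b * (2 : ℝ) ^ ((N : ℝ) * (Q - S)) * r ^ (q₂ - S))) := by gcongr
      _ = C₁ * (a * ((2 : ℝ) ^ ((N : ℝ) * (Q - q₂)) * F) + (1 + 2 * C₂) * b * t N) := by
          simp only [ht]; ring
      _ ≤ C₁ * ((a + (1 + 2 * C₂) * b) * ((2 : ℝ) ^ ((N : ℝ) * (Q - q₂)) * F) +
          (a + (1 + 2 * C₂) * b) * t N) := by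
          have h3 : 0 ≤ (1 + 2 * C₂) * b := by positivity
          have := ht0 N
          gcongr <;> linarith
      _ = _ := by rw [hC₃]; ring
  have hPle : ∀ m n, ‖P m - P n‖ ≤ (1 + 2 * C₂) * ‖f‖ := fun m n =>
    (hPP m n).trans (by linarith [norm_nonneg f])
  have hpres : ∀ (m : ℕ) (ν : ℝ), cstar * 2 ^ m ≤ ν →
      J.sigmaPoly h ν (P m) = J.sigmaPoly h (cstar * 2 ^ m) (P m) := fun m ν hν =>
    hpp.sigmaPoly_eq hh (Ξ₂.sigmaPoly_mem h _ f) hν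
  have hmono : ∀ {m n : ℕ}, m ≤ n → cstar * 2 ^ m ≤ cstar * 2 ^ n := fun hmn =>
    mul_le_mul_of_nonneg_left (pow_le_pow_right₀ one_le_two hmn) hc.le
  set G : ℕ → X₁ → ℝ := fun m x => J.sigmaPoly h (cstar * 2 ^ m) (P m) x with hG
  set w : ℕ → ℝ := fun m => (2 : ℝ) ^ ((m : ℝ) * (Q - q₂)) * e m with hw
  have hw0 : ∀ m, 0 ≤ w m := fun m => mul_nonneg (by positivity) (he0 m)
  have hinc : ∀ m, ∀ x ∈ B, dist (G m x) (G (m + 1) x) ≤ C₃ * (w m + t m) := by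
    intro m x hx
    have h1 : G (m + 1) x - G m x = J.sigmaPoly h (cstar * 2 ^ (m + 1)) (P (m + 1) - P m) x := by
      rw [map_sub, hpres m _ (hmono (Nat.le_succ m))]
      rfl
    rw [dist_comm, Real.dist_eq, h1]
    exact bound m _ (hmono (Nat.le_succ m)) le_rfl _ (e m) (hPle _ _) (he0 m) (heA m) x hx
  have hdsum : Summable fun m => C₃ * (w m + t m) := (hsum.add htsum).mul_left _
  have hlim : ∀ x ∈ B, ∃ l, Tendsto (fun m => G m x) atTop (𝓝 l) := fun x hx =>
    cauchySeq_tendsto_of_complete (cauchySeq_of_dist_le_of_summable _ (fun m => hinc m x hx) hdsum)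
  classical
  -- The function `g` is a limit on `B` only; its values elsewhere are arbitrary.
  choose! g hg using hlim
  have hgG : ∀ N, ∀ x ∈ B, |G N x - g x| ≤ ∑' i, C₃ * (w (N + i) + t (N + i)) := fun N x hx =>
    dist_le_tsum_of_dist_le_of_tendsto _ (fun m => hinc m x hx) hdsum (hg x hx) N
  -- This controls intermediate orders. If `Q ≥ q₂`, the weight increases with the index, and a tail
  -- of the summable series bounds the oscillation. If `Q < q₂`, the weight itself tends to 0 and
  -- the trivial bound suffices.
  obtain ⟨η, hη, hηb⟩ : ∃ η : ℕ → ℝ, Tendsto η atTop (𝓝 0) ∧ ∀ N M : ℕ, N ≤ M → ∀ y ∈ A,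
      (2 : ℝ) ^ ((N : ℝ) * (Q - q₂)) * |P M y - P N y| ≤ η N := by
    rcases le_or_gt q₂ Q with hq | hq
    · refine ⟨fun N => ∑' i, w (i + N), tendsto_sum_nat_add w, fun N M hNM y hy => ?_⟩
      have h1 : |P M y - P N y| ≤ ∑ i ∈ Finset.range (M - N), e (i + N) := by
        obtain ⟨k, rfl⟩ := Nat.exists_eq_add_of_le hNM
        rw [Nat.add_sub_cancel_left]
        clear hNM
        induction k with
        | zero => simp
        | succ k ih =>
          rw [Finset.sum_range_succ]
          have h2 := heA (N + k) y hy
          have h3 : P (N + (k + 1)) y - P N y =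
              (P (N + k) y - P N y) + (P (N + k + 1) y - P (N + k) y) := by
            rw [← add_assoc]; ring
          rw [h3, add_comm k N]
          exact (abs_add_le _ _).trans (add_le_add ih h2)
      calc _ ≤ (2 : ℝ) ^ ((N : ℝ) * (Q - q₂)) * ∑ i ∈ Finset.range (M - N), e (i + N) := by gcongr
        _ = ∑ i ∈ Finset.range (M - N), (2 : ℝ) ^ ((N : ℝ) * (Q - q₂)) * e (i + N) :=
            Finset.mul_sum _ _ _
        _ ≤ ∑ i ∈ Finset.range (M - N), w (i + N) := by
            refine Finset.sum_le_sum fun i _ => mul_le_mul_of_nonneg_right ?_ (he0 _)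
            refine Real.rpow_le_rpow_of_exponent_le one_le_two ?_
            refine mul_le_mul_of_nonneg_right ?_ (by linarith)
            exact_mod_cast Nat.le_add_left N i
        _ ≤ _ := ((summable_nat_add_iff N).2 hsum).sum_le_tsum _ fun i _ => hw0 _
    · refine ⟨fun N => (2 : ℝ) ^ ((N : ℝ) * (Q - q₂)) * (2 * C₂ * ‖f‖), ?_, fun N M _ y _ => ?_⟩
      · simpa using (summable_two_rpow (show Q - q₂ < 0 by linarith)).tendsto_atTop_zero.mul_const
          (2 * C₂ * ‖f‖)
      · exact mul_le_mul_of_nonneg_left (hsub M N y) (by positivity)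
  have hosc : ∀ (N : ℕ) (ν : ℝ), cstar * 2 ^ N ≤ ν → ν ≤ cstar * 2 ^ (N + 1) → ∀ x ∈ B,
      |J.sigmaPoly h ν f x - G N x| ≤ C₃ * (|η N| + t N) := by
    intro N ν h1 h2 x hx
    -- At the fixed order `ν`, `f` may be replaced by some `P M`. Comparing `P N` with `P M` rather
    -- than with `f` is essential, as `P N` need not converge to `f` on `A`.
    obtain ⟨M, hM, hNM⟩ := ((J.eventually_sigmaPoly_sigmaPoly hh ν f).and
      (eventually_ge_atTop N)).exists
    have h3 : J.sigmaPoly h ν f x - G N x = J.sigmaPoly h ν (P M - P N) x := by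
      rw [map_sub, hpres N ν h1, hM]; rfl
    have hpos : 0 < (2 : ℝ) ^ ((N : ℝ) * (Q - q₂)) := by positivity
    rw [h3]
    refine (bound N ν h1 h2 _ (|η N| / (2 : ℝ) ^ ((N : ℝ) * (Q - q₂))) (hPle _ _) (by positivity)
      (fun y hy => ?_) x hx).trans ?_
    · rw [le_div_iff₀ hpos, mul_comm]
      exact (hηb N M hNM y hy).trans (le_abs_self _)
    · rw [mul_div_cancel₀ _ hpos.ne']
  refine ⟨g, ?_, ?_⟩
  · set ζ : ℕ → ℝ := fun N => C₃ * (|η N| + t N) + ∑' i, C₃ * (w (i + N) + t (i + N)) with hζ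
    have hζ0 : Tendsto ζ atTop (𝓝 0) := by
      have h1 : Tendsto (fun N => C₃ * (|η N| + t N)) atTop (𝓝 0) := by
        simpa using ((hη.abs).add htsum.tendsto_atTop_zero).const_mul C₃
      simpa using h1.add (tendsto_sum_nat_add fun m => C₃ * (w m + t m))
    rw [Metric.tendstoUniformlyOn_iff]
    intro ε hε
    obtain ⟨N₀, hN₀⟩ := (hζ0.eventually_lt_const hε).exists_forall_of_atTop
    filter_upwards [eventually_ge_atTop (cstar * 2 ^ N₀)] with ν hν x hx
    -- The dyadic block is counted from `c* 2^N₀`, so that its index is automatically at least `N₀`.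
    obtain ⟨k, hk1, hk2⟩ := exists_dyadic (by positivity) hν
    have e1 : cstar * 2 ^ N₀ * 2 ^ k = cstar * 2 ^ (N₀ + k) := by rw [pow_add]; ring
    have e2 : cstar * 2 ^ N₀ * 2 ^ (k + 1) = cstar * 2 ^ (N₀ + k + 1) := by
      rw [add_assoc, pow_add _ N₀]; ring
    rw [e1] at hk1
    rw [e2] at hk2
    refine lt_of_le_of_lt ?_ (hN₀ (N₀ + k) (Nat.le_add_right _ _))
    rw [Real.dist_eq, abs_sub_comm]
    have h1 := hosc _ ν hk1 hk2 x hx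
    have h2 := hgG (N₀ + k) x hx
    simp_rw [add_comm (N₀ + k) _] at h2
    calc |J.sigmaPoly h ν f x - g x|
        = |(J.sigmaPoly h ν f x - G (N₀ + k) x) + (G (N₀ + k) x - g x)| := by ring_nf
      _ ≤ _ := (abs_add_le _ _).trans (add_le_add h1 h2)
  · intro n x hx
    set F := supNormOn A (fun y => f y - Ξ₂.sigmaPoly h (2 ^ n) f y) with hF
    have hfP : ‖f - P n‖ ≤ (1 + 2 * C₂) * ‖f‖ := by
      have := hPn n
      have h2 : 0 ≤ C₂ * ‖f‖ := by positivity
      exact (norm_sub_le _ _).trans (by linarith)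
    have h1 := bound n _ le_rfl (hmono (Nat.le_succ n)) (f - P n) F hfP
      (supNormOn_nonneg _ _) (fun y hy => abs_le_supNormOn
        (fun z => ((f - P n).norm_coe_le_norm z)) hy) x hx
    have h2 := hgG n x hx
    -- The error splits into the tail of the telescoping series and the joint operator applied to `f
    -- - P n`, the two sources of terms in the estimate.
    have e1 : g x - J.sigmaPoly h (cstar * 2 ^ n) f x =
        -(G n x - g x) - J.sigmaPoly h (cstar * 2 ^ n) (f - P n) x := by
      rw [map_sub, ContinuousMap.sub_apply]; simp only [hG]; ring
    have hshift : ∀ {v : ℕ → ℝ}, Summable v → Summable fun i => v (n + i) := fun {v} hv => by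
      simpa [add_comm] using (summable_nat_add_iff n).2 hv
    have e2 : ∑' i, C₃ * (w (n + i) + t (n + i)) = C₃ * (∑' i, w (n + i) + t n * Z) := by
      rw [tsum_mul_left, (hshift hsum).tsum_add (hshift htsum)]
      congr 2
      simp only [ht]
      rw [tsum_mul_right, tsum_mul_left, tsum_two_rpow_add]
      ring
    rw [e2] at h2
    have hW : 0 ≤ ∑' i, w (n + i) := tsum_nonneg fun i => hw0 _
    have hX : 0 ≤ (2 : ℝ) ^ ((n : ℝ) * (Q - q₂)) * F :=
      mul_nonneg (by positivity) (supNormOn_nonneg _ _)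
    rw [e1]
    calc |-(G n x - g x) - J.sigmaPoly h (cstar * 2 ^ n) (f - P n) x|
        ≤ |G n x - g x| + |J.sigmaPoly h (cstar * 2 ^ n) (f - P n) x| := by
          refine (abs_sub _ _).trans ?_
          rw [abs_neg]
      _ ≤ C₃ * (∑' i, w (n + i) + t n * Z) +
          C₃ * ((2 : ℝ) ^ ((n : ℝ) * (Q - q₂)) * F + t n) := add_le_add h2 h1
      _ ≤ C₃ * (1 + Z) * ((2 : ℝ) ^ ((n : ℝ) * (Q - q₂)) * F + t n + ∑' i, w (n + i)) := by
          have h3 : 0 ≤ C₃ * Z * ((2 : ℝ) ^ ((n : ℝ) * (Q - q₂)) * F) := by positivity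
          have h4 : 0 ≤ C₃ * Z * ∑' i, w (n + i) := by positivity
          linarith

end JointDataSpace

/-! ### Smoothness classes -/

namespace DataSpace

variable {X : Type*} [MetricSpace X] [CompactSpace X] [MeasurableSpace X] [BorelSpace X]

lemma degApprox_nonneg (Ξ : DataSpace X) (n : ℝ) (f : C(X, ℝ)) : 0 ≤ Ξ.degApprox n f :=
  Metric.infDist_nonneg

lemma diffusionPoly_nonempty (Ξ : DataSpace X) (n : ℝ) :
    (Ξ.diffusionPoly n : Set C(X, ℝ)).Nonempty := ⟨0, Submodule.zero_mem _⟩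

lemma degApprox_le (Ξ : DataSpace X) {n : ℝ} (f : C(X, ℝ)) {P : C(X, ℝ)}
    (hP : P ∈ Ξ.diffusionPoly n) : Ξ.degApprox n f ≤ ‖f - P‖ := by
  rw [← dist_eq_norm]; exact Metric.infDist_le_dist_of_mem hP

lemma degApprox_le_norm (Ξ : DataSpace X) (n : ℝ) (f : C(X, ℝ)) : Ξ.degApprox n f ≤ ‖f‖ := by
  simpa using Ξ.degApprox_le f (Submodule.zero_mem (Ξ.diffusionPoly n))

lemma exists_norm_sub_lt (Ξ : DataSpace X) {n : ℝ} {f : C(X, ℝ)} {b : ℝ}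
    (hb : Ξ.degApprox n f < b) : ∃ P ∈ Ξ.diffusionPoly n, ‖f - P‖ < b := by
  obtain ⟨P, hP, h⟩ := (Metric.infDist_lt_iff (Ξ.diffusionPoly_nonempty n)).1 hb
  exact ⟨P, hP, by rwa [← dist_eq_norm]⟩

lemma degApprox_anti (Ξ : DataSpace X) {m n : ℝ} (hmn : m ≤ n) (f : C(X, ℝ)) :
    Ξ.degApprox n f ≤ Ξ.degApprox m f :=
  Metric.infDist_le_infDist_of_subset (Ξ.diffusionPoly_mono hmn) (Ξ.diffusionPoly_nonempty m)

lemma degApprox_add_le (Ξ : DataSpace X) (n : ℝ) (f g : C(X, ℝ)) :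
    Ξ.degApprox n (f + g) ≤ Ξ.degApprox n f + Ξ.degApprox n g := by
  refine le_of_forall_pos_le_add fun ε hε => ?_
  obtain ⟨P, hP, h1⟩ := Ξ.exists_norm_sub_lt (show Ξ.degApprox n f < Ξ.degApprox n f + ε / 2 by
    linarith)
  obtain ⟨R, hR, h2⟩ := Ξ.exists_norm_sub_lt (show Ξ.degApprox n g < Ξ.degApprox n g + ε / 2 by
    linarith)
  refine (Ξ.degApprox_le _ (Submodule.add_mem _ hP hR)).trans ?_
  rw [add_sub_add_comm]
  exact (norm_add_le _ _).trans (by linarith)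

lemma MemW.exists_le {Ξ : DataSpace X} {γ : ℝ} {f : C(X, ℝ)} (hf : Ξ.MemW γ f) :
    ∃ C : ℝ, 0 ≤ C ∧ ∀ n : ℝ, 0 < n → Ξ.degApprox n f ≤ C * n ^ (-γ) := by
  obtain ⟨C, hC⟩ := hf.2
  have h : ∀ n : ℝ, 0 < n → n ^ γ * Ξ.degApprox n f ≤ C := fun n hn => hC ⟨n, hn, rfl⟩
  refine ⟨C, (mul_nonneg (by positivity) (Ξ.degApprox_nonneg _ _)).trans (h 1 one_pos),
    fun n hn => ?_⟩
  rw [Real.rpow_neg hn.le, ← div_eq_mul_inv, le_div_iff₀ (by positivity), mul_comm]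
  exact h n hn

/-- Orders below `n₁` are covered by `E_n(f) ≤ ‖f‖`, so only the asymptotic rate matters. -/
lemma memW_of_le (Ξ : DataSpace X) {γ : ℝ} (hγ : 0 < γ) {f : C(X, ℝ)} {C n₁ : ℝ} (hn₁ : 0 < n₁)
    (h : ∀ n : ℝ, n₁ ≤ n → Ξ.degApprox n f ≤ C * n ^ (-γ)) : Ξ.MemW γ f := by
  constructor
  · have h1 : Tendsto (fun n : ℝ => C * n ^ (-γ)) atTop (𝓝 0) := by
      simpa using (tendsto_rpow_neg_atTop hγ).const_mul C
    refine squeeze_zero' (Eventually.of_forall fun n => Ξ.degApprox_nonneg n f) ?_ h1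
    filter_upwards [eventually_ge_atTop n₁] with n hn using h n hn
  · refine ⟨max C (n₁ ^ γ * ‖f‖), ?_⟩
    rintro _ ⟨n, hn, rfl⟩
    have hn0 : 0 < n := hn
    rcases le_total n₁ n with h1 | h1
    · refine le_max_of_le_left ?_
      have h2 := h n h1
      rw [Real.rpow_neg hn0.le, ← div_eq_mul_inv, le_div_iff₀ (by positivity)] at h2
      simpa [mul_comm] using h2
    · refine le_max_of_le_right ?_
      exact mul_le_mul (Real.rpow_le_rpow hn0.le h1 hγ.le) (Ξ.degApprox_le_norm n f)
        (Ξ.degApprox_nonneg n f) (by positivity)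

lemma MemW.add {Ξ : DataSpace X} {γ : ℝ} (hγ : 0 < γ) {f g : C(X, ℝ)} (hf : Ξ.MemW γ f)
    (hg : Ξ.MemW γ g) : Ξ.MemW γ (f + g) := by
  obtain ⟨C, -, hC⟩ := hf.exists_le
  obtain ⟨D, -, hD⟩ := hg.exists_le
  refine Ξ.memW_of_le hγ one_pos (C := C + D) fun n hn => ?_
  have hn0 : 0 < n := by linarith
  refine (Ξ.degApprox_add_le n f g).trans ?_
  rw [add_mul]
  exact add_le_add (hC n hn0) (hD n hn0)

lemma memW_zero (Ξ : DataSpace X) {γ : ℝ} (hγ : 0 < γ) : Ξ.MemW γ 0 :=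
  Ξ.memW_of_le hγ one_pos (C := 0) fun n _ => by simpa using Ξ.degApprox_le_norm n 0

lemma isSmoothOn_sum (Ξ : DataSpace X) {B : Set X} {ι : Type*} (s : Finset ι) (f : ι → C(X, ℝ))
    (hf : ∀ i ∈ s, Ξ.IsSmoothOn B (f i)) : Ξ.IsSmoothOn B (∑ i ∈ s, f i) := by
  classical
  induction s using Finset.induction_on with
  | empty => exact ⟨fun γ hγ => by simpa using Ξ.memW_zero hγ, fun x _ => by simp⟩
  | insert i s hi ih =>
    rw [Finset.sum_insert hi]
    have h1 := hf i (Finset.mem_insert_self _ _)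
    have h2 := ih fun j hj => hf j (Finset.mem_insert_of_mem hj)
    exact ⟨fun γ hγ => (h1.1 γ hγ).add hγ (h2.1 γ hγ), fun x hx => by
      rw [ContinuousMap.add_apply, h1.2 x hx, h2.2 x hx, add_zero]⟩

/-- A smooth local cutoff function, from the partition of unity. -/
lemma MemWAt.exists_cutoff {Ξ : DataSpace X} (hpu : Ξ.HasPartitionOfUnity) {γ : ℝ} {x₀ : X}
    {f : C(X, ℝ)} (hf : Ξ.MemWAt γ x₀ f) :
    ∃ r : ℝ, 0 < r ∧ ∃ ψ : C(X, ℝ), (∀ y ∈ Metric.closedBall x₀ r, ψ y = 1) ∧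
      Ξ.MemW γ (ψ * f) := by
  obtain ⟨ρ, hρ, hφ⟩ := hf
  obtain ⟨ψ, c, N, hψ, -, hF⟩ := hpu (ρ / 3) (by positivity)
  obtain ⟨F, -, hF1⟩ := hF x₀
  classical
  -- Keep only the pieces centred within `2ρ/3` of `x₀`. Their supports stay in the ball of radius
  -- `ρ`, and the discarded pieces vanish on the ball of radius `ρ/3`, so the sum is still 1 there.
  refine ⟨ρ / 3, by positivity, ∑ k ∈ F with dist (c k) x₀ ≤ 2 * (ρ / 3), ψ k, fun y hy => ?_,
    hφ _ (Ξ.isSmoothOn_sum _ _ fun k hk => ?_)⟩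
  · rw [← hF1 y hy, ContinuousMap.sum_apply]
    refine Finset.sum_subset (Finset.filter_subset _ _) fun k hk hk' => (hψ k).2 y fun hyk => ?_
    refine hk' (Finset.mem_filter.2 ⟨hk, ?_⟩)
    rw [Metric.mem_closedBall] at hy hyk
    have := dist_triangle_left (c k) x₀ y
    linarith
  · refine ⟨(hψ k).1, fun x hx => (hψ k).2 x fun hxk => hx ?_⟩
    rw [Metric.mem_closedBall] at hxk ⊢
    have := dist_triangle x (c k) x₀
    have := (Finset.mem_filter.1 hk).2
    linarith

/-- `σ_n` is uniformly bounded and reproduces polynomials of order `n/2`, hence it approximates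
nearly as well as the best such polynomial. -/
lemma exists_norm_sub_sigmaPoly_const (Ξ : DataSpace X) {h : ℝ → ℝ} (hh : IsCutoff h) :
    ∃ C : ℝ, 0 < C ∧ ∀ n : ℝ, 1 ≤ n → ∀ f,
      ‖f - Ξ.sigmaPoly h n f‖ ≤ C * Ξ.degApprox (n / 2) f := by
  obtain ⟨C, hC, hb⟩ := (Ξ.exists_sigmaPoly_bound hh).1
  refine ⟨1 + C, by positivity, fun n hn f => ?_⟩
  have hn0 : 0 < n := by linarith
  rw [← div_le_iff₀' (by positivity), degApprox,
    Metric.le_infDist (Ξ.diffusionPoly_nonempty _)]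
  intro P hP
  rw [div_le_iff₀' (by positivity), dist_eq_norm]
  have h1 : f - Ξ.sigmaPoly h n f = (f - P) - Ξ.sigmaPoly h n (f - P) := by
    rw [map_sub, Ξ.sigmaPoly_of_mem hh hn0 hP]; abel
  rw [h1]
  have := hb n hn (f - P)
  refine (norm_sub_le _ _).trans ?_
  rw [add_mul, one_mul]
  linarith

/-- Local smoothness on a compact set is reflected by the rate of approximation by `σ_n`. -/
theorem MemWOn.exists_rate {Ξ : DataSpace X} {h : ℝ → ℝ} (hh : IsCutoff h)
    (hpu : Ξ.HasPartitionOfUnity) {γ : ℝ} {A : Set X} (hA : IsCompact A)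
    {f : C(X, ℝ)} (hf : Ξ.MemWOn γ A f) :
    ∃ C : ℝ, 0 ≤ C ∧ ∀ n : ℝ, 1 ≤ n → ∀ y ∈ A,
      |f y - Ξ.sigmaPoly h n f y| ≤ C * n ^ (-γ) := by
  refine hA.induction_on (p := fun s => ∃ C : ℝ, 0 ≤ C ∧ ∀ n : ℝ, 1 ≤ n → ∀ y ∈ s,
      |f y - Ξ.sigmaPoly h n f y| ≤ C * n ^ (-γ)) ?_ ?_ ?_ ?_
  · exact ⟨0, le_rfl, fun n _ y hy => absurd hy (notMem_empty y)⟩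
  · rintro s t hst ⟨C, hC, hb⟩
    exact ⟨C, hC, fun n hn y hy => hb n hn y (hst hy)⟩
  · rintro s t ⟨C, hC, hb⟩ ⟨D, hD, hd⟩
    refine ⟨C + D, by positivity, fun n hn y hy => ?_⟩
    have hp : 0 ≤ n ^ (-γ) := Real.rpow_nonneg (by linarith) _
    rcases hy with hy | hy
    · exact (hb n hn y hy).trans (by gcongr; linarith)
    · exact (hd n hn y hy).trans (by gcongr; linarith)
  · intro x₀ hx₀
    obtain ⟨r, hr, ψ, hψ1, hψW⟩ := (hf x₀ hx₀).exists_cutoff hpu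
    obtain ⟨C₁, hC₁, h1⟩ := hψW.exists_le
    obtain ⟨C₂, hC₂, h2⟩ := Ξ.exists_norm_sub_sigmaPoly_const hh
    obtain ⟨C₃, hC₃, h3⟩ := (Ξ.exists_sigmaPoly_bound hh).2 γ (r / 2) (by positivity)
    -- Near `x₀`, `f` agrees with the globally smooth `ψ * f`. The remainder `k` vanishes on the
    -- ball of radius `r`, so for `y` within `r/2` the operator sees it only through its rapidly
    -- decaying tail.
    set k : C(X, ℝ) := f - ψ * f with hk
    refine ⟨Metric.ball x₀ (r / 2), mem_nhdsWithin_of_mem_nhds (Metric.ball_mem_nhds _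
      (by positivity)), C₂ * (C₁ * (1 / 2) ^ (-γ)) + C₃ * ‖k‖, by positivity, fun n hn y hy => ?_⟩
    have hn0 : 0 < n := by linarith
    rw [Metric.mem_ball] at hy
    have hz : ∀ z ∈ Metric.closedBall x₀ r, k z = 0 := fun z hz => by
      simp [hk, hψ1 z hz]
    have hy0 : k y = 0 := hz y (by rw [Metric.mem_closedBall]; linarith)
    have e1 : f y - Ξ.sigmaPoly h n f y =
        (ψ * f - Ξ.sigmaPoly h n (ψ * f)) y - Ξ.sigmaPoly h n k y := by
      have e2 : f = ψ * f + k := by rw [hk]; abel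
      have e3 : Ξ.sigmaPoly h n f = Ξ.sigmaPoly h n (ψ * f) + Ξ.sigmaPoly h n k := by
        rw [← map_add, ← e2]
      have e4 : f y = (ψ * f) y := by
        conv_lhs => rw [e2]
        rw [ContinuousMap.add_apply, hy0, add_zero]
      rw [e3, e4, ContinuousMap.add_apply, ContinuousMap.sub_apply]; ring
    have b1 : |(ψ * f - Ξ.sigmaPoly h n (ψ * f)) y| ≤ C₂ * (C₁ * (1 / 2) ^ (-γ)) * n ^ (-γ) := by
      refine ((ContinuousMap.norm_coe_le_norm _ y).trans (h2 n hn _)).trans ?_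
      have := h1 (n / 2) (by positivity)
      rw [show n / 2 = 1 / 2 * n by ring, Real.mul_rpow (by norm_num) hn0.le] at this
      rw [show n / 2 = 1 / 2 * n by ring]
      calc _ ≤ C₂ * (C₁ * ((1 / 2) ^ (-γ) * n ^ (-γ))) := by gcongr
        _ = _ := by ring
    have b2 := h3 n hn k y fun z hzy => hz z (by
      rw [Metric.mem_closedBall] at hzy ⊢
      have := dist_triangle z y x₀
      linarith)
    rw [e1]
    refine (abs_sub _ _).trans ?_
    rw [add_mul]
    exact add_le_add b1 b2

/-- Products of a smooth function with a function that is well approximated by polynomials on the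
support. -/
theorem StrongProduct.exists_memW {Ξ : DataSpace X} (hsp : Ξ.StrongProduct) {β Q b : ℝ}
    (hβ : 0 < β) (hQ : 0 ≤ Q) (hb : 0 < b) {B : Set X} {φ : C(X, ℝ)} (hφ : Ξ.IsSmoothOn B φ)
    {g : X → ℝ} {R : ℕ → C(X, ℝ)} {C D : ℝ} (hR : ∀ N, R N ∈ Ξ.diffusionPoly (b * 2 ^ N))
    (hRD : ∀ N, ‖R N‖ ≤ D * (2 : ℝ) ^ ((N : ℝ) * Q))
    (hC : 0 ≤ C) (hD : 0 ≤ D)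
    (hg : ∀ N, ∀ x ∈ B, |g x - R N x| ≤ C * (2 : ℝ) ^ ((N : ℝ) * (-β))) :
    ∃ G : C(X, ℝ), (∀ x ∈ B, G x = φ x * g x) ∧ (∀ x, x ∉ B → G x = 0) ∧ Ξ.MemW β G := by
  classical
  have h2 : ∀ N : ℕ, 0 < (2 : ℝ) ^ ((N : ℝ) * (-β)) := fun N => by positivity
  set G : X → ℝ := fun x => if x ∈ B then φ x * g x else 0 with hGdef
  have hGR : ∀ N x, |G x - φ x * R N x| ≤ ‖φ‖ * (C * (2 : ℝ) ^ ((N : ℝ) * (-β))) := by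
    intro N x
    by_cases hx : x ∈ B
    · simp only [hGdef, if_pos hx]
      rw [← mul_sub, abs_mul]
      exact mul_le_mul (φ.norm_coe_le_norm x) (hg N x hx) (abs_nonneg _) (norm_nonneg _)
    · simp only [hGdef, if_neg hx, hφ.2 x hx, zero_mul, sub_zero, abs_zero]
      have := h2 N
      positivity
  have hdecay : Tendsto (fun N : ℕ => ‖φ‖ * (C * (2 : ℝ) ^ ((N : ℝ) * (-β)))) atTop (𝓝 0) := by
    have := (summable_two_rpow (neg_lt_zero.2 hβ)).tendsto_atTop_zero
    simpa using (this.const_mul C).const_mul ‖φ‖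
  have hGc : Continuous G := by
    have hunif : TendstoUniformly (fun (N : ℕ) x => φ x * R N x) G atTop := by
      rw [Metric.tendstoUniformly_iff]
      intro ε hε
      filter_upwards [hdecay.eventually_lt_const hε] with N hN x
      exact (hGR N x).trans_lt hN
    exact hunif.continuous (Eventually.of_forall fun N => by fun_prop).frequently
  refine ⟨⟨G, hGc⟩, fun x hx => if_pos hx, fun x hx => if_neg hx, ?_⟩
  obtain ⟨a, ha, hprod⟩ := hsp
  -- `R N` may grow like `2^(NQ)` away from `B`, so `φ` is approximated at the faster rate `β + Q`
  -- to absorb this growth.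
  obtain ⟨E, hE, hφE⟩ := (hφ.1 (β + Q) (by linarith)).exists_le
  -- The product assumption concerns integer orders. The integer `m * 2^N` bounds both `2^N`, the
  -- order for `φ`, and `b * 2^N`, the order of `R N`.
  set m := ⌈max b 1⌉₊ with hm
  have hmb : b ≤ m := (le_max_left b 1).trans (Nat.le_ceil _)
  have hm1 : (1 : ℝ) ≤ m := (le_max_right b 1).trans (Nat.le_ceil _)
  have hm0 : 0 < m := by
    have : (0 : ℝ) < m := by linarith
    exact_mod_cast this
  set n₁ := a * m with hn₁
  have hn₁0 : 0 < n₁ := by positivity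
  set F := ‖φ‖ * C + (E + 1) * D with hF
  have hF0 : 0 ≤ F := by positivity
  have hdyad : ∀ N : ℕ, Ξ.degApprox (n₁ * 2 ^ N) ⟨G, hGc⟩ ≤ F * (2 : ℝ) ^ ((N : ℝ) * (-β)) := by
    intro N
    have h2N : (0 : ℝ) < 2 ^ N := by positivity
    have e1 : ((2 : ℝ) ^ N) ^ (-(β + Q)) = (2 : ℝ) ^ ((N : ℝ) * (-(β + Q))) := by
      rw [← Real.rpow_natCast, ← Real.rpow_mul (by norm_num)]
    have hp : 0 < (2 : ℝ) ^ ((N : ℝ) * (-(β + Q))) := by positivity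
    obtain ⟨T, hT, hφT⟩ := Ξ.exists_norm_sub_lt (n := 2 ^ N) (f := φ)
      (b := (E + 1) * (2 : ℝ) ^ ((N : ℝ) * (-(β + Q)))) (by
        have := hφE (2 ^ N) h2N
        rw [e1] at this
        nlinarith)
    have hTR : T * R N ∈ Ξ.diffusionPoly (n₁ * 2 ^ N) := by
      have := hprod (m * 2 ^ N) (by positivity) T
        (Ξ.diffusionPoly_mono (by push_cast; nlinarith) hT) (R N)
        (Ξ.diffusionPoly_mono (by push_cast; gcongr) (hR N))
      push_cast at this
      rwa [← mul_assoc] at this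
    refine (Ξ.degApprox_le _ hTR).trans ?_
    rw [ContinuousMap.norm_le _ (mul_nonneg hF0 (h2 N).le)]
    intro x
    have e2 : (⟨G, hGc⟩ - T * R N : C(X, ℝ)) x =
        (G x - φ x * R N x) + (φ - T) x * R N x := by
      simp only [ContinuousMap.sub_apply, ContinuousMap.mul_apply, ContinuousMap.coe_mk]; ring
    have e3 : (2 : ℝ) ^ ((N : ℝ) * (-(β + Q))) * (2 : ℝ) ^ ((N : ℝ) * Q) =
        (2 : ℝ) ^ ((N : ℝ) * (-β)) := by
      rw [← Real.rpow_add (by norm_num)]; congr 1; ring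
    have b1 : |(φ - T) x * R N x| ≤ (E + 1) * D * (2 : ℝ) ^ ((N : ℝ) * (-β)) := by
      rw [abs_mul]
      calc |(φ - T) x| * |R N x| ≤ ((E + 1) * (2 : ℝ) ^ ((N : ℝ) * (-(β + Q)))) *
            (D * (2 : ℝ) ^ ((N : ℝ) * Q)) :=
            mul_le_mul (((φ - T).norm_coe_le_norm x).trans hφT.le)
              (((R N).norm_coe_le_norm x).trans (hRD N)) (abs_nonneg _) (by positivity)
        _ = _ := by rw [← e3]; ring
    rw [e2, Real.norm_eq_abs]
    refine (abs_add_le _ _).trans ((add_le_add (hGR N x) b1).trans (le_of_eq ?_))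
    rw [hF]; ring
  refine Ξ.memW_of_le hβ hn₁0 (C := F * (2 * n₁) ^ β) fun n hn => ?_
  obtain ⟨N, hN1, hN2⟩ := exists_dyadic hn₁0 hn
  have hn0 : 0 < n := hn₁0.trans_le hn
  refine (Ξ.degApprox_anti hN1 _).trans ((hdyad N).trans ?_)
  rw [mul_assoc]
  refine mul_le_mul_of_nonneg_left ?_ hF0
  have h3 := Real.rpow_le_rpow_of_nonpos hn0 hN2 (neg_nonpos.2 hβ.le)
  rw [show n₁ * 2 ^ (N + 1) = 2 * n₁ * 2 ^ N by ring, mul_two_pow_rpow (by positivity)] at h3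
  calc (2 : ℝ) ^ ((N : ℝ) * (-β))
      = (2 * n₁) ^ β * ((2 * n₁) ^ (-β) * (2 : ℝ) ^ ((N : ℝ) * (-β))) := by
        rw [← mul_assoc, ← Real.rpow_add (by positivity)]; simp
    _ ≤ _ := by gcongr

end DataSpace

end LocalTransfer

end

/-! ### Assembly of the convergence, error and smoothness statements. -/

theorem mainTheorem7 {X₁ X₂ : Type*}
    [MetricSpace X₁] [CompactSpace X₁] [MeasurableSpace X₁] [BorelSpace X₁]
    [MetricSpace X₂] [CompactSpace X₂] [MeasurableSpace X₂] [BorelSpace X₂]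
    (Ξ₁ : LocalTransfer.DataSpace X₁) (Ξ₂ : LocalTransfer.DataSpace X₂) (Q q₁ q₂ : ℝ)
    (J : LocalTransfer.JointDataSpace Ξ₁ Ξ₂ Q q₁ q₂)
    (h : ℝ → ℝ) (hh : LocalTransfer.IsCutoff h)
    (S : ℕ) (hS : max Q (max q₁ q₂) + 1 < (S : ℝ))
    (cstar : ℝ) (hpp : J.PolynomialPreservation h cstar)
    (hpu : Ξ₂.HasPartitionOfUnity) :
    ∃ C : ℝ, 0 < C ∧
      ∀ (r s : ℝ), 0 < r → 0 < s → ∀ (A : Set X₂) (B : Set X₁), IsCompact A →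
      J.IsImageSet r s A B →
      ∀ f : C(X₂, ℝ),
      Summable (fun m : ℕ => (2 : ℝ) ^ ((m : ℝ) * (Q - q₂)) * LocalTransfer.supNormOn A
        (fun x => Ξ₂.sigma h (2 ^ (m + 1)) f x - Ξ₂.sigma h (2 ^ m) f x)) →
      -- (a) existence of the lifted function on `B`
      TendstoUniformlyOn (fun (n : ℝ) (x : X₁) => J.sigma h n f x) (J.lift h f) atTop B ∧
      -- (a) error bound, in the supremum norm on `B`
      (∀ n : ℕ, 1 ≤ cstar * r * 2 ^ n → ∀ x ∈ B,
        |J.lift h f x - J.sigma h (cstar * 2 ^ n) f x| ≤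
          C * ((2 : ℝ) ^ ((n : ℝ) * (Q - q₂)) *
                LocalTransfer.supNormOn A (fun y => f y - Ξ₂.sigma h (2 ^ n) f y)
            + ‖f‖ * (2 : ℝ) ^ ((n : ℝ) * (Q - S)) * r ^ (q₂ - S)
            + ∑' i : ℕ, (2 : ℝ) ^ (((n + i : ℕ) : ℝ) * (Q - q₂)) * LocalTransfer.supNormOn A
                (fun y => Ξ₂.sigma h (2 ^ (n + i + 1)) f y - Ξ₂.sigma h (2 ^ (n + i)) f y))) ∧
      -- (a) the approximants are diffusion polynomials
      (∀ α : ℝ, 0 < α → (∀ j k, Ξ₁.lam j ≤ α * J.ell j k) → ∀ n : ℝ, 0 < n →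
        ∃ P ∈ Ξ₁.diffusionPoly (α * n), ∀ x, P x = J.sigma h n f x) ∧
      -- (b) continuity and smoothness of the lifted function
      (∀ γ : ℝ, 0 < γ → Q - q₂ < γ → γ < S - q₂ → Ξ₂.MemWOn γ A f →
        ContinuousOn (J.lift h f) B ∧
        (Ξ₁.StrongProduct → (∃ α : ℝ, 0 < α ∧ ∀ j k, Ξ₁.lam j ≤ α * J.ell j k) →
          ∀ φ : C(X₁, ℝ), Ξ₁.IsSmoothOn B φ →
            ∃ g : C(X₁, ℝ), (∀ x ∈ B, g x = φ x * J.lift h f x) ∧ (∀ x, x ∉ B → g x = 0) ∧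
              Ξ₁.MemW (γ - Q + q₂) g)) := by
  have hSQ : Q < S := by linarith [le_max_left Q (max q₁ q₂)]
  have hSq : q₂ < S := by
    linarith [(le_max_right q₁ q₂).trans (le_max_right Q (max q₁ q₂))]
  have hc := hpp.1
  have hσ : ∀ (f : C(X₂, ℝ)) (m : ℕ) (x : X₂),
      Ξ₂.sigma h (2 ^ m) f x = Ξ₂.sigmaPoly h (2 ^ m) f x := fun f m x =>
    Ξ₂.sigma_eq_sigmaPoly hh (by positivity) f x
  have hσJ : ∀ (f : C(X₂, ℝ)) (m : ℕ) (x : X₁),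
      J.sigma h (cstar * 2 ^ m) f x = J.sigmaPoly h (cstar * 2 ^ m) f x := fun f m x =>
    J.sigma_eq_sigmaPoly hh (by positivity) f x
  simp_rw [hσ, hσJ]
  obtain ⟨C, hC, hlift⟩ := J.exists_lift hh hSQ hSq hpp
  refine ⟨C, hC, fun r s hr hs A B hA hB f hsum => ?_⟩
  obtain ⟨g, hgu, hgb⟩ := hlift r A B hr (fun x hx y hy => hB.le_d hs hx hy) f _ (fun _ => rfl) hsum
  have hu : TendstoUniformlyOn (fun (n : ℝ) x => J.sigma h n f x) g atTop B := by
    refine hgu.congr ?_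
    filter_upwards [eventually_gt_atTop 0] with n hn x _
    exact (J.sigma_eq_sigmaPoly hh hn f x).symm
  -- Convergence along real orders makes `limUnder` take the actual limit on `B`.
  have hlg : EqOn (J.lift h f) g B := fun x hx => (hu.tendsto_at hx).limUnder_eq
  refine ⟨hu.congr_right hlg.symm, fun n _ x hx => ?_, fun α hα hlam n hn => ?_,
    fun γ hγ hγ1 hγ2 hfγ => ⟨?_, ?_⟩⟩
  · rw [hlg hx]
    exact hgb n x hx
  · exact ⟨J.sigmaPoly h n f, J.sigmaPoly_mem h hα hlam n f,
      fun x => (J.sigma_eq_sigmaPoly hh hn f x).symm⟩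
  · refine ContinuousOn.congr ?_ hlg
    exact hgu.continuousOn (Eventually.of_forall fun n => (map_continuous _).continuousOn).frequently
  · rintro hsp ⟨α, hα, hlam⟩ φ hφ
    obtain ⟨E, hE, hrate⟩ := hfγ.exists_rate hh hpu hA
    obtain ⟨K, hK, hJ⟩ := J.exists_sigmaPoly_bound hh hSq hc
    set β := γ - Q + q₂ with hβ
    have hβ0 : 0 < β := by rw [hβ]; linarith
    set Z := ∑' i : ℕ, (2 : ℝ) ^ ((i : ℝ) * (-β))
    have hrateA : ∀ m : ℕ, ∀ y ∈ A,
        |f y - Ξ₂.sigmaPoly h (2 ^ m) f y| ≤ E * (2 : ℝ) ^ ((m : ℝ) * (-γ)) := fun m y hy => by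
      have := hrate (2 ^ m) (one_le_pow₀ one_le_two) y hy
      rwa [← Real.rpow_natCast, ← Real.rpow_mul (by norm_num), Real.rpow_natCast] at this
    have hγβ : ∀ m : ℕ, (2 : ℝ) ^ ((m : ℝ) * (Q - q₂)) * (2 : ℝ) ^ ((m : ℝ) * (-γ)) =
        (2 : ℝ) ^ ((m : ℝ) * (-β)) := fun m => by
      rw [← Real.rpow_add (by norm_num)]; congr 1; rw [hβ]; ring
    -- Two consecutive approximations of `f` on `A` differ by at most the sum of their errors, hence
    -- the factor 2.
    have hinc : ∀ m : ℕ, (2 : ℝ) ^ ((m : ℝ) * (Q - q₂)) * LocalTransfer.supNormOn A (fun y =>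
        Ξ₂.sigmaPoly h (2 ^ (m + 1)) f y - Ξ₂.sigmaPoly h (2 ^ m) f y) ≤
        2 * E * (2 : ℝ) ^ ((m : ℝ) * (-β)) := fun m => by
      rw [← hγβ, mul_left_comm]
      refine mul_le_mul_of_nonneg_left (LocalTransfer.supNormOn_le (by positivity) ?_)
        (by positivity)
      intro y hy
      have h1 := hrateA m y hy
      have h2 := hrateA (m + 1) y hy
      have h3 : (2 : ℝ) ^ (((m + 1 : ℕ) : ℝ) * (-γ)) ≤ (2 : ℝ) ^ ((m : ℝ) * (-γ)) :=
        Real.rpow_le_rpow_of_exponent_le one_le_two (by push_cast; linarith)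
      have h4 := mul_le_mul_of_nonneg_left h3 hE
      have h5 : Ξ₂.sigmaPoly h (2 ^ (m + 1)) f y - Ξ₂.sigmaPoly h (2 ^ m) f y =
          (f y - Ξ₂.sigmaPoly h (2 ^ m) f y) - (f y - Ξ₂.sigmaPoly h (2 ^ (m + 1)) f y) := by ring
      rw [h5]
      refine (abs_sub _ _).trans ?_
      linarith
    have hsβ := LocalTransfer.summable_two_rpow (neg_lt_zero.2 hβ0)
    have herr : ∀ N : ℕ, ∀ x ∈ B, |g x - J.sigmaPoly h (cstar * 2 ^ N) f x| ≤
        C * (E + ‖f‖ * r ^ (q₂ - S) + 2 * E * Z) * (2 : ℝ) ^ ((N : ℝ) * (-β)) := by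
      intro N x hx
      refine (hgb N x hx).trans ?_
      have b1 : (2 : ℝ) ^ ((N : ℝ) * (Q - q₂)) * LocalTransfer.supNormOn A
          (fun y => f y - Ξ₂.sigmaPoly h (2 ^ N) f y) ≤ E * (2 : ℝ) ^ ((N : ℝ) * (-β)) := by
        rw [← hγβ, mul_left_comm]
        exact mul_le_mul_of_nonneg_left (LocalTransfer.supNormOn_le (by positivity) (hrateA N))
          (by positivity)
      -- This is where `γ < S - q₂` enters: it gives `Q - S ≤ -β`, so the off-`A` error does not
      -- spoil the rate.
      have b2 : (2 : ℝ) ^ ((N : ℝ) * (Q - S)) ≤ (2 : ℝ) ^ ((N : ℝ) * (-β)) := by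
        refine Real.rpow_le_rpow_of_exponent_le one_le_two ?_
        exact mul_le_mul_of_nonneg_left (by rw [hβ]; linarith) (Nat.cast_nonneg N)
      have b3 : ∑' i : ℕ, (2 : ℝ) ^ (((N + i : ℕ) : ℝ) * (Q - q₂)) * LocalTransfer.supNormOn A
          (fun y => Ξ₂.sigmaPoly h (2 ^ (N + i + 1)) f y - Ξ₂.sigmaPoly h (2 ^ (N + i)) f y) ≤
          2 * E * ((2 : ℝ) ^ ((N : ℝ) * (-β)) * Z) := by
        rw [← LocalTransfer.tsum_two_rpow_add, ← tsum_mul_left]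
        refine Summable.tsum_le_tsum (fun i => hinc (N + i)) ?_ ?_
        · simpa [add_comm] using (summable_nat_add_iff N).2 hsum
        · simpa [add_comm] using ((summable_nat_add_iff N).2 hsβ).mul_left (2 * E)
      have b4 : ‖f‖ * (2 : ℝ) ^ ((N : ℝ) * (Q - S)) * r ^ (q₂ - S) ≤
          ‖f‖ * (2 : ℝ) ^ ((N : ℝ) * (-β)) * r ^ (q₂ - S) := by gcongr
      rw [mul_assoc C]
      refine mul_le_mul_of_nonneg_left ?_ hC.le
      linarith
    have hZ : 0 ≤ Z := tsum_nonneg fun i => by positivity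
    -- The approximants have order `α c* 2^N`, and the global bound for the joint operator gives
    -- their growth `K ‖f‖ (c* 2^N)^Q`.
    obtain ⟨G, hG1, hG2, hG3⟩ := hsp.exists_memW (b := α * cstar) hβ0 J.Q_pos.le (by positivity)
      hφ (g := g) (R := fun N => J.sigmaPoly h (cstar * 2 ^ N) f)
      (C := C * (E + ‖f‖ * r ^ (q₂ - S) + 2 * E * Z)) (D := K * ‖f‖ * cstar ^ Q)
      (fun N => by
        rw [mul_assoc]; exact J.sigmaPoly_mem h hα hlam _ f)
      (fun N => by
        rw [ContinuousMap.norm_le _ (by positivity)]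
        intro x
        have := (hJ (cstar * 2 ^ N)
          (le_mul_of_one_le_right hc.le (one_le_pow₀ one_le_two)) f x).1
        rw [LocalTransfer.mul_two_pow_rpow hc, ← mul_assoc] at this
        exact this)
      (by positivity) (by positivity) herr
    exact ⟨G, fun x hx => by rw [hG1 x hx, hlg hx], hG2, hG3⟩
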